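/- For $k\in\mathbb Z/5$ put $n_k=(\cos(\tfrac\pi2+\tfrac{2k\pi}5),\sin(\tfrac\pi2+\tfrac{2k\pi}5))$. For $\gamma\in\mathbb R^5$ with $\sum_k\gamma_k\in\mathbb Z$ let $G_k=\{x\in\mathbb R^2: x\cdot n_k-\gamma_k\in\mathbb Z\}$, and call $\gamma$ regular if no point lies in three of the sets $G_0,\dots,G_4$. The tiling dual to a regular $\gamma$ consists, for all $i\ne j$ and $z\in G_i\cap G_j$, of the unit rhombus with edge vectors $n_i,n_j$ at the vertex $\sum_k\lceil z\cdot n_k-\gamma_k\rceil n_k$. A Penrose tiling is here a translate of such a tiling (the tilings that belong to non-regular $\gamma$ form a null set). Tiles are neighbors if they are distinct and share a side. Let $\Omega$ be the set of Penrose tilings $\omega$ in which the origin is the center of a tile; let $H_\omega\subset\mathbb R^2$ be the set of the centers of the tiles of $\omega$, $S_\omega$ the set of the (four) centers of the neighbors of the tile centered at $0$, $H=\bigcup_\omega H_\omega$, $S=\bigcup_\omega S_\omega$, and for $x\in H_\omega$ let $\tau_x\omega=\omega-x\in\Omega$. Up to a null set $\Omega$ is a union of ten tori: the torus of a pair $\{i,j\}$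 consists of the tilings dual to $\gamma$ with $\gamma_i=\gamma_j=0$, translated so that the tile of $z=0$ is centered at the origin, and it is parametrized by two of the other three $\gamma_k$ modulo $1$. Let $\mathbb P$ be the probability measure on $\Omega$ proportional to the sum of $\frac{1+\sqrt5}2$ times Lebesgue measure on the five tori with $j-i\equiv\pm1\pmod 5$ (thick tile at the origin) and Lebesgue measure on the five tori with $j-i\equiv\pm2\pmod 5$ (thin tile). Let $L^2$ be the space of $\mathbb R^2$-valued functions square integrable with respect to $\mathbb P$, and put $$(Qf)(\omega)=\tfrac14\sum_{e\in S_\omega}f(\tau_e\omega),\qquad V(\omega)=\tfrac14\sum_{e\in S_\omega}e .$$ **Theorem (existence of the corrector).** For every $\epsilon>0$ the equation $(1+\epsilon-Q)\psi_\epsilon=V$ ($\mathbb P$-almost everywhere) has a solution $\psi_\epsilon\in L^2$, unique up to null sets, and there is a function $\chi:H\times\Omega\to\mathbb R^2$ such that for every $x\in H$ $$\lim_{\epsilon\searrow0}\mathbf 1\{x\in H_\omega\}(\psi_\epsilon\circ\tau_x-\psi_\epsilon)=\chi(x,\cdot)\quad\text{in }L^2 .$$ Moreover: (1) For $\mathbb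 P$-almost every $\omega$, $\chi(x,\omega)-\chi(y,\omega)=\chi(x-y,\tau_y\omega)$ for all $x,y\in H_\omega$. (2) For $\mathbb P$-almost every $\omega$ the function $h(x)=x+\chi(x,\omega)$ is harmonic for the simple random walk on the tile centers, that is, $h(x)=\frac14\sum_{e\in S_{\tau_x\omega}}h(x+e)$ for all $x\in H_\omega$. (3) There is a constant $C<\infty$ with $$\big\|\mathbf 1\{x\in H_\omega\}\,\mathbf 1\{e\in S_{\tau_x\omega}\}\,(\chi(x+e,\omega)-\chi(x,\omega))\big\|_2<C\qquad\text{for all }x\in H,\ e\in S .$$ -/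

import Mathlib

open MeasureTheory Filter Topology
open scoped ENNReal NNReal

noncomputable section

namespace Penrose

/-! ### Pentagrids -/

/-- The Euclidean plane. -/
abbrev Plane : Type := EuclideanSpace ℝ (Fin 2)

/-- The unit vector `(cos (π/2 + 2kπ/5), sin (π/2 + 2kπ/5))`, normal to the lines of the `k`-th
grid. -/
def normal (k : Fin 5) : Plane :=
  !₂[Real.cos (Real.pi / 2 + 2 * (k.val : ℝ) * Real.pi / 5),
     Real.sin (Real.pi / 2 + 2 * (k.val : ℝ) * Real.pi / 5)]

/-- The `k`-th grid of the pentagrid with offsets `γ`: a family of equidistant parallel lines. -/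
def grid (γ : Fin 5 → ℝ) (k : Fin 5) : Set Plane :=
  {x | ∃ n : ℤ, inner ℝ x (normal k) - γ k = n}

/-- No point of the plane lies on three lines of the pentagrid. -/
def Regular (γ : Fin 5 → ℝ) : Prop :=
  ∀ i j k : Fin 5, i ≠ j → j ≠ k → i ≠ k → ∀ x : Plane,
    ¬ (x ∈ grid γ i ∧ x ∈ grid γ j ∧ x ∈ grid γ k)

/-! ### Rhombi and the tiling dual to a pentagrid -/

/-- Difference of the two edge directions: `1` for a thick rhombus (angles `2π/5`, `3π/5`),
`2` for a thin one (angles `4π/5`, `π/5`). -/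
def step (thick : Bool) : Fin 5 := if thick then 1 else 2

/-- A unit rhombus with edges parallel to `normal first` and `normal (first + step thick)`. Each
unordered pair of distinct directions arises from exactly one choice of `first`, `thick`. -/
@[ext]
structure Rhombus where
  corner : Plane
  first : Fin 5
  thick : Bool

namespace Rhombus

/-- The index of the second edge direction. -/
def second (R : Rhombus) : Fin 5 := R.first + step R.thick

/-- The center of the rhombus. -/
def center (R : Rhombus) : Plane :=
  R.corner + (1 / 2 : ℝ) • (normal R.first + normal R.second)

/-- The four sides, each one given as the unordered pair of its endpoints. -/
def sides (R : Rhombus) : Set (Sym2 Plane) :=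
  {s(R.corner, R.corner + normal R.first),
   s(R.corner, R.corner + normal R.second),
   s(R.corner + normal R.first, R.corner + normal R.first + normal R.second),
   s(R.corner + normal R.second, R.corner + normal R.first + normal R.second)}

/-- Two different rhombi are neighbors if they have a common side. -/
def Neighbor (R R' : Rhombus) : Prop := R ≠ R' ∧ (R.sides ∩ R'.sides).Nonempty

/-- The rhombus moved by the vector `-x`, so that the point `x` goes to the origin. -/
def moveToOrigin (x : Plane) (R : Rhombus) : Rhombus := { R with corner := R.corner - x }

end Rhombus

/-- The vertex `∑ₖ ⌈z · nₖ - γₖ⌉ nₖ` dual to the point `z` of the plane (`nₖ = normal k`). -/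
def dualVertex (γ : Fin 5 → ℝ) (z : Plane) : Plane :=
  ∑ k : Fin 5, ((⌈inner ℝ z (normal k) - γ k⌉ : ℤ) : ℝ) • normal k

/-- The tiling dual to a pentagrid: each intersection `z` of a line of the `i`-th grid with a line
of the `j`-th grid gives the rhombus with edges `normal i`, `normal j`, whose vertices are dual to
the four cells of the pentagrid around `z`. -/
def dualTiling (γ : Fin 5 → ℝ) : Set Rhombus :=
  {R | ∃ z : Plane, z ∈ grid γ R.first ∧ z ∈ grid γ R.second ∧ R.corner = dualVertex γ z}

/-- A Penrose tiling: a translate of the dual of a regular pentagrid with integral total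
offset. -/
def IsPenroseTiling (T : Set Rhombus) : Prop :=
  ∃ γ : Fin 5 → ℝ, (∃ n : ℤ, ∑ k, γ k = n) ∧ Regular γ ∧
    ∃ v : Plane, T = Rhombus.moveToOrigin v '' dualTiling γ

/-! ### Configurations -/

/-- The set `Ω` of Penrose tilings in which the origin is the center of a tile. -/
@[ext]
structure Config where
  tiles : Set Rhombus
  isPenrose : IsPenroseTiling tiles
  rooted : ∃ R ∈ tiles, R.center = 0

/-- `H_ω`: the centers of the tiles of `ω`. -/
def centers (ω : Config) : Set Plane := Rhombus.center '' ω.tiles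

/-- `S_ω`: the centers of the tiles neighboring the tile centered at the origin. -/
def nbrs (ω : Config) : Set Plane :=
  {e | ∃ R ∈ ω.tiles, ∃ R' ∈ ω.tiles, R.center = 0 ∧ R'.center = e ∧ R.Neighbor R'}

/-- `H`: all points that occur as the center of a tile in some configuration. -/
def allCenters : Set Plane := {x | ∃ ω : Config, x ∈ centers ω}

/-- `S`: all vectors from the center of a tile to the center of a neighboring tile. -/
def allSteps : Set Plane := {e | ∃ ω : Config, e ∈ nbrs ω}

theorem isPenroseTiling_moveToOrigin {T : Set Rhombus} (hT : IsPenroseTiling T) (x : Plane) :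
    IsPenroseTiling (Rhombus.moveToOrigin x '' T) := by
  obtain ⟨γ, hs, hr, v, rfl⟩ := hT
  refine ⟨γ, hs, hr, v + x, ?_⟩
  rw [Set.image_image]
  refine Set.image_congr fun R _ => ?_
  simp [Rhombus.moveToOrigin, sub_sub]

theorem center_moveToOrigin (x : Plane) (R : Rhombus) :
    (R.moveToOrigin x).center = R.center - x := by
  simp only [Rhombus.center, Rhombus.moveToOrigin, Rhombus.second]
  abel

open Classical in
/-- `τ_x ω`: the configuration shifted so that the center `x ∈ H_ω` moves to the origin
(by convention `ω` itself if `x ∉ H_ω`). -/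
def shift (x : Plane) (ω : Config) : Config :=
  if h : x ∈ centers ω then
    { tiles := Rhombus.moveToOrigin x '' ω.tiles
      isPenrose := isPenroseTiling_moveToOrigin ω.isPenrose x
      rooted := by
        obtain ⟨R, hR, rfl⟩ := h
        exact ⟨R.moveToOrigin R.center, Set.mem_image_of_mem _ hR, by
          rw [center_moveToOrigin, sub_self]⟩ }
  else ω

/-! ### The shift-invariant probability measure

A configuration is parametrized by the type `(i, thick)` of the tile at the origin, i.e. by the
pair `i, j = i + step thick` of grids that meet at the origin of the pentagrid, and by the offsets
of two of the three remaining grids, in `[0,1)`. So `Ω` is, up to a null set, a union of ten tori. -/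

/-- Raw parameters. -/
abbrev RawParam : Type := (Fin 5 × Bool) × (ℝ × ℝ)

/-- The offsets of the pentagrid: `γ_i = γ_j = 0`, the given values at `i + 3` and `i + 4`, and
`γ_l = 1 - γ_{i+3} - γ_{i+4}` at the remaining index `l`. -/
def offsets (p : RawParam) (k : Fin 5) : ℝ :=
  if k = p.1.1 + 3 then p.2.1
  else if k = p.1.1 + 4 then p.2.2
  else if k = p.1.1 ∨ k = p.1.1 + step p.1.2 then 0
  else 1 - p.2.1 - p.2.2

/-- The parameters that give a regular pentagrid. -/
abbrev Param : Type := ({p : RawParam | Regular (offsets p)} : Set RawParam)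

/-- The tile dual to the intersection at the origin of the pentagrid. -/
def rootTile (p : RawParam) : Rhombus where
  corner := dualVertex (offsets p) 0
  first := p.1.1
  thick := p.1.2

theorem sum_offsets (p : RawParam) : ∑ k, offsets p k = 1 := by
  obtain ⟨⟨i, t⟩, a, b⟩ := p
  fin_cases i <;> cases t <;> simp [offsets, step, Fin.sum_univ_five] <;> ring

theorem rootTile_mem (p : RawParam) : rootTile p ∈ dualTiling (offsets p) := by
  refine ⟨0, ⟨0, ?_⟩, ⟨0, ?_⟩, rfl⟩
  · obtain ⟨⟨i, t⟩, a, b⟩ := p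
    fin_cases i <;> simp [offsets, rootTile]
  · obtain ⟨⟨i, t⟩, a, b⟩ := p
    fin_cases i <;> cases t <;> simp [offsets, rootTile, Rhombus.second, step]

/-- The configuration with given parameters: the tiling dual to the pentagrid, translated so that
the tile dual to the origin of the pentagrid is centered at the origin of the plane. -/
def configOf (p : Param) : Config where
  tiles := Rhombus.moveToOrigin (rootTile p.1).center '' dualTiling (offsets p.1)
  isPenrose := ⟨offsets p.1, ⟨1, by simp [sum_offsets]⟩, p.2, _, rfl⟩
  rooted := ⟨_, Set.mem_image_of_mem _ (rootTile_mem p.1), by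
    rw [center_moveToOrigin, sub_self]⟩

/-- The σ-algebra on `Ω` transported from the Borel σ-algebra of the parameters. -/
instance : MeasurableSpace Config := MeasurableSpace.map configOf inferInstance

/-- Weight of each of the ten tori: the five tori of thick tiles have relative weight
`(1 + √5) / 2`, the five tori of thin tiles have relative weight `1`. -/
def weight (thick : Bool) : ℝ≥0∞ :=
  ENNReal.ofReal ((if thick then Real.goldenRatio else 1) / (5 * Real.goldenRatio + 5))

/-- The weighted sum of Lebesgue measures on the ten tori, identified with `[0,1)²`. -/
def rawMeasure : Measure RawParam :=
  (∑ t : Fin 5 × Bool, weight t.2 • Measure.dirac t).prod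
    (volume.restrict (Set.Ico (0 : ℝ) 1 ×ˢ Set.Ico (0 : ℝ) 1))

/-- The shift-invariant probability measure `ℙ` on `Ω`. -/
def prob : Measure Config :=
  Measure.map configOf (Measure.comap Subtype.val rawMeasure)

/-! ### The random walk -/

open Classical in
/-- The transition probability `P_ω(X_{n+1} = x + e | X_n = x)` of the simple random walk. -/
def transProb (ω : Config) (x e : Plane) : ℝ := if e ∈ nbrs (shift x ω) then 1 / 4 else 0

/-- `f` is harmonic on the vertices of `ω` for the simple random walk. -/
def IsHarmonic (ω : Config) (f : Plane → Plane) : Prop :=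
  ∀ x ∈ centers ω, f x = ∑ᶠ e : Plane, transProb ω x e • f (x + e)

/-- The Markov operator `(Qf)(ω) = (1/4) ∑_{e ∈ S_ω} f(τ_e ω)` of the walk on `Ω`. -/
def markovOp (f : Config → Plane) (ω : Config) : Plane :=
  (1 / 4 : ℝ) • ∑ᶠ e ∈ nbrs ω, f (shift e ω)

/-- The drift at the origin `V(ω) = (1/4) ∑_{e ∈ S_ω} e`. -/
def drift (ω : Config) : Plane := (1 / 4 : ℝ) • ∑ᶠ e ∈ nbrs ω, e

/-- `ψ ∈ L²(Ω)` and `(1 + ε - Q) ψ = V`. -/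
def SolvesResolvent (ε : ℝ) (ψ : Config → Plane) : Prop :=
  MemLp ψ 2 prob ∧ ∀ᵐ ω ∂prob, (1 + ε) • ψ ω - markovOp ψ ω = drift ω

open Classical in
/-- The function `1{x ∈ H_ω} (ψ ∘ τ_x - ψ)`. -/
def increment (ψ : Config → Plane) (x : Plane) (ω : Config) : Plane :=
  if x ∈ centers ω then ψ (shift x ω) - ψ ω else 0

open Classical in
/-- The function `1{x ∈ H_ω} 1{e ∈ S_{τ_x ω}} (χ(x + e, ω) - χ(x, ω))`. -/
def edgeIncrement (χ : Plane → Config → Plane) (x e : Plane) (ω : Config) : Plane :=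
  if x ∈ centers ω ∧ e ∈ nbrs (shift x ω) then χ (x + e) ω - χ x ω else 0


/-! ### `prob` is a probability measure -/

theorem angle_aux {n : ℤ} {a b : Fin 5}
    (h : (n : ℝ) * Real.pi = 2 * ((a.val : ℝ) - b.val) * Real.pi / 5) : a = b := by
  have h1 : (n : ℝ) * 5 = 2 * ((a.val : ℝ) - b.val) := by
    have := Real.pi_pos.ne'
    field_simp at h
    linarith
  have h2 : n * 5 = 2 * ((a.val : ℤ) - b.val) := by exact_mod_cast h1
  omega

/-- The sine of the angle between two edge directions. -/
def sinDiff (a b : Fin 5) : ℝ := Real.sin (2 * ((a.val : ℝ) - b.val) * Real.pi / 5)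

theorem sinDiff_ne_zero {a b : Fin 5} (hab : a ≠ b) : sinDiff a b ≠ 0 := by
  intro h
  obtain ⟨n, hn⟩ := Real.sin_eq_zero_iff.1 h
  exact hab (angle_aux hn)

theorem sinDiff_eq {a b c d : Fin 5} (h : sinDiff a b = sinDiff c d) :
    (5 : ℤ) ∣ ((c.val : ℤ) - d.val) - (a.val - b.val) ∨
      ∃ k : ℤ, 2 * (((c.val : ℤ) - d.val) + (a.val - b.val)) = 5 * (2 * k + 1) := by
  have hpi := Real.pi_pos.ne'
  obtain ⟨k, hk | hk⟩ := Real.sin_eq_sin_iff.1 h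
  · left
    have h1 : ((c.val : ℝ) - d.val) - (a.val - b.val) = 5 * k := by
      field_simp at hk
      linarith
    exact ⟨k, by exact_mod_cast h1⟩
  · right
    have h1 : 2 * (((c.val : ℝ) - d.val) + (a.val - b.val)) = 5 * (2 * k + 1) := by
      field_simp at hk
      linarith
    exact ⟨k, by exact_mod_cast h1⟩

theorem inner_normal (x : Plane) (k : Fin 5) :
    inner ℝ x (normal k) =
      x 0 * Real.cos (Real.pi / 2 + 2 * (k.val : ℝ) * Real.pi / 5) +
      x 1 * Real.sin (Real.pi / 2 + 2 * (k.val : ℝ) * Real.pi / 5) := by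
  simp [normal, PiLp.inner_apply, Fin.sum_univ_two]
  ring

theorem three_grids {γ : Fin 5 → ℝ} {i j k : Fin 5} {x : Plane}
    (h : x ∈ grid γ i ∧ x ∈ grid γ j ∧ x ∈ grid γ k) :
    ∃ m : ℤ × ℤ × ℤ, sinDiff j k * (γ i + m.1) + sinDiff k i * (γ j + m.2.1)
      + sinDiff i j * (γ k + m.2.2) = 0 := by
  obtain ⟨⟨m₁, h₁⟩, ⟨m₂, h₂⟩, ⟨m₃, h₃⟩⟩ := h
  refine ⟨(m₁, m₂, m₃), ?_⟩
  have e₁ : γ i + m₁ = inner ℝ x (normal i) := by linarith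
  have e₂ : γ j + m₂ = inner ℝ x (normal j) := by linarith
  have e₃ : γ k + m₃ = inner ℝ x (normal k) := by linarith
  have key : ∀ a b : Fin 5, sinDiff a b =
      Real.sin ((Real.pi / 2 + 2 * (a.val : ℝ) * Real.pi / 5) -
        (Real.pi / 2 + 2 * (b.val : ℝ) * Real.pi / 5)) := by
    intro a b
    unfold sinDiff
    congr 1
    ring
  simp only [e₁, e₂, e₃, inner_normal, key, Real.sin_sub]
  ring

/-- Coefficients of `offsets` as an affine function of the two parameters. -/
def coef₁ (t : Fin 5 × Bool) (k : Fin 5) : ℝ := offsets (t, (1, 0)) k - offsets (t, (0, 0)) k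

/-- Coefficients of `offsets` as an affine function of the two parameters. -/
def coef₂ (t : Fin 5 × Bool) (k : Fin 5) : ℝ := offsets (t, (0, 1)) k - offsets (t, (0, 0)) k

theorem offsets_eq (t : Fin 5 × Bool) (q : ℝ × ℝ) (k : Fin 5) :
    offsets (t, q) k = coef₁ t k * q.1 + coef₂ t k * q.2 + offsets (t, (0, 0)) k := by
  unfold coef₁ coef₂ offsets
  split_ifs <;> simp <;> ring

theorem coef_ne {i j k : Fin 5} (hij : i ≠ j) (hjk : j ≠ k) (hik : i ≠ k) (t : Fin 5 × Bool)
    (h₁ : sinDiff j k * coef₁ t i + sinDiff k i * coef₁ t j + sinDiff i j * coef₁ t k = 0)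
    (h₂ : sinDiff j k * coef₂ t i + sinDiff k i * coef₂ t j + sinDiff i j * coef₂ t k = 0) :
    False := by
  have a₁ := sinDiff_ne_zero hjk
  have a₂ := sinDiff_ne_zero hik.symm
  have a₃ := sinDiff_ne_zero hij
  have hne : ¬ (sinDiff j k = sinDiff k i ∧ sinDiff j k = sinDiff i j) := by
    rintro ⟨u, v⟩
    have u' := sinDiff_eq u
    have v' := sinDiff_eq v
    have w' := sinDiff_eq (u.symm.trans v)
    omega
  obtain ⟨r, th⟩ := t
  have key : ∀ (l : Fin 5), coef₁ (r, th) l = (if l = r + 3 then 1 else if l = r + 4 then 0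
      else if l = r ∨ l = r + step th then 0 else -1) ∧
      coef₂ (r, th) l = (if l = r + 3 then 0 else if l = r + 4 then 1
      else if l = r ∨ l = r + step th then 0 else -1) := by
    intro l
    unfold coef₁ coef₂ offsets
    dsimp only
    split_ifs <;> simp
  simp only [key] at h₁ h₂
  clear key
  generalize sinDiff j k = A at *
  generalize sinDiff k i = B at *
  generalize sinDiff i j = C at *
  obtain ⟨i, rfl⟩ : ∃ i', i = r + i' := ⟨i - r, by omega⟩
  obtain ⟨j, rfl⟩ : ∃ i', j = r + i' := ⟨j - r, by omega⟩
  obtain ⟨k, rfl⟩ : ∃ i', k = r + i' := ⟨k - r, by omega⟩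
  have hr : ∀ l : Fin 5, (r + l = r) ↔ l = 0 := by intro l; omega
  simp only [add_right_inj, hr, ne_eq] at h₁ h₂ hij hjk hik
  clear hr
  revert h₁ h₂ hij hjk hik
  fin_cases i <;> fin_cases j <;> (try (intro _ _ h; exact absurd rfl h)) <;>
    fin_cases k <;> cases th <;> simp [step] <;> grind

theorem line_null {α β δ : ℝ} (h : α ≠ 0 ∨ β ≠ 0) :
    (volume : Measure (ℝ × ℝ)) {q | α * q.1 + β * q.2 + δ = 0} = 0 := by
  have hm : MeasurableSet {q : ℝ × ℝ | α * q.1 + β * q.2 + δ = 0} :=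
    measurableSet_eq_fun (by fun_prop) (by fun_prop)
  rw [Measure.volume_eq_prod]
  by_cases hβ : β = 0
  · have hα : α ≠ 0 := h.resolve_right (not_not.2 hβ)
    refine measure_mono_null (t := ({-δ / α} : Set ℝ) ×ˢ Set.univ) ?_ ?_
    · rintro ⟨a, b⟩ hq
      simp only [hβ, Set.mem_ofPred_eq] at hq
      simp only [Set.mem_prod, Set.mem_singleton_iff, Set.mem_univ, and_true]
      field_simp
      linarith
    · rw [Measure.prod_prod]
      simp
  · rw [Measure.measure_prod_null hm]
    refine ae_of_all _ fun a => ?_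
    refine measure_mono_null (t := ({-(α * a + δ) / β} : Set ℝ)) ?_ (by simp)
    intro b hb
    simp only [Set.mem_preimage, Set.mem_ofPred_eq] at hb
    simp only [Set.mem_singleton_iff]
    field_simp
    linarith

theorem singular_null (t : Fin 5 × Bool) :
    (volume : Measure (ℝ × ℝ)) {q | ¬ Regular (offsets (t, q))} = 0 := by
  let I : Type := {s : Fin 5 × Fin 5 × Fin 5 // s.1 ≠ s.2.1 ∧ s.2.1 ≠ s.2.2 ∧ s.1 ≠ s.2.2}
  let f : I → (Fin 5 → ℝ) → ℝ := fun s c => sinDiff s.1.2.1 s.1.2.2 * c s.1.1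
    + sinDiff s.1.2.2 s.1.1 * c s.1.2.1 + sinDiff s.1.1 s.1.2.1 * c s.1.2.2
  refine measure_mono_null (t := ⋃ (s : I) (m : ℤ × ℤ × ℤ), {q : ℝ × ℝ |
    f s (coef₁ t) * q.1 + f s (coef₂ t) * q.2 +
      (f s (offsets (t, (0, 0))) + (sinDiff s.1.2.1 s.1.2.2 * m.1
    + sinDiff s.1.2.2 s.1.1 * m.2.1 + sinDiff s.1.1 s.1.2.1 * m.2.2)) = 0}) ?_ ?_
  · intro q hq
    simp only [Set.mem_ofPred_eq, Regular] at hq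
    push Not at hq
    obtain ⟨i, j, k, h₁, h₂, h₃, x, hx⟩ := hq
    obtain ⟨m, hm⟩ := three_grids hx
    simp only [Set.mem_iUnion]
    refine ⟨⟨(i, j, k), h₁, h₂, h₃⟩, m, ?_⟩
    simp only [Set.mem_ofPred_eq, f]
    rw [offsets_eq t q i, offsets_eq t q j, offsets_eq t q k] at hm
    linarith
  · refine measure_iUnion_null fun s => measure_iUnion_null fun m => line_null ?_
    by_contra! hc
    exact coef_ne s.2.1 s.2.2.1 s.2.2.2 t hc.1 hc.2

theorem rawMeasure_univ : rawMeasure Set.univ = 1 := by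
  have hg := Real.goldenRatio_pos
  have hw : 5 * weight true + 5 * weight false = 1 := by
    have h5 : (5 : ℝ≥0∞) = ENNReal.ofReal 5 := by simp
    rw [weight, weight, h5, ← ENNReal.ofReal_mul (by norm_num), ← ENNReal.ofReal_mul (by norm_num),
      ← ENNReal.ofReal_add (by positivity) (by positivity), ENNReal.ofReal_eq_one]
    simp only [if_true, Bool.false_eq_true, if_false]
    field_simp
  rw [rawMeasure, ← Set.univ_prod_univ, Measure.prod_prod, Measure.restrict_apply_univ,
    Measure.volume_eq_prod, Measure.prod_prod]
  simp only [Measure.coe_finsetSum, Finset.sum_apply, Measure.smul_apply, measure_univ,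
    smul_eq_mul, mul_one, Real.volume_Ico, sub_zero, ENNReal.ofReal_one]
  rw [Fintype.sum_prod_type]
  simpa [mul_add] using hw

theorem rawMeasure_singular : rawMeasure {p | ¬ Regular (offsets p)} = 0 := by
  refine measure_mono_null (t := ⋃ t : Fin 5 × Bool,
    ({t} : Set (Fin 5 × Bool)) ×ˢ {q : ℝ × ℝ | ¬ Regular (offsets (t, q))}) ?_ ?_
  · rintro ⟨t, q⟩ h
    simpa using h
  · refine measure_iUnion_null fun t => ?_
    rw [rawMeasure, Measure.prod_prod,
      Measure.absolutelyContinuous_of_le Measure.restrict_le_self (singular_null t), mul_zero]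

instance : IsProbabilityMeasure prob := by
  have hmeas : Measurable configOf := fun s hs => hs
  have hae : rawMeasure {p | Regular (offsets p)}ᶜ = 0 := rawMeasure_singular
  have hnull : NullMeasurableSet {p | Regular (offsets p)} rawMeasure :=
    (NullMeasurableSet.of_null hae).of_compl
  have h : Measure.comap (Subtype.val : Param → RawParam) rawMeasure Set.univ =
      rawMeasure (Subtype.val '' (Set.univ : Set Param)) :=
    Measure.comap_apply₀ _ _ Subtype.val_injective
      (fun s hs => Measure.MeasurableSet.nullMeasurableSet_subtype_coe hnull hs)
      MeasurableSet.univ.nullMeasurableSet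
  constructor
  rw [prob, Measure.map_apply hmeas MeasurableSet.univ, Set.preimage_univ, h, Set.image_univ,
    Subtype.range_coe, ← rawMeasure_univ]
  exact measure_of_measure_compl_eq_zero hae

end Penrose

end

open Penrose

/-! This is the Kipnis–Varadhan construction of a corrector for a reversible environment seen from
the walker. The tilings supply two inputs: `prob` is invariant under the partial shifts, and a
center at a given vector is joined to the origin by a bounded number of neighbor steps.

Invariance (`prob_shift`). Among pentagrids with total offset 1, the offsets are determined up to a
translation of the plane by the point `star (offsets p)` of an internal plane, the component of
frequency two under the cyclic group of order five (`exists_inner_iff`). On each torus this point is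
an affine function of the parameters, with Jacobian proportional to the golden ratio for thick and
to 1 for thin tiles (`abs_det_torusMap`): exactly the weights of the tori. So `prob` is, piece by
piece, a fixed multiple of Lebesgue measure of the internal plane, and moving the root to another
tile acts there as a piecewise translation (`Rel.torusMap_eq`).

Connectivity. For a regular pentagrid, tiles correspond to crossing points, and neighbors to
consecutive crossings on a common line (`neighbor_iff`). Hence every tile has four neighbors, and
crossings at bounded distance are joined by walking along two grid lines (`exists_linked`).

Hilbert space. Invariance and the symmetry of the neighbor relation give `⟨(1 - Q) f, g⟩ = (1/8)
⟨grad f, grad g⟩` (`inner_grad`), and the drift has the same divergence form (`inner_driftL`).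
Lax–Milgram solves the resolvent equation. Testing the equation shows that the gradients of the
solutions `ψ ε` converge to the projection of the step field onto the closure of the gradients, and
that `ε • ψ ε` tends to 0 (`exists_tendsto_resolvent`). Connectivity bounds every increment by the
gradient (`exists_norm_incOp_le`), so all increments converge in L². The limits inherit the cocycle
identity, and `(Q - 1) ψ = ε ψ - V` becomes harmonicity. The uniform edge bound follows from the
cocycle identity, invariance and the finiteness of the set of steps. -/

noncomputable section

namespace Penrose

/-! ### The five normals -/

/-- `sin (π / 5)`. -/
def sinFifth : ℝ := Real.sin (Real.pi / 5)

theorem sinFifth_pos : 0 < sinFifth :=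
  Real.sin_pos_of_pos_of_lt_pi (by positivity) (by linarith [Real.pi_pos])

theorem cos_fifth : Real.cos (Real.pi / 5) = Real.goldenRatio / 2 := by
  rw [Real.cos_pi_div_five, Real.goldenRatio]; ring

theorem sinFifth_sq : sinFifth ^ 2 = (3 - Real.goldenRatio) / 4 := by
  rw [sinFifth, Real.sin_sq, cos_fifth, div_pow, Real.goldenRatio_sq]; ring

theorem cos_two_fifths : Real.cos (2 * (Real.pi / 5)) = (Real.goldenRatio - 1) / 2 := by
  rw [Real.cos_two_mul, cos_fifth, div_pow, Real.goldenRatio_sq]; ring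

theorem sin_two_fifths : Real.sin (2 * (Real.pi / 5)) = Real.goldenRatio * sinFifth := by
  rw [Real.sin_two_mul, cos_fifth, sinFifth]; ring

theorem normal_zero_coord (k : Fin 5) : normal k 0 =
    ![0, -(Real.goldenRatio * sinFifth), -sinFifth, sinFifth, Real.goldenRatio * sinFifth] k := by
  have e : ∀ θ : ℝ, Real.cos (Real.pi / 2 + θ) = - Real.sin θ := by
    intro θ; rw [add_comm, Real.cos_add_pi_div_two]
  fin_cases k
  · simp [normal]
  · simp only [normal, Fin.mk_one, Fin.isValue, PiLp.toLp_apply, Matrix.cons_val_zero, e]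
    rw [← sin_two_fifths]; norm_num; congr 1; ring
  · simp only [normal, Fin.isValue, PiLp.toLp_apply, Matrix.cons_val_zero, e, sinFifth]
    have : (2 * (((⟨2, by norm_num⟩ : Fin 5).val : ℕ) : ℝ) * Real.pi / 5) =
      Real.pi - Real.pi / 5 := by norm_num; ring
    rw [this, Real.sin_pi_sub]; rfl
  · simp only [normal, Fin.isValue, PiLp.toLp_apply, Matrix.cons_val_zero, e, sinFifth]
    have : (2 * (((⟨3, by norm_num⟩ : Fin 5).val : ℕ) : ℝ) * Real.pi / 5) =
      Real.pi / 5 + Real.pi := by norm_num; ring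
    rw [this, Real.sin_add_pi, neg_neg]; rfl
  · simp only [normal, Fin.isValue, PiLp.toLp_apply, Matrix.cons_val_zero, e]
    have : (2 * (((⟨4, by norm_num⟩ : Fin 5).val : ℕ) : ℝ) * Real.pi / 5) =
      2 * Real.pi - 2 * (Real.pi / 5) := by norm_num; ring
    rw [this, Real.sin_two_pi_sub, neg_neg, sin_two_fifths]; rfl

theorem normal_one_coord (k : Fin 5) : normal k 1 =
    ![1, (Real.goldenRatio - 1) / 2, -(Real.goldenRatio / 2), -(Real.goldenRatio / 2),
      (Real.goldenRatio - 1) / 2] k := by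
  have e : ∀ θ : ℝ, Real.sin (Real.pi / 2 + θ) = Real.cos θ := by
    intro θ; rw [add_comm, Real.sin_add_pi_div_two]
  fin_cases k
  · simp [normal]
  · simp only [normal, Fin.mk_one, Fin.isValue, PiLp.toLp_apply, Matrix.cons_val_one, e]
    have : (2 * (((1 : Fin 5).val : ℕ) : ℝ) * Real.pi / 5) = 2 * (Real.pi / 5) := by
      norm_num; ring
    simp only [Matrix.cons_val_fin_one]
    exact (congrArg Real.cos this).trans cos_two_fifths
  · simp only [normal, Fin.isValue, PiLp.toLp_apply, Matrix.cons_val_one, e]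
    have : (2 * (((⟨2, by norm_num⟩ : Fin 5).val : ℕ) : ℝ) * Real.pi / 5) =
      Real.pi - Real.pi / 5 := by norm_num; ring
    simp only [Matrix.cons_val_fin_one, this, Real.cos_pi_sub, cos_fifth]; rfl
  · simp only [normal, Fin.isValue, PiLp.toLp_apply, Matrix.cons_val_one, e]
    have : (2 * (((⟨3, by norm_num⟩ : Fin 5).val : ℕ) : ℝ) * Real.pi / 5) =
      Real.pi / 5 + Real.pi := by norm_num; ring
    simp only [Matrix.cons_val_fin_one, this, Real.cos_add_pi, cos_fifth]; rfl
  · simp only [normal, Fin.isValue, PiLp.toLp_apply, Matrix.cons_val_one, e]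
    have : (2 * (((⟨4, by norm_num⟩ : Fin 5).val : ℕ) : ℝ) * Real.pi / 5) =
      2 * Real.pi - 2 * (Real.pi / 5) := by norm_num; ring
    simp only [Matrix.cons_val_fin_one, this, Real.cos_two_pi_sub, cos_two_fifths]; rfl

theorem inner_plane (x y : Plane) : inner ℝ x y = x 0 * y 0 + x 1 * y 1 := by
  simp [PiLp.inner_apply, Fin.sum_univ_two]
  ring

theorem plane_ext {x y : Plane} (h₀ : x 0 = y 0) (h₁ : x 1 = y 1) : x = y := by
  ext i
  fin_cases i
  exacts [h₀, h₁]

theorem sum_smul_normal_zero (c : Fin 5 → ℝ) : (∑ k, c k • normal k) 0 =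
    sinFifth * (c 3 - c 2 + Real.goldenRatio * (c 4 - c 1)) := by
  simp [Fin.sum_univ_five, normal_zero_coord]
  ring

theorem sum_smul_normal_one (c : Fin 5 → ℝ) : (∑ k, c k • normal k) 1 =
    c 0 - (c 1 + c 4) / 2 + Real.goldenRatio * ((c 1 + c 4 - c 2 - c 3) / 2) := by
  simp [Fin.sum_univ_five, normal_one_coord]
  ring

theorem sum_normal : ∑ k, normal k = 0 := by
  have h : ∑ k, normal k = ∑ k, (1 : ℝ) • normal k := by simp
  rw [h]
  refine plane_ext ?_ ?_
  · rw [sum_smul_normal_zero]; simp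
  · rw [sum_smul_normal_one]; simp

theorem norm_normal (k : Fin 5) : ‖normal k‖ = 1 := by
  rw [← sq_eq_sq₀ (norm_nonneg _) zero_le_one, ← real_inner_self_eq_norm_sq, inner_normal]
  simp only [normal, PiLp.toLp_apply, Matrix.cons_val_zero, Matrix.cons_val_one,
    Matrix.cons_val_fin_one]
  rw [← sq, ← sq, Real.cos_sq_add_sin_sq, one_pow]

theorem int_add_int_mul_goldenRatio {a b : ℤ} (h : (a : ℝ) + Real.goldenRatio * b = 0) :
    a = 0 ∧ b = 0 := by
  by_cases hb : b = 0
  · subst hb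
    simpa using h
  · exfalso
    have h' : Real.goldenRatio = ((-a / b : ℚ) : ℝ) := by
      have : (b : ℝ) ≠ 0 := by exact_mod_cast hb
      push_cast
      rw [eq_div_iff this]
      linear_combination h
    exact Real.goldenRatio_irrational ⟨_, h'.symm⟩

/-- The only integral relations between the five normals are the multiples of `∑ₖ nₖ = 0`. -/
theorem int_relation {m : Fin 5 → ℤ} (h : ∑ k, (m k : ℝ) • normal k = 0) (k : Fin 5) :
    m k = m 0 := by
  have h₀ : sinFifth * (((m 3 - m 2 : ℤ) : ℝ) + Real.goldenRatio * ((m 4 - m 1 : ℤ) : ℝ)) = 0 := by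
    have := congrArg (fun v : Plane => v 0) h
    simp only [sum_smul_normal_zero] at this
    push_cast
    simpa using this
  have h₁ : ((2 * m 0 - (m 1 + m 4) : ℤ) : ℝ) +
      Real.goldenRatio * ((m 1 + m 4 - m 2 - m 3 : ℤ) : ℝ) = 0 := by
    have := congrArg (fun v : Plane => v 1) h
    simp only [sum_smul_normal_one] at this
    have e : (0 : Plane) 1 = 0 := rfl
    rw [e] at this
    push_cast
    linarith
  -- Irrationality of the golden ratio splits each coordinate into two integer equations; the four
  -- together force all coefficients to agree.
  have h₀' := int_add_int_mul_goldenRatio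
    ((mul_eq_zero.1 h₀).resolve_left sinFifth_pos.ne')
  have h₁' := int_add_int_mul_goldenRatio h₁
  fin_cases k <;> simp <;> omega

/-- The normal vectors with doubled index span the internal space. The images of a real vector
under both projections and its total determine it. -/
theorem fourier_inversion (c : Fin 5 → ℝ) (k : Fin 5) :
    c k = (1 / 5) * ∑ l, c l + (2 / 5) * inner ℝ (∑ l, c l • normal l) (normal k) +
      (2 / 5) * inner ℝ (∑ l, c l • normal (2 * l)) (normal (2 * k)) := by
  have hs := sinFifth_sq
  have hg := Real.goldenRatio_sq
  simp only [inner_plane, Fin.sum_univ_five, PiLp.add_apply, PiLp.smul_apply, smul_eq_mul]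
  have e : (2 * 0 : Fin 5) = 0 ∧ (2 * 1 : Fin 5) = 2 ∧ (2 * 2 : Fin 5) = 4 ∧ (2 * 3 : Fin 5) = 1 ∧
    (2 * 4 : Fin 5) = 3 := by decide
  obtain ⟨e0, e1, e2, e3, e4⟩ := e
  fin_cases k <;>
    simp [normal_zero_coord, normal_one_coord, e0, e1, e2, e3, e4] <;> grind

/-- The five normals form a tight frame. This is why the dual vertex of `z` stays close to `(5/2)
z`, up to a constant. -/
theorem frame_identity (z : Plane) :
    ∑ k, inner ℝ z (normal k) • normal k = (5 / 2 : ℝ) • z := by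
  have hs := sinFifth_sq
  have hg := Real.goldenRatio_sq
  refine plane_ext ?_ ?_
  · rw [sum_smul_normal_zero]
    simp [inner_plane, normal_zero_coord, normal_one_coord]
    grind
  · rw [sum_smul_normal_one]
    simp [inner_plane, normal_zero_coord, normal_one_coord]
    grind

/-- The sequence `z · n_k` has frequency one and `n_{2k}` frequency two under the cyclic group, so
they are orthogonal. Hence translating a pentagrid does not change its internal coordinate. -/
theorem frame_star (z : Plane) :
    ∑ k, inner ℝ z (normal k) • normal (2 * k) = 0 := by
  have hs := sinFifth_sq
  have hg := Real.goldenRatio_sq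
  have e : (2 * 0 : Fin 5) = 0 ∧ (2 * 1 : Fin 5) = 2 ∧ (2 * 2 : Fin 5) = 4 ∧ (2 * 3 : Fin 5) = 1 ∧
    (2 * 4 : Fin 5) = 3 := by decide
  obtain ⟨e0, e1, e2, e3, e4⟩ := e
  refine plane_ext ?_ ?_
  · simp [Fin.sum_univ_five, inner_plane, normal_zero_coord, normal_one_coord, e2, e3, e4]
    grind
  · simp [Fin.sum_univ_five, inner_plane, normal_zero_coord, normal_one_coord, e2, e3, e4]
    grind

/-! ### The directions of the grid lines -/

/-- The direction of the lines of the `a`-th grid. -/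
def lineDir (a : Fin 5) : Plane := !₂[-normal a 1, normal a 0]

theorem inner_lineDir (a b : Fin 5) : inner ℝ (lineDir a) (normal b) = sinDiff b a := by
  simp only [inner_plane, lineDir, Matrix.cons_val_zero, Matrix.cons_val_one,
    Matrix.cons_val_fin_one]
  have key : sinDiff b a =
      Real.sin ((Real.pi / 2 + 2 * (b.val : ℝ) * Real.pi / 5) -
        (Real.pi / 2 + 2 * (a.val : ℝ) * Real.pi / 5)) := by
    unfold sinDiff
    congr 1
    ring
  rw [key, Real.sin_sub]
  simp only [normal, PiLp.toLp_apply, Matrix.cons_val_zero, Matrix.cons_val_one,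
    Matrix.cons_val_fin_one]
  ring

theorem sinDiff_self (a : Fin 5) : sinDiff a a = 0 := by simp [sinDiff]

theorem abs_sinDiff_le (a b : Fin 5) : |sinDiff a b| ≤ 1 := Real.abs_sin_le_one _

theorem lineDir_ne_zero (a : Fin 5) : lineDir a ≠ 0 := by
  intro h
  have h1 := inner_lineDir a (a + 1)
  rw [h, inner_zero_left] at h1
  exact sinDiff_ne_zero (by simp) h1.symm

theorem inner_add_smul_lineDir (z : Plane) (s : ℝ) (a k : Fin 5) :
    inner ℝ (z + s • lineDir a) (normal k) = inner ℝ z (normal k) + s * sinDiff k a := by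
  rw [inner_add_left, real_inner_smul_left, inner_lineDir]

theorem exists_eq_add_smul_lineDir {z z' : Plane} {a : Fin 5}
    (h : inner ℝ z (normal a) = inner ℝ z' (normal a)) : ∃ s : ℝ, z' = z + s • lineDir a := by
  have hn : normal a 0 * normal a 0 + normal a 1 * normal a 1 = 1 := by
    have := norm_normal a
    rw [← inner_plane, real_inner_self_eq_norm_sq, this, one_pow]
  rw [inner_plane, inner_plane] at h
  refine ⟨(z' 1 - z 1) * normal a 0 - (z' 0 - z 0) * normal a 1, plane_ext ?_ ?_⟩
  · simp only [lineDir, PiLp.add_apply, PiLp.smul_apply, Matrix.cons_val_zero,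
      smul_eq_mul]
    linear_combination (-(normal a 0)) * h + (z 0 - z' 0) * hn
  · simp only [lineDir, PiLp.add_apply, PiLp.smul_apply, Matrix.cons_val_one,
      Matrix.cons_val_fin_one, smul_eq_mul]
    linear_combination (-(normal a 1)) * h + (z 1 - z' 1) * hn

/-! ### Tiles and the points of the pentagrid dual to them -/

/-- The integer coordinates of the vertex dual to `z`. -/
def cell (γ : Fin 5 → ℝ) (z : Plane) (k : Fin 5) : ℤ := ⌈inner ℝ z (normal k) - γ k⌉

/-- If all five labels rose together, then `(z - z') · n_k` would be positive for every `k`,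
although these numbers add up to 0. This removes the constant that `int_relation` leaves free. -/
theorem cell_sub_const {γ : Fin 5 → ℝ} {z z' : Plane} {c : ℤ}
    (h : ∀ k, cell γ z k - cell γ z' k = c) : c = 0 := by
  have key : ∀ (z z' : Plane) (c : ℤ), (∀ k, cell γ z k - cell γ z' k = c) → ¬ 0 < c := by
    intro z z' c h hc
    have h1 : ∀ k, 0 < inner ℝ (z - z') (normal k) := by
      intro k
      by_contra! hk
      rw [inner_sub_left] at hk
      have : cell γ z k ≤ cell γ z' k := Int.ceil_mono (by linarith)
      have := h k
      omega
    have h2 : ∑ k, inner ℝ (z - z') (normal k) = 0 := by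
      rw [← inner_sum, sum_normal, inner_zero_right]
    have := Finset.sum_pos (fun k _ => h1 k) (Finset.univ_nonempty (α := Fin 5))
    linarith
  have h1 := key z z' c h
  have h2 := key z' z (-c) (fun k => by have := h k; omega)
  omega

theorem cell_eq_of_dualVertex_eq {γ : Fin 5 → ℝ} {z z' : Plane}
    (h : dualVertex γ z = dualVertex γ z') (k : Fin 5) : cell γ z k = cell γ z' k := by
  have h1 : ∑ k, ((cell γ z k - cell γ z' k : ℤ) : ℝ) • normal k = 0 := by
    simp only [Int.cast_sub, sub_smul, Finset.sum_sub_distrib]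
    exact sub_eq_zero.2 h
  have h2 := int_relation h1
  have h3 := cell_sub_const h2
  have := h2 k
  omega

theorem mem_grid_iff_cell {γ : Fin 5 → ℝ} {z : Plane} {k : Fin 5} :
    z ∈ grid γ k ↔ inner ℝ z (normal k) - γ k = cell γ z k := by
  constructor
  · rintro ⟨n, hn⟩
    rw [cell, hn, Int.ceil_intCast]
  · exact fun h => ⟨_, h⟩

/-- The rhombus `R` is the tile dual to the point `z` of the pentagrid. -/
def TileAt (γ : Fin 5 → ℝ) (R : Rhombus) (z : Plane) : Prop :=
  z ∈ grid γ R.first ∧ z ∈ grid γ R.second ∧ R.corner = dualVertex γ z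

theorem Rhombus.first_ne_second (R : Rhombus) : R.first ≠ R.second := by
  have : ∀ (i : Fin 5) (t : Bool), i ≠ i + step t := by decide
  exact this _ _

theorem eq_of_inner_normal_eq {z z' : Plane} {a b : Fin 5} (hab : a ≠ b)
    (ha : inner ℝ z (normal a) = inner ℝ z' (normal a))
    (hb : inner ℝ z (normal b) = inner ℝ z' (normal b)) : z = z' := by
  obtain ⟨s, rfl⟩ := exists_eq_add_smul_lineDir ha
  rw [inner_add_smul_lineDir] at hb
  have : s * sinDiff b a = 0 := by linarith
  rw [(mul_eq_zero.1 this).resolve_right (sinDiff_ne_zero hab.symm), zero_smul, add_zero]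

theorem TileAt.point_unique {γ : Fin 5 → ℝ} {R : Rhombus} {z z' : Plane}
    (h : TileAt γ R z) (h' : TileAt γ R z') : z = z' := by
  have hc := cell_eq_of_dualVertex_eq (h.2.2.symm.trans h'.2.2)
  refine eq_of_inner_normal_eq R.first_ne_second ?_ ?_
  · have h1 := mem_grid_iff_cell.1 h.1
    have h2 := mem_grid_iff_cell.1 h'.1
    rw [hc] at h1
    linarith
  · have h1 := mem_grid_iff_cell.1 h.2.1
    have h2 := mem_grid_iff_cell.1 h'.2.1
    rw [hc] at h1
    linarith

/-- Indicator of the two edge directions of a type of tiles. -/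
def typeInd (t : Fin 5 × Bool) (k : Fin 5) : ℤ := if k = t.1 ∨ k = t.1 + step t.2 then 1 else 0

theorem typeInd_injective : Function.Injective typeInd := by
  have : ∀ t t' : Fin 5 × Bool, (∀ k, typeInd t k = typeInd t' k) → t = t' := by
    unfold typeInd; decide
  exact fun t t' h => this t t' (congrFun h)

/-- Each indicator has total 2, and 2 + 2 is not 5. -/
theorem not_typeInd_add_eq_one (t t' : Fin 5 × Bool) : ¬ ∀ k, typeInd t k + typeInd t' k = 1 := by
  revert t t'
  unfold typeInd
  decide

theorem typeInd_zero_or_one (t : Fin 5 × Bool) (k : Fin 5) : typeInd t k = 0 ∨ typeInd t k = 1 := by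
  unfold typeInd
  split_ifs <;> simp

theorem normal_add_normal (t : Fin 5 × Bool) :
    normal t.1 + normal (t.1 + step t.2) = ∑ k, (typeInd t k : ℝ) • normal k := by
  have h : t.1 ≠ t.1 + step t.2 := by revert t; decide
  have h1 : ∀ k, (typeInd t k : ℝ) • normal k =
      (if t.1 = k then normal k else 0) + (if t.1 + step t.2 = k then normal k else 0) := by
    intro k
    unfold typeInd
    by_cases h1 : t.1 = k
    · have h2 : ¬ t.1 + step t.2 = k := fun h2 => h (h1.trans h2.symm)
      rw [if_pos (Or.inl h1.symm), if_pos h1, if_neg h2, Int.cast_one, one_smul, add_zero]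
    · by_cases h2 : t.1 + step t.2 = k <;> simp [h1, h2, eq_comm (a := k)]
  simp only [h1, Finset.sum_add_distrib, Finset.sum_ite_eq, Finset.mem_univ, if_true]

/-- Centers have half-integral coordinates with respect to the normals, the halves marking the type.
Doubling the difference gives an integral relation, whose coefficients are constant. -/
theorem TileAt.eq_of_center_eq {γ : Fin 5 → ℝ} {R R' : Rhombus} {z z' : Plane}
    (h : TileAt γ R z) (h' : TileAt γ R' z') (hc : R.center = R'.center) : R = R' := by
  have h1 : ∀ {R : Rhombus} {z : Plane}, TileAt γ R z → R.center =
      ∑ k, ((cell γ z k : ℝ) + (1 / 2) * typeInd (R.first, R.thick) k) • normal k := by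
    intro R z h
    have := normal_add_normal (R.first, R.thick)
    simp only at this
    simp only [Rhombus.center, Rhombus.second, add_smul, Finset.sum_add_distrib, this, h.2.2,
      Finset.smul_sum, mul_smul]
    rfl
  set t := (R.first, R.thick) with ht
  set t' := (R'.first, R'.thick) with ht'
  have h2 : ∑ k, ((2 * (cell γ z k - cell γ z' k) + typeInd t k - typeInd t' k : ℤ) : ℝ) •
      normal k = 0 := by
    rw [h1 h, h1 h'] at hc
    have := congrArg (fun v : Plane => (2 : ℝ) • v) (sub_eq_zero.2 hc)
    simp only [← Finset.sum_sub_distrib, ← sub_smul, Finset.smul_sum, smul_smul, smul_zero] at this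
    rw [← this]
    refine Finset.sum_congr rfl fun k _ => ?_
    push_cast
    congr 1
    ring
  have h3 := int_relation h2
  set c := 2 * (cell γ z 0 - cell γ z' 0) + typeInd t 0 - typeInd t' 0
  -- Modulo 2 only the type indicators remain: an even constant makes the types equal, an odd one
  -- makes them complementary, which is impossible.
  rcases Int.even_or_odd' c with ⟨d, hd | hd⟩
  · have h4 : t = t' := typeInd_injective (funext fun k => by
      have := h3 k
      have := typeInd_zero_or_one t k
      have := typeInd_zero_or_one t' k
      omega)
    have h5 : ∀ k, cell γ z k - cell γ z' k = d := by
      intro k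
      have := h3 k
      rw [h4] at this
      omega
    have h6 := cell_sub_const h5
    have h7 : R.corner = R'.corner := by
      rw [h.2.2, h'.2.2]
      refine Finset.sum_congr rfl fun k _ => ?_
      have := h5 k
      have : cell γ z k = cell γ z' k := by omega
      unfold cell at this
      rw [this]
    rw [ht, ht', Prod.mk.injEq] at h4
    exact Rhombus.ext h7 h4.1 h4.2
  · refine absurd (fun k => ?_) (not_typeInd_add_eq_one t t')
    have := h3 k
    have := typeInd_zero_or_one t k
    have := typeInd_zero_or_one t' k
    omega

theorem eq_of_first_second {R R' : Rhombus} (hc : R.corner = R'.corner)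
    (h₁ : R.first = R'.first ∨ R.first = R'.second)
    (h₂ : R.second = R'.first ∨ R.second = R'.second) : R = R' := by
  have key : ∀ (i i' : Fin 5) (t t' : Bool), (i = i' ∨ i = i' + step t') →
      (i + step t = i' ∨ i + step t = i' + step t') → i = i' ∧ t = t' := by decide
  obtain ⟨e, e'⟩ := key _ _ _ _ h₁ h₂
  exact Rhombus.ext hc e e'

theorem Regular.first_or_second {γ : Fin 5 → ℝ} (hγ : Regular γ) {R : Rhombus} {z : Plane}
    (h : TileAt γ R z) {k : Fin 5} (hk : z ∈ grid γ k) : k = R.first ∨ k = R.second := by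
  by_contra! hne
  exact hγ _ _ _ R.first_ne_second hne.2.symm hne.1.symm z ⟨h.1, h.2.1, hk⟩

theorem Regular.tileAt_unique {γ : Fin 5 → ℝ} (hγ : Regular γ) {R R' : Rhombus} {z : Plane}
    (h : TileAt γ R z) (h' : TileAt γ R' z) : R = R' :=
  eq_of_first_second (h.2.2.trans h'.2.2.symm) (hγ.first_or_second h' h.1)
    (hγ.first_or_second h' h.2.1)

theorem exists_tileAt {γ : Fin 5 → ℝ} {a b : Fin 5} (hab : a ≠ b) {z : Plane}
    (ha : z ∈ grid γ a) (hb : z ∈ grid γ b) : ∃ R, TileAt γ R z := by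
  have key : ∀ a b : Fin 5, a ≠ b → ∃ (i : Fin 5) (t : Bool), (i = a ∧ i + step t = b) ∨
      (i = b ∧ i + step t = a) := by decide
  obtain ⟨i, t, ⟨rfl, rfl⟩ | ⟨rfl, rfl⟩⟩ := key a b hab
  exacts [⟨⟨dualVertex γ z, i, t⟩, ha, hb, rfl⟩, ⟨⟨dualVertex γ z, i, t⟩, hb, ha, rfl⟩]

/-! ### Consecutive points on a line of the pentagrid -/

/-- Starting from `z` in the direction of the lines of the `a`-th grid, the first crossing with
another grid occurs at the (signed) time `s`. -/
def Consec (γ : Fin 5 → ℝ) (a : Fin 5) (z : Plane) (s : ℝ) : Prop :=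
  s ≠ 0 ∧ (∃ l, l ≠ a ∧ z + s • lineDir a ∈ grid γ l) ∧
    ∀ r : ℝ, 0 < r → r < 1 → ∀ l, l ≠ a → z + (r * s) • lineDir a ∉ grid γ l

theorem add_smul_mem_grid {γ : Fin 5 → ℝ} {a l : Fin 5} {z : Plane} {s : ℝ} :
    z + s • lineDir a ∈ grid γ l ↔
      ∃ n : ℤ, inner ℝ z (normal l) - γ l + s * sinDiff l a = n := by
  simp only [grid, Set.mem_ofPred_eq, inner_add_smul_lineDir]
  refine exists_congr fun n => ?_
  rw [add_sub_right_comm]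

theorem exists_first_hit (α : ℝ) {b : ℝ} (hb : b ≠ 0) : ∃ t : ℝ, 0 < t ∧
    (∃ n : ℤ, α + t * b = n) ∧ ∀ t', 0 < t' → t' < t → ∀ n : ℤ, α + t' * b ≠ n := by
  have pos : ∀ (α : ℝ) {b : ℝ}, 0 < b → ∃ t : ℝ, 0 < t ∧
      (∃ n : ℤ, α + t * b = n) ∧ ∀ t', 0 < t' → t' < t → ∀ n : ℤ, α + t' * b ≠ n := by
    intro α b hb
    have h1 := Int.lt_floor_add_one α
    have h0 := Int.floor_le α
    -- `⌊α⌋ + 1` rather than `⌈α⌉`: the hit must occur at a positive time even if `α` is an integer.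
    refine ⟨(⌊α⌋ + 1 - α) / b, div_pos (by linarith) hb, ⟨⌊α⌋ + 1, ?_⟩, ?_⟩
    · rw [div_mul_cancel₀ _ hb.ne']; push_cast; ring
    · intro t' ht' ht n hn
      rw [lt_div_iff₀ hb] at ht
      have h2 : (⌊α⌋ : ℝ) < n := by nlinarith [mul_pos ht' hb]
      have h3 : (n : ℝ) < (⌊α⌋ + 1 : ℤ) := by push_cast; linarith
      have h2' : ⌊α⌋ < n := by exact_mod_cast h2
      have h3' : n < ⌊α⌋ + 1 := by exact_mod_cast h3
      omega
  rcases hb.lt_or_gt with h | h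
  · obtain ⟨t, ht, ⟨n, hn⟩, hmin⟩ := pos (-α) (neg_pos.2 h)
    refine ⟨t, ht, ⟨-n, by push_cast; linarith⟩, fun t' h1 h2 m hm => ?_⟩
    exact hmin t' h1 h2 (-m) (by push_cast; linarith)
  · exact pos α h

/-- The sign of `σ` selects one of the two rays. No other grid is parallel to the line, so each of
the four has a first hit, and the earliest is the next crossing. -/
theorem exists_consec (γ : Fin 5 → ℝ) (a : Fin 5) (z : Plane) {σ : ℝ} (hσ : σ ≠ 0) :
    ∃ s, 0 < s * σ ∧ Consec γ a z s := by
  have hb : ∀ l, l ≠ a → σ * sinDiff l a ≠ 0 := fun l hl => mul_ne_zero hσ (sinDiff_ne_zero hl)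
  choose! t ht hint hmin using fun l hl =>
    exists_first_hit (inner ℝ z (normal l) - γ l) (hb l hl)
  have hne : (Finset.univ.erase a).Nonempty := ⟨a + 1, by simp⟩
  obtain ⟨l, hl, hle⟩ := Finset.exists_min_image _ t hne
  simp only [Finset.mem_erase, Finset.mem_univ, and_true] at hl hle
  have htl := ht l hl
  refine ⟨t l * σ, ?_, mul_ne_zero htl.ne' hσ, ⟨l, hl, ?_⟩, ?_⟩
  · have := mul_self_pos.2 hσ
    rw [mul_assoc]
    positivity
  · rw [add_smul_mem_grid, mul_assoc]
    exact hint l hl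
  · intro r hr0 hr1 k hk
    rw [add_smul_mem_grid]
    rintro ⟨n, hn⟩
    refine hmin k hk (r * t l) (by positivity) ?_ n ?_
    · have := hle k hk
      nlinarith
    · rw [← hn]; ring

theorem Consec.unique {γ : Fin 5 → ℝ} {a : Fin 5} {z : Plane} {s s' : ℝ}
    (h : Consec γ a z s) (h' : Consec γ a z s') (hs : 0 < s * s') : s = s' := by
  have key : ∀ {s s' : ℝ}, Consec γ a z s → Consec γ a z s' → 0 < s * s' → ¬ s / s' < 1 := by
    intro s s' h h' hs hlt
    obtain ⟨l, hl, hmem⟩ := h.2.1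
    refine h'.2.2 (s / s') ?_ hlt l hl ?_
    · rw [div_eq_mul_inv, ← mul_pos_iff_of_pos_right (mul_self_pos.2 h'.1)]
      have : s * s'⁻¹ * (s' * s') = s * s' := by
        have := h'.1
        field_simp
      rwa [this]
    · rwa [div_mul_cancel₀ _ h'.1]
  have h1 := key h h' hs
  have h2 := key h' h (by rwa [mul_comm])
  have h3 : 0 < s / s' := by
    by_contra! h3
    linarith
  rw [← inv_div] at h2
  have h4 : s / s' ≤ 1 := by
    by_contra! h4
    exact h2 (inv_lt_one_of_one_lt₀ h4)
  exact (div_eq_one_iff_eq h'.1).1 (le_antisymm h4 (not_lt.1 h1))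

theorem Consec.symm {γ : Fin 5 → ℝ} {a b : Fin 5} {z : Plane} {s : ℝ}
    (h : Consec γ a z s) (hb : b ≠ a) (hz : z ∈ grid γ b) :
    Consec γ a (z + s • lineDir a) (-s) := by
  refine ⟨neg_ne_zero.2 h.1, ⟨b, hb, by simpa using hz⟩, ?_⟩
  intro r h0 h1 l hl hmem
  refine h.2.2 (1 - r) (by linarith) (by linarith) l hl ?_
  convert hmem using 1
  rw [add_assoc, ← add_smul]
  congr 2
  ring

theorem exists_int_of_ceil_ne {x d : ℝ} (h : ⌈x⌉ ≠ ⌈x + d⌉) :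
    ∃ (n : ℤ) (t : ℝ), 0 ≤ t ∧ t ≤ 1 ∧ x + t * d = n := by
  have hd : d ≠ 0 := by
    rintro rfl
    simp at h
  have key : ∃ n : ℤ, (x ≤ n ∧ (n : ℝ) ≤ x + d) ∨ (x + d ≤ n ∧ (n : ℝ) ≤ x) := by
    rcases h.lt_or_gt with h | h
    · exact ⟨⌈x⌉, Or.inl ⟨Int.le_ceil x, (Int.lt_ceil.1 h).le⟩⟩
    · exact ⟨⌈x + d⌉, Or.inr ⟨Int.le_ceil _, (Int.lt_ceil.1 h).le⟩⟩
  obtain ⟨n, hn⟩ := key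
  refine ⟨n, (n - x) / d, ?_, ?_, ?_⟩
  · rcases hn with hn | hn
    · exact div_nonneg (by linarith) (by linarith)
    · exact div_nonneg_of_nonpos (by linarith) (by linarith)
  · rcases hd.lt_or_gt with hd' | hd'
    · rw [div_le_one_of_neg hd']
      rcases hn with hn | hn <;> linarith
    · rw [div_le_one hd']
      rcases hn with hn | hn <;> linarith
  · rw [div_mul_cancel₀ _ hd]; ring

/-- Strictly before the next crossing only the label of the second grid through `z` can change. Its
value at `z` is an integer, so the ceiling jumps by one when the value increases and stays when it
decreases. -/
theorem Consec.dualVertex_eq {γ : Fin 5 → ℝ} (hγ : Regular γ) {a b : Fin 5} {z : Plane} {s : ℝ}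
    (h : Consec γ a z s) (hab : b ≠ a) (ha : z ∈ grid γ a) (hb : z ∈ grid γ b) {r : ℝ}
    (h0 : 0 < r) (h1 : r < 1) : dualVertex γ (z + (r * s) • lineDir a) =
      dualVertex γ z + (if 0 < s * sinDiff b a then 1 else 0 : ℝ) • normal b := by
  have hcell : ∀ k, (cell γ (z + (r * s) • lineDir a) k : ℝ) =
      cell γ z k + if k = b then (if 0 < s * sinDiff b a then 1 else 0 : ℝ) else 0 := by
    intro k
    have hval : cell γ (z + (r * s) • lineDir a) k =
        ⌈inner ℝ z (normal k) - γ k + r * s * sinDiff k a⌉ := by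
      unfold cell
      rw [inner_add_smul_lineDir, add_sub_right_comm]
    by_cases hka : k = a
    · subst hka
      rw [hval, sinDiff_self, if_neg hab.symm]
      simp [cell]
    by_cases hkb : k = b
    · subst hkb
      have hne := mul_ne_zero h.1 (sinDiff_ne_zero hab)
      have hz := mem_grid_iff_cell.1 hb
      have hno := fun r h0 h1 => h.2.2 r h0 h1 k hab
      simp only [add_smul_mem_grid, hz, not_exists] at hno
      rw [hval, hz, if_pos rfl]
      set n := cell γ z k
      set B := s * sinDiff k a with hB
      have hr : r * s * sinDiff k a = r * B := by rw [hB]; ring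
      have hno' : ∀ r, 0 < r → r < 1 → ∀ m : ℤ, (n : ℝ) + r * B ≠ m := by
        intro r h0 h1 m hm
        exact hno r h0 h1 m (by rw [← hm, hB]; ring)
      rw [hr]
      split_ifs with hpos
      · have h2 : ⌈(n : ℝ) + r * B⌉ = n + 1 := by
          rw [Int.ceil_eq_iff]
          push_cast
          refine ⟨by linarith [mul_pos h0 hpos], ?_⟩
          by_contra! hlt
          -- At time `1 / B` this grid would reach its next line, with value `n + 1`; in the
          -- decreasing case below, `-1 / B` is the time of the value `n - 1`.
          refine hno' (1 / B) (by positivity) ?_ (n + 1) ?_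
          · rw [div_lt_one hpos]
            nlinarith
          · push_cast
            field_simp
        rw [h2]
        push_cast
        ring
      · have hneg : B < 0 := lt_of_le_of_ne (not_lt.1 hpos) hne
        have h2 : ⌈(n : ℝ) + r * B⌉ = n := by
          rw [Int.ceil_eq_iff]
          refine ⟨?_, by nlinarith⟩
          by_contra! hlt
          refine hno' (-1 / B) (div_pos_of_neg_of_neg (by norm_num) hneg) ?_ (n - 1) ?_
          · rw [div_lt_one_of_neg hneg]
            nlinarith
          · push_cast
            field_simp
            ring
        rw [h2, add_zero]
    · rw [if_neg hkb, add_zero, hval]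
      congr 1
      by_contra hc
      obtain ⟨n, t, ht0, ht1, ht⟩ := exists_int_of_ceil_ne (Ne.symm hc)
      -- A hit at time 0 puts three grids through `z`, against regularity; a later one contradicts
      -- `Consec`.
      rcases ht0.eq_or_lt with rfl | ht0
      · exact hγ a b k hab.symm (Ne.symm hkb) (Ne.symm hka) z ⟨ha, hb, ⟨n, by linarith⟩⟩
      · refine h.2.2 (t * r) (by positivity) (by nlinarith) k hka ?_
        rw [add_smul_mem_grid]
        exact ⟨n, by rw [← ht]; ring⟩
  have : ∀ w, dualVertex γ w = ∑ k, (cell γ w k : ℝ) • normal k := fun w => rfl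
  rw [this, this]
  simp only [hcell, add_smul, Finset.sum_add_distrib, ite_smul, zero_smul, Finset.sum_ite_eq',
    Finset.mem_univ, if_true]

/-! ### Neighbors -/

theorem TileAt.exists_other {γ : Fin 5 → ℝ} {R : Rhombus} {z : Plane} (h : TileAt γ R z)
    {a : Fin 5} (ha : a = R.first ∨ a = R.second) : z ∈ grid γ a ∧
      ∃ b, b ≠ a ∧ (b = R.first ∨ b = R.second) ∧ z ∈ grid γ b := by
  rcases ha with rfl | rfl
  · exact ⟨h.1, _, R.first_ne_second.symm, Or.inr rfl, h.2.1⟩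
  · exact ⟨h.2.1, _, R.first_ne_second, Or.inl rfl, h.1⟩

/-- Duality of segments and sides: a point on a line of grid `a` is labelled by the cell on the
lower side of that line, and adding `normal a` gives the cell across it. -/
theorem Consec.mem_sides {γ : Fin 5 → ℝ} (hγ : Regular γ) {R : Rhombus} {a : Fin 5} {z : Plane}
    {s : ℝ} (h : Consec γ a z s) (hR : TileAt γ R z) (ha : a = R.first ∨ a = R.second) {r : ℝ}
    (h0 : 0 < r) (h1 : r < 1) :
    s(dualVertex γ (z + (r * s) • lineDir a), dualVertex γ (z + (r * s) • lineDir a) + normal a) ∈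
      R.sides := by
  rcases ha with rfl | rfl
  · rw [h.dualVertex_eq hγ R.first_ne_second.symm hR.1 hR.2.1 h0 h1, ← hR.2.2]
    split_ifs
    · simp [Rhombus.sides, add_right_comm]
    · simp [Rhombus.sides]
  · rw [h.dualVertex_eq hγ R.first_ne_second hR.2.1 hR.1 h0 h1, ← hR.2.2]
    split_ifs
    · simp [Rhombus.sides]
    · simp [Rhombus.sides]

/-- The four sides match the four rays from `z`. The direction of the ray is chosen so that
`Consec.dualVertex_eq` adds the other normal or not, as the side requires. -/
theorem exists_consec_of_mem_sides {γ : Fin 5 → ℝ} (hγ : Regular γ) {R : Rhombus} {z : Plane}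
    (hR : TileAt γ R z) {e : Sym2 Plane} (he : e ∈ R.sides) :
    ∃ a s, (a = R.first ∨ a = R.second) ∧ Consec γ a z s ∧ ∀ r, 0 < r → r < 1 →
      e = s(dualVertex γ (z + (r * s) • lineDir a),
        dualVertex γ (z + (r * s) • lineDir a) + normal a) := by
  have hne := sinDiff_ne_zero R.first_ne_second
  have hne' := sinDiff_ne_zero R.first_ne_second.symm
  rcases he with rfl | rfl | rfl | rfl
  · obtain ⟨s, hs, hc⟩ := exists_consec γ R.first z (neg_ne_zero.2 hne')
    refine ⟨R.first, s, Or.inl rfl, hc, fun r h0 h1 => ?_⟩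
    rw [hc.dualVertex_eq hγ R.first_ne_second.symm hR.1 hR.2.1 h0 h1, ← hR.2.2,
      if_neg (by linarith)]
    simp
  · obtain ⟨s, hs, hc⟩ := exists_consec γ R.second z (neg_ne_zero.2 hne)
    refine ⟨R.second, s, Or.inr rfl, hc, fun r h0 h1 => ?_⟩
    rw [hc.dualVertex_eq hγ R.first_ne_second hR.2.1 hR.1 h0 h1, ← hR.2.2,
      if_neg (by linarith)]
    simp
  · obtain ⟨s, hs, hc⟩ := exists_consec γ R.second z hne
    refine ⟨R.second, s, Or.inr rfl, hc, fun r h0 h1 => ?_⟩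
    rw [hc.dualVertex_eq hγ R.first_ne_second hR.2.1 hR.1 h0 h1, ← hR.2.2,
      if_pos (by linarith)]
    simp
  · obtain ⟨s, hs, hc⟩ := exists_consec γ R.first z hne'
    refine ⟨R.first, s, Or.inl rfl, hc, fun r h0 h1 => ?_⟩
    rw [hc.dualVertex_eq hγ R.first_ne_second.symm hR.1 hR.2.1 h0 h1, ← hR.2.2,
      if_pos (by linarith)]
    simp [add_right_comm]

theorem normal_injective : Function.Injective normal := by
  intro a b h
  by_contra hab
  refine sinDiff_ne_zero hab ?_
  rw [← inner_lineDir, h, inner_lineDir, sinDiff_self]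

theorem normal_add_normal_ne_zero (a b : Fin 5) : normal a + normal b ≠ 0 := by
  intro h
  have h1 : ∑ k, (((if a = k then 1 else 0) + (if b = k then 1 else 0) : ℤ) : ℝ) • normal k = 0 := by
    simpa [add_smul, Finset.sum_add_distrib] using h
  have key : ∀ a b : Fin 5, ¬ ∀ k : Fin 5,
      ((if a = k then 1 else 0) + (if b = k then 1 else 0) : ℤ) =
        (if a = 0 then 1 else 0) + (if b = 0 then 1 else 0) := by decide
  exact key a b (int_relation h1)

/-- Matching the endpoints in reverse order would give two normals with sum 0, and the integral
relations exclude this. -/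
theorem side_eq_iff {P P' : Plane} {a a' : Fin 5} :
    s(P, P + normal a) = s(P', P' + normal a') ↔ P = P' ∧ a = a' := by
  constructor
  · intro h
    rcases Sym2.eq_iff.1 h with ⟨rfl, h2⟩ | ⟨h1, h2⟩
    · exact ⟨rfl, normal_injective (add_left_cancel h2)⟩
    · exfalso
      refine normal_add_normal_ne_zero a' a ?_
      rw [h1, add_assoc] at h2
      simpa using h2
  · rintro ⟨rfl, rfl⟩
    rfl

/-- The geometric core: a shared side is dual to the grid segment between the two crossing points.
It turns adjacency of tiles into the order of crossings on a line. -/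
theorem neighbor_iff {γ : Fin 5 → ℝ} (hγ : Regular γ) {R R' : Rhombus} {z z' : Plane}
    (hR : TileAt γ R z) (hR' : TileAt γ R' z') : R.Neighbor R' ↔
      ∃ a s, (a = R.first ∨ a = R.second) ∧ Consec γ a z s ∧ z' = z + s • lineDir a := by
  constructor
  · rintro ⟨hne, e, he, he'⟩
    obtain ⟨a, s₁, ha, hc₁, hs₁⟩ := exists_consec_of_mem_sides hγ hR he
    obtain ⟨a', s₂, ha', hc₂, hs₂⟩ := exists_consec_of_mem_sides hγ hR' he'
    have key : ∀ r r', 0 < r → r < 1 → 0 < r' → r' < 1 →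
        dualVertex γ (z + (r * s₁) • lineDir a) = dualVertex γ (z' + (r' * s₂) • lineDir a') ∧
        a = a' := fun r r' h0 h1 h0' h1' =>
      side_eq_iff.1 ((hs₁ r h0 h1).symm.trans (hs₂ r' h0' h1'))
    obtain rfl : a = a' := (key (1/2) (1/2) (by norm_num) (by norm_num) (by norm_num)
      (by norm_num)).2
    have hcell := fun r r' h0 h1 h0' h1' =>
      cell_eq_of_dualVertex_eq (key r r' h0 h1 h0' h1').1
    obtain ⟨hza, b, hba, -, hzb⟩ := hR.exists_other ha
    obtain ⟨hza', b', hba', -, hzb'⟩ := hR'.exists_other ha'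
    have hline : ∀ {z : Plane} (s : ℝ), z ∈ grid γ a → z + s • lineDir a ∈ grid γ a := by
      rintro z s ⟨n, hn⟩
      exact ⟨n, by rw [inner_add_smul_lineDir, sinDiff_self, mul_zero, add_zero, hn]⟩
    have hsame : inner ℝ z (normal a) = inner ℝ z' (normal a) := by
      have e1 := mem_grid_iff_cell.1 (hline (1 / 2 * s₁) hza)
      have e2 := mem_grid_iff_cell.1 (hline (1 / 2 * s₂) hza')
      rw [hcell (1/2) (1/2) (by norm_num) (by norm_num) (by norm_num) (by norm_num) a] at e1
      rw [inner_add_smul_lineDir, sinDiff_self] at e1 e2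
      linarith
    obtain ⟨s, hs⟩ := exists_eq_add_smul_lineDir hsame
    refine ⟨a, s, ha, ⟨?_, ⟨b', hba', hs ▸ hzb'⟩, ?_⟩, hs⟩
    · rintro rfl
      rw [zero_smul, add_zero] at hs
      subst hs
      exact hne (hγ.tileAt_unique hR hR')
    · intro r h0 h1 l hl hmem
      rw [add_smul_mem_grid] at hmem
      obtain ⟨n, hn⟩ := hmem
      have hs0 : s ≠ 0 := by
        rintro rfl
        rw [zero_smul, add_zero] at hs
        subst hs
        exact hne (hγ.tileAt_unique hR hR')
      have hβ := sinDiff_ne_zero hl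
      -- points of the two sides so close to the ends that the crossing lies between them
      have hex : ∀ {c d : ℝ}, 0 < d → ∃ r, 0 < r ∧ r < 1 ∧ |r * c| < d := by
        intro c d hd
        refine ⟨min (1 / 2) (d / (2 * (|c| + 1))), lt_min (by norm_num) (by positivity),
          (min_le_left _ _).trans_lt (by norm_num), ?_⟩
        have hc := abs_nonneg c
        rw [abs_mul, abs_of_pos (lt_min (by norm_num) (by positivity))]
        calc _ ≤ d / (2 * (|c| + 1)) * |c| := by gcongr; exact min_le_right _ _
          _ < d := by
            rw [div_mul_eq_mul_div, div_lt_iff₀ (by positivity)]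
            nlinarith
      have hsp := abs_pos.2 hs0
      obtain ⟨r₁, h₁0, h₁1, h₁⟩ := hex (c := s₁) (mul_pos h0 hsp)
      obtain ⟨r₂, h₂0, h₂1, h₂⟩ := hex (c := s₂) (mul_pos (sub_pos.2 h1) hsp)
      -- Points near `z` and near `z'` have the same labels, both lying on segments dual to the
      -- common side. A crossing between them would separate the `l`-th values by the integer `n`.
      have hc := hcell r₁ r₂ h₁0 h₁1 h₂0 h₂1 l
      unfold cell at hc
      rw [hs, add_assoc, ← add_smul, inner_add_smul_lineDir, inner_add_smul_lineDir,
        add_sub_right_comm, add_sub_right_comm] at hc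
      set α := inner ℝ z (normal l) - γ l
      set β := sinDiff l a
      have hlt : ∀ {x y : ℝ}, x < n → (n : ℝ) < y → ⌈x⌉ < ⌈y⌉ := by
        intro x y hx hy
        exact (Int.ceil_le.2 hx.le).trans_lt (Int.lt_ceil.2 hy)
      rw [abs_lt] at h₁ h₂
      rcases hs0.lt_or_gt with hs' | hs' <;> rcases hβ.lt_or_gt with hβ' | hβ'
      · rw [abs_of_neg hs'] at h₁ h₂
        exact (hlt (by nlinarith) (by nlinarith)).ne hc
      · rw [abs_of_neg hs'] at h₁ h₂
        exact (hlt (by nlinarith) (by nlinarith)).ne' hc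
      · rw [abs_of_pos hs'] at h₁ h₂
        exact (hlt (by nlinarith) (by nlinarith)).ne' hc
      · rw [abs_of_pos hs'] at h₁ h₂
        exact (hlt (by nlinarith) (by nlinarith)).ne hc
  · rintro ⟨a, s, ha, hc, rfl⟩
    obtain ⟨hza, b, hba, -, hzb⟩ := hR.exists_other ha
    refine ⟨?_, _, hc.mem_sides hγ hR ha (r := 1 / 2) (by norm_num) (by norm_num), ?_⟩
    · rintro rfl
      have := hR.point_unique hR'
      rw [left_eq_add, smul_eq_zero] at this
      exact this.elim hc.1 (lineDir_ne_zero a)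
    · have hza' : z + s • lineDir a ∈ grid γ a := by
        obtain ⟨n, hn⟩ := hza
        exact ⟨n, by rw [inner_add_smul_lineDir, sinDiff_self, mul_zero, add_zero, hn]⟩
      have := (hc.symm hba hzb).mem_sides hγ hR' (hγ.first_or_second hR' hza') (r := 1 / 2)
        (by norm_num) (by norm_num)
      have e : z + s • lineDir a + (1 / 2 * -s) • lineDir a = z + (1 / 2 * s) • lineDir a := by
        rw [add_assoc, ← add_smul]
        congr 2
        ring
      rwa [e] at this

/-- Two lines through `z` and two directions on each give four next crossings; distinct rays lead to
distinct points, hence to distinct tiles. -/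
theorem ncard_neighbors {γ : Fin 5 → ℝ} (hγ : Regular γ) {R : Rhombus} {z : Plane}
    (hR : TileAt γ R z) : {R' | (∃ z', TileAt γ R' z') ∧ R.Neighbor R'}.ncard = 4 := by
  let a : Bool → Fin 5 := fun u => if u then R.first else R.second
  let σ : Bool → ℝ := fun v => if v then 1 else -1
  have hσ : ∀ v, σ v ≠ 0 := by intro v; cases v <;> simp [σ]
  have ha : ∀ u, a u = R.first ∨ a u = R.second := by intro u; cases u <;> simp [a]
  have hainj : ∀ u u', a u = a u' → u = u' := by
    have := R.first_ne_second
    intro u u' h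
    cases u <;> cases u' <;> simp_all [a]
  choose s hs hc using fun q : Bool × Bool => exists_consec γ (a q.1) z (hσ q.2)
  have hgrid : ∀ q, z + s q • lineDir (a q.1) ∈ grid γ (a q.1) := by
    intro q
    obtain ⟨n, hn⟩ := (hR.exists_other (ha q.1)).1
    exact ⟨n, by rw [inner_add_smul_lineDir, sinDiff_self, mul_zero, add_zero, hn]⟩
  have hT : ∀ q, ∃ R', TileAt γ R' (z + s q • lineDir (a q.1)) := fun q => by
    obtain ⟨l, hl, hmem⟩ := (hc q).2.1
    exact exists_tileAt hl hmem (hgrid q)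
  choose F hF using hT
  have hset : {R' | (∃ z', TileAt γ R' z') ∧ R.Neighbor R'} = Set.range F := by
    ext R'
    constructor
    · rintro ⟨⟨z', hz'⟩, hn⟩
      obtain ⟨a', s', ha', hc', rfl⟩ := (neighbor_iff hγ hR hz').1 hn
      obtain ⟨u, rfl⟩ : ∃ u, a u = a' := by
        rcases ha' with rfl | rfl
        exacts [⟨true, rfl⟩, ⟨false, rfl⟩]
      obtain ⟨v, hv⟩ : ∃ v, 0 < s' * σ v := by
        rcases hc'.1.lt_or_gt with h | h
        · exact ⟨false, by simp [σ, h]⟩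
        · exact ⟨true, by simp [σ, h]⟩
      have h1 : s (u, v) = s' := by
        refine (hc (u, v)).unique hc' ?_
        have h2 := hs (u, v)
        have h3 := mul_pos h2 hv
        have h4 : s (u, v) * σ v * (s' * σ v) = s (u, v) * s' * (σ v * σ v) := by ring
        simp only [h4] at h3
        exact (mul_pos_iff_of_pos_right (mul_self_pos.2 (hσ v))).1 h3
      refine ⟨(u, v), hγ.tileAt_unique (hF (u, v)) ?_⟩
      simpa only [h1] using hz'
    · rintro ⟨q, rfl⟩
      exact ⟨⟨_, hF q⟩, (neighbor_iff hγ hR (hF q)).2 ⟨_, _, ha _, hc q, rfl⟩⟩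
  have hinj : Function.Injective F := by
    intro q q' h
    have h1 := hF q
    rw [h] at h1
    have h2 := add_left_cancel (h1.point_unique (hF q'))
    have h3 : a q.1 = a q'.1 := by
      by_contra hne
      have h4 := congrArg (fun v => inner ℝ v (normal (a q.1))) h2
      simp only [real_inner_smul_left, inner_lineDir, sinDiff_self, mul_zero] at h4
      exact (mul_ne_zero (hc q').1 (sinDiff_ne_zero hne)) h4.symm
    rw [h3] at h2
    have h4 : s q = s q' := smul_left_injective ℝ (lineDir_ne_zero _) h2
    refine Prod.ext (hainj _ _ h3) ?_
    have e1 := hs q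
    have e2 := hs q'
    rw [h4] at e1
    rcases q with ⟨u, v⟩
    rcases q' with ⟨u', v'⟩
    cases v <;> cases v' <;> simp [σ] at e1 e2 ⊢ <;> linarith
  rw [hset, ← Set.image_univ, Set.ncard_image_of_injective _ hinj, Set.ncard_univ]
  simp

/-! ### Paths of neighboring tiles -/

/-- There is a path of `n` steps between neighboring tiles of `T`. -/
inductive Linked (T : Set Rhombus) : ℕ → Rhombus → Rhombus → Prop
  | refl {R : Rhombus} : R ∈ T → Linked T 0 R R
  | tail {n : ℕ} {R R' R'' : Rhombus} : Linked T n R R' → R'' ∈ T → R'.Neighbor R'' →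
      Linked T (n + 1) R R''

theorem Linked.right_mem {T : Set Rhombus} {n : ℕ} {R R' : Rhombus} (h : Linked T n R R') :
    R' ∈ T := by
  cases h with
  | refl h => exact h
  | tail _ h _ => exact h

theorem Linked.trans {T : Set Rhombus} {n m : ℕ} {R R' R'' : Rhombus} (h : Linked T n R R')
    (h' : Linked T m R' R'') : Linked T (n + m) R R'' := by
  induction h' with
  | refl _ => exact h
  | tail _ h1 h2 ih => exact .tail (ih h) h1 h2

theorem norm_lineDir (a : Fin 5) : ‖lineDir a‖ = 1 := by
  rw [← sq_eq_sq₀ (norm_nonneg _) zero_le_one, ← real_inner_self_eq_norm_sq, one_pow, ← one_pow 2,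
    ← norm_normal a, ← real_inner_self_eq_norm_sq, inner_plane, inner_plane]
  simp only [lineDir, Matrix.cons_val_zero, Matrix.cons_val_one, Matrix.cons_val_fin_one]
  ring

theorem add_smul_lineDir_mem {γ : Fin 5 → ℝ} {a : Fin 5} {z : Plane} (s : ℝ) (h : z ∈ grid γ a) :
    z + s • lineDir a ∈ grid γ a := by
  obtain ⟨n, hn⟩ := h
  exact ⟨n, by rw [inner_add_smul_lineDir, sinDiff_self, mul_zero, add_zero, hn]⟩

/-- Walking along the line from crossing to crossing passes only neighbors. The number of steps is
at most the number of crossings, counted by the monotone function `Φ` of the position. -/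
theorem linked_of_mem_line {γ : Fin 5 → ℝ} (hγ : Regular γ) {a : Fin 5} {R R' : Rhombus}
    {z : Plane} {s S : ℝ} (hz : z ∈ grid γ a) (hR : TileAt γ R z)
    (hR' : TileAt γ R' (z + s • lineDir a)) (hs : |s| ≤ S) :
    ∃ m ≤ ⌈4 * (S + 1)⌉₊, Linked (dualTiling γ) m R R' := by
  rcases eq_or_ne s 0 with rfl | hs0
  · rw [zero_smul, add_zero] at hR'
    rw [hγ.tileAt_unique hR hR']
    exact ⟨0, Nat.zero_le _, .refl ⟨z, hR'⟩⟩
  let α : Fin 5 → ℝ := fun l => inner ℝ z (normal l) - γ l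
  let β : Fin 5 → ℝ := fun l => s * sinDiff l a
  -- The value of grid `l` along the segment, with its sign turned so that it increases; the
  -- crossings are still at the integers, so the floor gains at least one at each.
  let h : Fin 5 → ℝ → ℝ := fun l τ => (SignType.sign (β l) : ℝ) * α l + |β l| * τ
  let Φ : ℝ → ℤ := fun τ => ∑ l ∈ Finset.univ.erase a, ⌊h l τ⌋
  have hmono : ∀ l {τ τ' : ℝ}, τ ≤ τ' → h l τ ≤ h l τ' := fun l τ τ' hle =>
    add_le_add_right (mul_le_mul_of_nonneg_left hle (abs_nonneg _)) _
  have hΦ : ∀ {τ τ' : ℝ}, τ ≤ τ' → Φ τ ≤ Φ τ' := fun hle =>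
    Finset.sum_le_sum fun l _ => Int.floor_mono (hmono l hle)
  have hstep : ∀ {τ τ' : ℝ} {l : Fin 5}, τ < τ' → l ≠ a →
      z + (τ' * s) • lineDir a ∈ grid γ l → Φ τ + 1 ≤ Φ τ' := by
    intro τ τ' l hlt hl hmem
    rw [Int.add_one_le_iff]
    refine Finset.sum_lt_sum (fun l _ => Int.floor_mono (hmono l hlt.le)) ⟨l, by simp [hl], ?_⟩
    rw [add_smul_mem_grid] at hmem
    obtain ⟨n, hn⟩ := hmem
    have hβ : β l ≠ 0 := mul_ne_zero hs0 (sinDiff_ne_zero hl)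
    have hint : h l τ' = ((SignType.sign (β l) * n : ℤ) : ℝ) := by
      push_cast
      rw [← hn]
      simp only [h]
      rw [← sign_mul_self (β l)]
      simp only [α, β]
      ring
    rw [hint, Int.floor_intCast, Int.floor_lt, ← hint]
    exact add_lt_add_right (mul_lt_mul_of_pos_left hlt (abs_pos.2 hβ)) _
  obtain ⟨hz', b', hb', -, hzb'⟩ : z + s • lineDir a ∈ grid γ a ∧ ∃ b, b ≠ a ∧
      (b = R'.first ∨ b = R'.second) ∧ z + s • lineDir a ∈ grid γ b :=
    hR'.exists_other (hγ.first_or_second hR' (add_smul_lineDir_mem s hz))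
  have main : ∀ (n : ℕ) (τ : ℝ) (R₀ : Rhombus), τ ≤ 1 →
      TileAt γ R₀ (z + (τ * s) • lineDir a) → Φ 1 - Φ τ ≤ n →
      ∃ m ≤ n, Linked (dualTiling γ) m R₀ R' := by
    intro n
    induction n with
    | zero =>
      intro τ R₀ hτ hR₀ hn
      rcases hτ.eq_or_lt with rfl | hτ
      · rw [one_mul] at hR₀
        rw [hγ.tileAt_unique hR₀ hR']
        exact ⟨0, le_rfl, .refl ⟨_, hR'⟩⟩
      · have := hstep hτ hb' (by rwa [one_mul])
        omega
    | succ n ih =>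
      intro τ R₀ hτ hR₀ hn
      rcases hτ.eq_or_lt with rfl | hτ
      · rw [one_mul] at hR₀
        rw [hγ.tileAt_unique hR₀ hR']
        exact ⟨0, Nat.zero_le _, .refl ⟨_, hR'⟩⟩
      obtain ⟨s₁, hs₁, hc⟩ := exists_consec γ a (z + (τ * s) • lineDir a) hs0
      have hq : 0 < s₁ / s := by
        rw [← mul_pos_iff_of_pos_right (mul_self_pos.2 hs0)]
        have : s₁ / s * (s * s) = s₁ * s := by field_simp
        rwa [this]
      have hpt : z + (τ * s) • lineDir a + s₁ • lineDir a = z + ((τ + s₁ / s) * s) • lineDir a := by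
        rw [add_assoc, ← add_smul]
        congr 2
        field_simp
      obtain ⟨l, hl, hmem⟩ := hc.2.1
      have hza := add_smul_lineDir_mem (γ := γ) (τ * s) hz
      obtain ⟨R₁, hR₁⟩ := exists_tileAt hl hmem (add_smul_lineDir_mem s₁ hza)
      have hN := (neighbor_iff hγ hR₀ hR₁).2 ⟨a, s₁, hγ.first_or_second hR₀ hza, hc, rfl⟩
      rw [hpt] at hmem hR₁
      -- The next crossing cannot lie beyond the end point, which is itself a crossing with grid
      -- `b'`.
      have hle : τ + s₁ / s ≤ 1 := by
        by_contra! hlt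
        have h1τ : 0 < 1 - τ := by linarith
        refine hc.2.2 ((1 - τ) / (s₁ / s)) (by positivity) ?_ b' hb' ?_
        · rw [div_lt_one hq]
          linarith
        · convert hzb' using 1
          rw [add_assoc, ← add_smul]
          congr 2
          have := hc.1
          field_simp
          ring
      have h1 := hstep (lt_add_of_pos_right τ hq) hl hmem
      obtain ⟨m, hm, hL⟩ := ih (τ + s₁ / s) R₁ hle hR₁ (by push_cast at hn; omega)
      exact ⟨1 + m, by omega, Linked.trans (.tail (.refl ⟨_, hR₀⟩) ⟨_, hR₁⟩ hN) hL⟩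
  refine main _ 0 R zero_le_one (by simpa using hR) ?_
  have hbound : ((Φ 1 - Φ 0 : ℤ) : ℝ) ≤ 4 * (S + 1) := by
    have h1 : ((Φ 1 - Φ 0 : ℤ) : ℝ) ≤ ∑ l ∈ Finset.univ.erase a, (S + 1) := by
      simp only [Φ]
      rw [← Finset.sum_sub_distrib]
      push_cast
      refine Finset.sum_le_sum fun l _ => ?_
      have h1 := Int.floor_le (h l 1)
      have h2 := Int.lt_floor_add_one (h l 0)
      have h3 : |β l| ≤ S := by
        simp only [β, abs_mul]
        have := abs_sinDiff_le l a
        have := abs_nonneg s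
        nlinarith [abs_nonneg (sinDiff l a)]
      simp only [h] at h1 h2 ⊢
      linarith
    rw [Finset.sum_const, Finset.card_erase_of_mem (Finset.mem_univ _)] at h1
    simp only [Finset.card_univ, Fintype.card_fin, nsmul_eq_mul] at h1
    norm_num at h1 ⊢
    linarith
  have := hbound.trans (Nat.le_ceil _)
  exact_mod_cast this

/-- By `frame_identity`, the difference of dual vertices is `(5/2) (z' - z)` up to the rounding
errors, which are at most one for each of the five unit normals. -/
theorem norm_sub_le_of_dualVertex (γ : Fin 5 → ℝ) (z z' : Plane) :
    ‖z' - z‖ ≤ ‖dualVertex γ z' - dualVertex γ z‖ + 5 := by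
  have h1 : (5 / 2 : ℝ) • (z' - z) = (dualVertex γ z' - dualVertex γ z) +
      ∑ k, (inner ℝ (z' - z) (normal k) - ((cell γ z' k : ℝ) - cell γ z k)) • normal k := by
    have : ∀ w, dualVertex γ w = ∑ k, (cell γ w k : ℝ) • normal k := fun w => rfl
    rw [← frame_identity, this, this]
    simp only [sub_smul, Finset.sum_sub_distrib]
    abel
  have h2 : ‖∑ k, (inner ℝ (z' - z) (normal k) - ((cell γ z' k : ℝ) - cell γ z k)) • normal k‖ ≤
      5 := by
    refine (norm_sum_le _ _).trans ?_
    have : (5 : ℝ) = ∑ k : Fin 5, 1 := by simp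
    rw [this]
    refine Finset.sum_le_sum fun k _ => ?_
    rw [norm_smul, norm_normal, mul_one, Real.norm_eq_abs, abs_le, inner_sub_left]
    have e1 := Int.le_ceil (inner ℝ z (normal k) - γ k)
    have e2 := Int.ceil_lt_add_one (inner ℝ z (normal k) - γ k)
    have e3 := Int.le_ceil (inner ℝ z' (normal k) - γ k)
    have e4 := Int.ceil_lt_add_one (inner ℝ z' (normal k) - γ k)
    unfold cell
    constructor <;> linarith
  have h3 := norm_add_le (dualVertex γ z' - dualVertex γ z)
    (∑ k, (inner ℝ (z' - z) (normal k) - ((cell γ z' k : ℝ) - cell γ z k)) • normal k)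
  rw [← h1, norm_smul] at h3
  norm_num at h3
  linarith [norm_nonneg (z' - z)]

/-- The route follows one line through `z` to its intersection `w` with a line through `z'` of
another grid, and then that line to `z'`. Angles between grids are bounded below, so both pieces
have bounded length. -/
theorem exists_linked_dualTiling (ρ : ℝ) : ∃ N : ℕ, ∀ γ : Fin 5 → ℝ, Regular γ →
    ∀ R ∈ dualTiling γ, ∀ R' ∈ dualTiling γ, ‖R'.center - R.center‖ ≤ ρ →
      ∃ m ≤ N, Linked (dualTiling γ) m R R' := by
  obtain ⟨c, hc0, hc⟩ : ∃ c : ℝ, 0 < c ∧ ∀ a b : Fin 5, a ≠ b → c ≤ |sinDiff a b| := by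
    have hne : (Finset.univ.filter fun q : Fin 5 × Fin 5 => q.1 ≠ q.2).Nonempty :=
      ⟨(0, 1), by simp⟩
    obtain ⟨q, hq, hmin⟩ := Finset.exists_min_image _ (fun q => |sinDiff q.1 q.2|) hne
    refine ⟨_, abs_pos.2 (sinDiff_ne_zero (Finset.mem_filter.1 hq).2), fun a b hab => ?_⟩
    exact hmin (a, b) (by simpa using hab)
  -- `7 = 5 + 1 + 1`: the rounding error of `norm_sub_le_of_dualVertex` and the two distances from
  -- corner to center. Dividing by `c` bounds the way to `w`.
  refine ⟨⌈4 * ((ρ + 7) / c + 1)⌉₊ + ⌈4 * (((ρ + 7) + (ρ + 7) / c) + 1)⌉₊, ?_⟩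
  rintro γ hγ R ⟨z, hR⟩ R' ⟨z', hR'⟩ hρ
  change TileAt γ R z at hR
  change TileAt γ R' z' at hR'
  have hdist : ‖z' - z‖ ≤ ρ + 7 := by
    have h1 := norm_sub_le_of_dualVertex γ z z'
    have h2 : ∀ R : Rhombus, ‖R.center - R.corner‖ ≤ 1 := by
      intro R
      rw [Rhombus.center, add_sub_cancel_left, norm_smul]
      have := norm_add_le (normal R.first) (normal R.second)
      rw [norm_normal, norm_normal] at this
      norm_num
      linarith
    have h3 : dualVertex γ z' - dualVertex γ z = (R'.center - R.center) -
        (R'.center - R'.corner) + (R.center - R.corner) := by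
      rw [← hR.2.2, ← hR'.2.2]
      abel
    have h4 := norm_add_le ((R'.center - R.center) - (R'.center - R'.corner))
      (R.center - R.corner)
    have h5 := norm_sub_le (R'.center - R.center) (R'.center - R'.corner)
    rw [← h3] at h4
    linarith [h2 R, h2 R']
  obtain ⟨b, hb, hbz'⟩ : ∃ b, b ≠ R.first ∧ z' ∈ grid γ b := by
    by_cases h : R'.first = R.first
    · exact ⟨R'.second, fun h' => R'.first_ne_second (h.trans h'.symm), hR'.2.1⟩
    · exact ⟨R'.first, h, hR'.1⟩
  have hβ := sinDiff_ne_zero hb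
  set s := inner ℝ (z' - z) (normal b) / sinDiff b R.first with hs
  set w := z + s • lineDir R.first with hw
  have hwb : inner ℝ w (normal b) = inner ℝ z' (normal b) := by
    rw [hw, inner_add_smul_lineDir, hs, div_mul_cancel₀ _ hβ, inner_sub_left]
    ring
  have hs_le : |s| ≤ (ρ + 7) / c := by
    rw [hs, abs_div]
    have := abs_real_inner_le_norm (z' - z) (normal b)
    rw [norm_normal, mul_one] at this
    exact div_le_div₀ (by linarith [norm_nonneg (z' - z)]) (this.trans hdist) hc0 (hc _ _ hb)
  have hwgb : w ∈ grid γ b := by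
    obtain ⟨n, hn⟩ := hbz'
    exact ⟨n, by rw [hwb, hn]⟩
  obtain ⟨R₁, hR₁⟩ := exists_tileAt hb hwgb (add_smul_lineDir_mem s hR.1)
  obtain ⟨s', hs'⟩ := exists_eq_add_smul_lineDir hwb
  have hs'_le : |s'| ≤ (ρ + 7) + (ρ + 7) / c := by
    have h1 : |s'| = ‖(z' - z) - s • lineDir R.first‖ := by
      have : (z' - z) - s • lineDir R.first = s' • lineDir b := by
        rw [hs', hw]
        abel
      rw [this, norm_smul, norm_lineDir, mul_one, Real.norm_eq_abs]
    rw [h1]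
    refine (norm_sub_le _ _).trans ?_
    rw [norm_smul, norm_lineDir, mul_one, Real.norm_eq_abs]
    exact add_le_add hdist hs_le
  obtain ⟨m₁, hm₁, hL₁⟩ := linked_of_mem_line hγ hR.1 hR hR₁ hs_le
  obtain ⟨m₂, hm₂, hL₂⟩ := linked_of_mem_line hγ hwgb hR₁ (hs' ▸ hR') hs'_le
  exact ⟨m₁ + m₂, add_le_add hm₁ hm₂, hL₁.trans hL₂⟩

/-! ### Translates -/

theorem moveToOrigin_injective (v : Plane) : Function.Injective (Rhombus.moveToOrigin v) := by
  intro R R' h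
  simp only [Rhombus.moveToOrigin, Rhombus.mk.injEq] at h
  exact Rhombus.ext (sub_left_injective h.1) h.2.1 h.2.2

theorem sides_moveToOrigin (v : Plane) (R : Rhombus) :
    (R.moveToOrigin v).sides = Sym2.map (· - v) '' R.sides := by
  simp only [Rhombus.sides, Set.image_insert_eq, Set.image_singleton, Sym2.map_mk,
    Rhombus.moveToOrigin, Rhombus.second, add_sub_right_comm]

theorem neighbor_moveToOrigin (v : Plane) (R R' : Rhombus) :
    (R.moveToOrigin v).Neighbor (R'.moveToOrigin v) ↔ R.Neighbor R' := by
  unfold Rhombus.Neighbor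
  rw [(moveToOrigin_injective v).ne_iff, sides_moveToOrigin, sides_moveToOrigin,
    ← Set.image_inter (Sym2.map.injective sub_left_injective), Set.image_nonempty]

theorem Rhombus.Neighbor.symm {R R' : Rhombus} (h : R.Neighbor R') : R'.Neighbor R :=
  ⟨h.1.symm, by rw [Set.inter_comm]; exact h.2⟩

theorem Linked.moveToOrigin {T : Set Rhombus} {n : ℕ} {R R' : Rhombus} (v : Plane)
    (h : Linked T n R R') :
    Linked (Rhombus.moveToOrigin v '' T) n (R.moveToOrigin v) (R'.moveToOrigin v) := by
  induction h with
  | refl h => exact .refl (Set.mem_image_of_mem _ h)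
  | tail _ h1 h2 ih =>
    exact .tail ih (Set.mem_image_of_mem _ h1) ((neighbor_moveToOrigin v _ _).2 h2)

theorem IsPenroseTiling.eq_of_center_eq {T : Set Rhombus} (hT : IsPenroseTiling T)
    {R R' : Rhombus} (hR : R ∈ T) (hR' : R' ∈ T) (h : R.center = R'.center) : R = R' := by
  obtain ⟨γ, -, -, v, rfl⟩ := hT
  obtain ⟨R, ⟨z, hz⟩, rfl⟩ := hR
  obtain ⟨R', ⟨z', hz'⟩, rfl⟩ := hR'
  rw [center_moveToOrigin, center_moveToOrigin] at h
  rw [TileAt.eq_of_center_eq (z := z) (z' := z') hz hz' (sub_left_injective h)]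

theorem IsPenroseTiling.ncard_neighbors {T : Set Rhombus} (hT : IsPenroseTiling T)
    {R : Rhombus} (hR : R ∈ T) : {R' | R' ∈ T ∧ R.Neighbor R'}.ncard = 4 := by
  obtain ⟨γ, -, hγ, v, rfl⟩ := hT
  obtain ⟨R, ⟨z, hz⟩, rfl⟩ := hR
  suffices h : {R' | R' ∈ Rhombus.moveToOrigin v '' dualTiling γ ∧ (R.moveToOrigin v).Neighbor R'} =
      Rhombus.moveToOrigin v '' {R' | (∃ z', TileAt γ R' z') ∧ R.Neighbor R'} by
    rw [h, Set.ncard_image_of_injective _ (moveToOrigin_injective v)]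
    exact Penrose.ncard_neighbors hγ (z := z) hz
  ext R'
  constructor
  · rintro ⟨⟨R₁, h, rfl⟩, hn⟩
    exact ⟨R₁, ⟨h, (neighbor_moveToOrigin v _ _).1 hn⟩, rfl⟩
  · rintro ⟨R₁, ⟨h, hn⟩, rfl⟩
    exact ⟨⟨R₁, h, rfl⟩, (neighbor_moveToOrigin v _ _).2 hn⟩

theorem exists_linked (ρ : ℝ) : ∃ N : ℕ, ∀ T : Set Rhombus, IsPenroseTiling T →
    ∀ R ∈ T, ∀ R' ∈ T, ‖R'.center - R.center‖ ≤ ρ → ∃ m ≤ N, Linked T m R R' := by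
  obtain ⟨N, hN⟩ := exists_linked_dualTiling ρ
  refine ⟨N, ?_⟩
  rintro _ ⟨γ, -, hγ, v, rfl⟩ _ ⟨R, hR, rfl⟩ _ ⟨R', hR', rfl⟩ h
  rw [center_moveToOrigin, center_moveToOrigin, sub_sub_sub_cancel_right] at h
  obtain ⟨m, hm, hL⟩ := hN γ hγ R hR R' hR' h
  exact ⟨m, hm, hL.moveToOrigin v⟩

/-! ### Configurations and shifts -/

theorem zero_mem_centers (ω : Config) : (0 : Plane) ∈ centers ω := by
  obtain ⟨R, hR, h⟩ := ω.rooted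
  exact ⟨R, hR, h⟩

theorem shift_tiles {x : Plane} {ω : Config} (h : x ∈ centers ω) :
    (shift x ω).tiles = Rhombus.moveToOrigin x '' ω.tiles := by
  rw [shift, dif_pos h]

theorem moveToOrigin_zero (R : Rhombus) : R.moveToOrigin 0 = R := by
  simp [Rhombus.moveToOrigin]

theorem moveToOrigin_moveToOrigin (x y : Plane) (R : Rhombus) :
    (R.moveToOrigin x).moveToOrigin y = R.moveToOrigin (y + x) := by
  simp [Rhombus.moveToOrigin, sub_sub, add_comm]

theorem shift_zero (ω : Config) : shift 0 ω = ω := by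
  refine Config.ext ?_
  rw [shift_tiles (zero_mem_centers ω)]
  simp [moveToOrigin_zero]

theorem mem_centers_shift {x y : Plane} {ω : Config} (h : x ∈ centers ω) :
    y ∈ centers (shift x ω) ↔ y + x ∈ centers ω := by
  simp only [centers, shift_tiles h, Set.mem_image, exists_exists_and_eq_and,
    center_moveToOrigin, sub_eq_iff_eq_add]

theorem shift_shift {x y : Plane} {ω : Config} (h : x ∈ centers ω) (h' : y + x ∈ centers ω) :
    shift y (shift x ω) = shift (y + x) ω := by
  refine Config.ext ?_
  rw [shift_tiles h', shift_tiles ((mem_centers_shift h).2 h'), shift_tiles h, Set.image_image]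
  simp only [moveToOrigin_moveToOrigin]

theorem shift_neg_shift {x : Plane} {ω : Config} (h : x ∈ centers ω) :
    shift (-x) (shift x ω) = ω := by
  rw [shift_shift h (by rw [neg_add_cancel]; exact zero_mem_centers ω), neg_add_cancel, shift_zero]

theorem nbrs_subset_centers (ω : Config) : nbrs ω ⊆ centers ω := by
  rintro e ⟨R, -, R', hR', -, h, -⟩
  exact ⟨R', hR', h⟩

theorem mem_nbrs_shift {x e : Plane} {ω : Config} (h : x ∈ centers ω) :
    e ∈ nbrs (shift x ω) ↔ ∃ R ∈ ω.tiles, ∃ R' ∈ ω.tiles,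
      R.center = x ∧ R'.center = e + x ∧ R.Neighbor R' := by
  simp only [nbrs, shift_tiles h, Set.mem_ofPred_eq, Set.exists_mem_image, center_moveToOrigin,
    neighbor_moveToOrigin, sub_eq_iff_eq_add, zero_add]

theorem neg_mem_nbrs_shift {e : Plane} {ω : Config} (h : e ∈ nbrs ω) :
    -e ∈ nbrs (shift e ω) := by
  rw [mem_nbrs_shift (nbrs_subset_centers ω h), neg_add_cancel]
  obtain ⟨R, hR, R', hR', h0, he, hn⟩ := h
  exact ⟨R', hR', R, hR, he, h0, hn.symm⟩

/-- The neighbor relation seen from the other end of the step; with invariance of the measure this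
gives reversibility. -/
theorem mem_nbrs_iff_neg_mem {e : Plane} {ω : Config} :
    e ∈ nbrs ω ↔ e ∈ centers ω ∧ -e ∈ nbrs (shift e ω) := by
  refine ⟨fun h => ⟨nbrs_subset_centers ω h, neg_mem_nbrs_shift h⟩, fun ⟨h, h'⟩ => ?_⟩
  have := neg_mem_nbrs_shift h'
  rwa [shift_neg_shift h, neg_neg] at this

theorem ncard_nbrs (ω : Config) : (nbrs ω).ncard = 4 := by
  obtain ⟨R, hR, h0⟩ := ω.rooted
  rw [← ω.isPenrose.ncard_neighbors hR]
  have h : nbrs ω = Rhombus.center '' {R' | R' ∈ ω.tiles ∧ R.Neighbor R'} := by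
    ext e
    constructor
    · rintro ⟨R₁, hR₁, R', hR', h1, he, hn⟩
      rw [ω.isPenrose.eq_of_center_eq hR₁ hR (h1.trans h0.symm)] at hn
      exact ⟨R', ⟨hR', hn⟩, he⟩
    · rintro ⟨R', ⟨hR', hn⟩, he⟩
      exact ⟨R, hR, R', hR', h0, he, hn⟩
  rw [h]
  exact Set.InjOn.ncard_image fun R₁ h₁ R₂ h₂ =>
    ω.isPenrose.eq_of_center_eq h₁.1 h₂.1

theorem finite_nbrs (ω : Config) : (nbrs ω).Finite :=
  Set.finite_of_ncard_ne_zero (by rw [ncard_nbrs]; norm_num)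

/-- The vector between two centers passes through an endpoint of the common side, and the offset
from a center to a vertex takes finitely many values. -/
theorem finite_allSteps : allSteps.Finite := by
  let D : Set Plane := Set.range fun q : (Fin 5 × Fin 5) × Bool × Bool =>
    ((if q.2.1 then 1 / 2 else -(1 / 2) : ℝ) • normal q.1.1 +
      (if q.2.2 then 1 / 2 else -(1 / 2) : ℝ) • normal q.1.2)
  have hD : D.Finite := Set.finite_range _
  have hside : ∀ (R : Rhombus) (s : Sym2 Plane), s ∈ R.sides → ∀ P ∈ s, P - R.center ∈ D := by
    have h2 : ∀ (R : Rhombus) (u v : Bool), R.corner + (if u then normal R.first else 0) +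
        (if v then normal R.second else 0) - R.center ∈ D := by
      intro R u v
      refine ⟨((R.first, R.second), u, v), ?_⟩
      simp only [Rhombus.center]
      cases u <;> cases v <;> simp only [Bool.false_eq_true, if_false, if_true] <;> module
    rintro R s (rfl | rfl | rfl | rfl) P hP <;> rcases Sym2.mem_iff.1 hP with rfl | rfl
    · simpa using h2 R false false
    · simpa using h2 R true false
    · simpa using h2 R false false
    · simpa using h2 R false true
    · simpa using h2 R true false
    · simpa using h2 R true true
    · simpa using h2 R false true
    · simpa using h2 R true true
  refine (hD.image2 (fun a b => a - b) hD).subset ?_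
  rintro e ⟨ω, R, -, R', -, h0, rfl, -, s, hs, hs'⟩
  refine ⟨_, hside R s hs _ s.out_fst_mem, _, hside R' s hs' _ s.out_fst_mem, ?_⟩
  simp [h0]

theorem neg_mem_allSteps {e : Plane} (h : e ∈ allSteps) : -e ∈ allSteps := by
  obtain ⟨ω, hω⟩ := h
  exact ⟨_, neg_mem_nbrs_shift hω⟩

theorem mem_allSteps {e : Plane} {ω : Config} (h : e ∈ nbrs ω) : e ∈ allSteps := ⟨ω, h⟩

theorem mem_allCenters {x : Plane} {ω : Config} (h : x ∈ centers ω) : x ∈ allCenters := ⟨ω, h⟩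

/-- Differences of centers are integral combinations of the normals up to finitely many
half-vectors. Countability allows almost sure statements to hold for all centers at once. -/
theorem countable_allCenters : allCenters.Countable := by
  refine (Set.countable_range fun q : (Fin 5 → ℤ) × (Fin 5 × Bool) × (Fin 5 × Bool) =>
    (∑ k, (q.1 k : ℝ) • normal k) + (1 / 2 : ℝ) • (normal q.2.1.1 + normal (q.2.1.1 + step q.2.1.2))
      - (1 / 2 : ℝ) • (normal q.2.2.1 + normal (q.2.2.1 + step q.2.2.2))).mono ?_
  rintro x ⟨ω, R, hR, rfl⟩
  obtain ⟨R₀, hR₀, h₀⟩ := ω.rooted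
  obtain ⟨γ, -, -, v, hT⟩ := ω.isPenrose
  rw [hT] at hR hR₀
  obtain ⟨R, ⟨z, -, -, hz⟩, rfl⟩ := hR
  obtain ⟨R₀, ⟨z₀, -, -, hz₀⟩, rfl⟩ := hR₀
  refine ⟨(fun k => cell γ z k - cell γ z₀ k, (R.first, R.thick), (R₀.first, R₀.thick)), ?_⟩
  rw [center_moveToOrigin, sub_eq_zero] at h₀
  rw [center_moveToOrigin, ← h₀, Rhombus.center, Rhombus.center, hz, hz₀]
  have : ∀ w, dualVertex γ w = ∑ k, (cell γ w k : ℝ) • normal k := fun w => rfl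
  rw [this, this]
  simp only [Int.cast_sub, sub_smul, Finset.sum_sub_distrib, Rhombus.second]
  abel

/-- Every point that occurs as a center is reached from the origin by a bounded number of steps
between neighbors. -/
theorem exists_linked_center (x : Plane) : ∃ N : ℕ, ∀ ω : Config, x ∈ centers ω →
    ∃ m ≤ N, ∃ R ∈ ω.tiles, ∃ R' ∈ ω.tiles, R.center = 0 ∧ R'.center = x ∧
      Linked ω.tiles m R R' := by
  obtain ⟨N, hN⟩ := exists_linked ‖x‖
  refine ⟨N, fun ω ⟨R', hR', hx⟩ => ?_⟩
  obtain ⟨R, hR, h0⟩ := ω.rooted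
  obtain ⟨m, hm, hL⟩ := hN _ ω.isPenrose R hR R' hR' (by rw [hx, h0, sub_zero])
  exact ⟨m, hm, R, hR, R', hR', h0, hx, hL⟩

/-! ### Shifts in terms of the parameters -/

/-- The tile at the origin of the configuration with parameters `p'` is, up to a translation, the
tile with center `x` of the configuration with parameters `p`; `m` is the difference of the grid
labels. -/
def Rel (x : Plane) (m : Fin 5 → ℤ) (p p' : RawParam) : Prop :=
  (∃ z : Plane, ∀ k, offsets p' k = offsets p k + m k - inner ℝ z (normal k)) ∧
    x = ∑ k, (m k : ℝ) • normal k + (rootTile p').center - (rootTile p).center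

theorem Rel.symm {x : Plane} {m : Fin 5 → ℤ} {p p' : RawParam} (h : Rel x m p p') :
    Rel (-x) (-m) p' p := by
  obtain ⟨⟨z, hz⟩, hx⟩ := h
  refine ⟨⟨-z, fun k => ?_⟩, ?_⟩
  · rw [hz, Pi.neg_apply, inner_neg_left]
    push_cast
    ring
  · rw [hx]
    simp only [Pi.neg_apply, Int.cast_neg, neg_smul, Finset.sum_neg_distrib]
    abel

theorem rel_neg_iff {x : Plane} {m : Fin 5 → ℤ} {p p' : RawParam} :
    Rel (-x) (-m) p' p ↔ Rel x m p p' :=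
  ⟨fun h => by simpa using h.symm, Rel.symm⟩

section Translation

variable {γ γ' : Fin 5 → ℝ} {m : Fin 5 → ℤ} {z : Plane}

theorem mem_grid_translate (h : ∀ k, γ' k = γ k + m k - inner ℝ z (normal k)) {w : Plane}
    {k : Fin 5} : w ∈ grid γ' k ↔ w + z ∈ grid γ k := by
  simp only [grid, Set.mem_ofPred_eq, inner_add_left, h]
  constructor
  · rintro ⟨n, hn⟩
    exact ⟨n + m k, by push_cast; linarith⟩
  · rintro ⟨n, hn⟩
    exact ⟨n - m k, by push_cast; linarith⟩

theorem dualVertex_translate (h : ∀ k, γ' k = γ k + m k - inner ℝ z (normal k)) (w : Plane) :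
    dualVertex γ (w + z) = dualVertex γ' w + ∑ k, (m k : ℝ) • normal k := by
  unfold dualVertex
  rw [← Finset.sum_add_distrib]
  refine Finset.sum_congr rfl fun k _ => ?_
  rw [← add_smul, h, inner_add_left]
  congr 1
  have : inner ℝ w (normal k) + inner ℝ z (normal k) - γ k =
      (inner ℝ w (normal k) - (γ k + m k - inner ℝ z (normal k))) + m k := by ring
  rw [this, Int.ceil_add_intCast]
  push_cast
  ring

theorem tileAt_translate (h : ∀ k, γ' k = γ k + m k - inner ℝ z (normal k)) {R : Rhombus}
    {w : Plane} : TileAt γ' R w ↔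
      TileAt γ (R.moveToOrigin (-∑ k, (m k : ℝ) • normal k)) (w + z) := by
  unfold TileAt
  rw [mem_grid_translate h, mem_grid_translate h, dualVertex_translate h]
  simp [Rhombus.moveToOrigin, Rhombus.second]

theorem regular_translate (h : ∀ k, γ' k = γ k + m k - inner ℝ z (normal k)) (hγ : Regular γ) :
    Regular γ' := by
  intro i j k h1 h2 h3 w hw
  simp only [mem_grid_translate h] at hw
  exact hγ i j k h1 h2 h3 _ hw

theorem dualTiling_translate (h : ∀ k, γ' k = γ k + m k - inner ℝ z (normal k)) :
    dualTiling γ' = Rhombus.moveToOrigin (∑ k, (m k : ℝ) • normal k) '' dualTiling γ := by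
  ext R
  constructor
  · rintro ⟨w, hw⟩
    refine ⟨_, ⟨w + z, (tileAt_translate h (R := R)).1 hw⟩, ?_⟩
    rw [moveToOrigin_moveToOrigin, add_neg_cancel, moveToOrigin_zero]
  · rintro ⟨R, ⟨w, hw⟩, rfl⟩
    refine ⟨w - z, (tileAt_translate h).2 ?_⟩
    rw [moveToOrigin_moveToOrigin, neg_add_cancel, moveToOrigin_zero, sub_add_cancel]
    exact hw

end Translation

/-- Moving the origin of the pentagrid to `z` and relabelling the grids by `m` only translates the
dual tiling. -/
theorem Rel.exists_shift_eq {x : Plane} {m : Fin 5 → ℤ} {p p' : RawParam} (h : Rel x m p p')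
    (hp : Regular (offsets p)) : ∃ hp' : Regular (offsets p'),
      x ∈ centers (configOf ⟨p, hp⟩) ∧ shift x (configOf ⟨p, hp⟩) = configOf ⟨p', hp'⟩ := by
  obtain ⟨⟨z, hz⟩, hx⟩ := h
  have hx' : x + (rootTile p).center =
      (rootTile p').center + ∑ k, (m k : ℝ) • normal k := by
    rw [hx]
    abel
  have hc : x ∈ centers (configOf ⟨p, hp⟩) := by
    have hmem := rootTile_mem p'
    rw [dualTiling_translate hz] at hmem
    obtain ⟨R, hR, hR'⟩ := hmem
    refine ⟨R.moveToOrigin (rootTile p).center, Set.mem_image_of_mem _ hR, ?_⟩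
    have := congrArg Rhombus.center hR'
    rw [center_moveToOrigin] at this ⊢
    rw [hx, ← this]
    abel
  refine ⟨regular_translate hz hp, hc, Config.ext ?_⟩
  rw [shift_tiles hc]
  change _ '' (_ '' _) = _ '' dualTiling (offsets p')
  rw [dualTiling_translate hz, Set.image_image, Set.image_image]
  simp only [moveToOrigin_moveToOrigin, hx']

/-- The fundamental domain of the parameters of one torus. -/
def unitSquare : Set (ℝ × ℝ) := Set.Ico 0 1 ×ˢ Set.Ico 0 1

theorem offsets_of_sum {t : Fin 5 × Bool} {c : Fin 5 → ℝ} (hs : ∑ k, c k = 1) (h₁ : c t.1 = 0)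
    (h₂ : c (t.1 + step t.2) = 0) (k : Fin 5) :
    offsets (t, (c (t.1 + 3), c (t.1 + 4))) k = c k := by
  rw [Fin.sum_univ_five] at hs
  obtain ⟨i, u⟩ := t
  fin_cases i <;> cases u <;> simp [step] at h₁ h₂ <;> fin_cases k <;>
    simp [offsets, step, *] <;> linarith

/-- The index whose offset is determined by the others. -/
def lastIndex (t : Fin 5 × Bool) : Fin 5 := t.1 + step !t.2

/-- The pentagrid is re-centered at the crossing dual to the tile at `x`, and its offsets are
reduced modulo 1. -/
theorem exists_rel {p : RawParam} {x : Plane} (hp : Regular (offsets p))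
    (hx : x ∈ centers (configOf ⟨p, hp⟩)) :
    ∃ t' m, ∃ q' ∈ unitSquare, Rel x m p (t', q') := by
  obtain ⟨_, ⟨R, ⟨z, hR⟩, rfl⟩, rfl⟩ := hx
  change TileAt _ R z at hR
  set γ := offsets p with hγ
  set t : Fin 5 × Bool := (R.first, R.thick) with ht
  have hl : t.1 ≠ lastIndex t ∧ t.1 + step t.2 ≠ lastIndex t ∧ t.1 + 3 ≠ lastIndex t ∧
      t.1 + 4 ≠ lastIndex t := by
    have : ∀ t : Fin 5 × Bool, t.1 ≠ lastIndex t ∧ t.1 + step t.2 ≠ lastIndex t ∧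
        t.1 + 3 ≠ lastIndex t ∧ t.1 + 4 ≠ lastIndex t := by unfold lastIndex; decide
    exact this t
  -- Ceilings bring the offsets into `[0, 1)`; the last index is corrected to make `m` sum to 0,
  -- which keeps the total offset equal to 1.
  set m : Fin 5 → ℤ := fun k => cell γ z k - if k = lastIndex t then ∑ k, cell γ z k else 0 with hm
  set c : Fin 5 → ℝ := fun k => m k - (inner ℝ z (normal k) - γ k) with hc
  have hm_ne : ∀ k, k ≠ lastIndex t → m k = cell γ z k := by
    intro k hk
    simp [hm, hk]
  have hsum : ∑ k, c k = 1 := by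
    have h1 : ∑ k, inner ℝ z (normal k) = 0 := by rw [← inner_sum, sum_normal, inner_zero_right]
    have h2 : ∑ k, γ k = 1 := sum_offsets p
    simp only [hc, hm, Finset.sum_sub_distrib, Int.cast_sub, h1, h2]
    push_cast
    simp
  have h0 : ∀ k, k ≠ lastIndex t → z ∈ grid γ k → c k = 0 := by
    intro k hk hz
    simp only [hc, hm_ne k hk, mem_grid_iff_cell.1 hz, sub_self]
  have hIco : ∀ k, k ≠ lastIndex t → c k ∈ Set.Ico (0 : ℝ) 1 := by
    intro k hk
    simp only [hc, hm_ne k hk, cell, Set.mem_Ico]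
    have h1 := Int.le_ceil (inner ℝ z (normal k) - γ k)
    have h2 := Int.ceil_lt_add_one (inner ℝ z (normal k) - γ k)
    constructor <;> linarith
  have hoff := offsets_of_sum (t := t) hsum (h0 _ hl.1 hR.1) (h0 _ hl.2.1 hR.2.1)
  have hz : ∀ k, offsets (t, (c (t.1 + 3), c (t.1 + 4))) k =
      γ k + m k - inner ℝ z (normal k) := by
    intro k
    rw [hoff]
    simp only [hc]
    ring
  refine ⟨t, m, (c (t.1 + 3), c (t.1 + 4)), ⟨hIco _ hl.2.2.1, hIco _ hl.2.2.2⟩, ⟨z, hz⟩, ?_⟩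
  have h1 := dualVertex_translate hz 0
  rw [zero_add] at h1
  rw [center_moveToOrigin]
  simp only [Rhombus.center, hR.2.2, h1, rootTile, Rhombus.second, ht]
  abel

/-- The center determines the tile, hence its type and `z`. The offsets are then fixed modulo
integers, and the fundamental domain leaves no choice. -/
theorem Rel.unique {x : Plane} {m m' : Fin 5 → ℤ} {p p' p'' : RawParam} (h : Rel x m p p')
    (h' : Rel x m' p p'') (hp' : p'.2 ∈ unitSquare) (hp'' : p''.2 ∈ unitSquare) :
    p' = p'' ∧ m = m' := by
  obtain ⟨⟨z, hz⟩, hx⟩ := h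
  obtain ⟨⟨z', hz'⟩, hx'⟩ := h'
  have key : ∀ {m : Fin 5 → ℤ} {p' : RawParam} {z : Plane},
      (∀ k, offsets p' k = offsets p k + m k - inner ℝ z (normal k)) →
      TileAt (offsets p) ((rootTile p').moveToOrigin (-∑ k, (m k : ℝ) • normal k)) z := by
    intro m p' z hz
    have hroot : TileAt (offsets p') (rootTile p') 0 := by
      obtain ⟨⟨i, t⟩, a, b⟩ := p'
      refine ⟨⟨0, ?_⟩, ⟨0, ?_⟩, rfl⟩
      · fin_cases i <;> simp [offsets, rootTile]
      · fin_cases i <;> cases t <;> simp [offsets, rootTile, Rhombus.second, step]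
    have := (tileAt_translate hz).1 hroot
    rwa [zero_add] at this
  have hT := key hz
  have hT' := key hz'
  have heq := hT.eq_of_center_eq hT' (by
    rw [center_moveToOrigin, center_moveToOrigin, sub_neg_eq_add, sub_neg_eq_add]
    rw [hx] at hx'
    have := sub_left_injective hx'
    rw [add_comm, this, add_comm])
  have ht : p'.1 = p''.1 := by
    simp only [Rhombus.moveToOrigin, Rhombus.mk.injEq, rootTile] at heq
    exact Prod.ext heq.2.1 heq.2.2
  rw [← heq] at hT'
  obtain rfl := hT.point_unique hT'
  obtain ⟨t, a, b⟩ := p'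
  obtain ⟨t', a', b'⟩ := p''
  obtain rfl : t = t' := ht
  have hint : ∀ k, offsets (t, (a, b)) k - offsets (t, (a', b')) k = ((m k - m' k : ℤ) : ℝ) := by
    intro k
    rw [hz, hz']
    push_cast
    ring
  have hIco : ∀ {u v : ℝ} {n : ℤ}, u ∈ Set.Ico (0 : ℝ) 1 → v ∈ Set.Ico (0 : ℝ) 1 → u - v = n →
      u = v := by
    intro u v n hu hv hn
    have h1 : (-1 : ℝ) < n := by linarith [hu.1, hv.2]
    have h2 : (n : ℝ) < 1 := by linarith [hu.2, hv.1]
    have h1' : -1 < n := by exact_mod_cast h1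
    have h2' : n < 1 := by exact_mod_cast h2
    obtain rfl : n = 0 := by omega
    simpa [sub_eq_zero] using hn
  have h3 := hint (t.1 + 3)
  have h4 := hint (t.1 + 4)
  simp only [offsets, if_true, add_right_inj, show (4 : Fin 5) ≠ 3 by decide, if_false] at h3 h4
  obtain rfl := hIco hp'.1 hp''.1 h3
  obtain rfl := hIco hp'.2 hp''.2 h4
  refine ⟨rfl, funext fun k => ?_⟩
  have := hint k
  rw [sub_self] at this
  have : m k - m' k = 0 := by exact_mod_cast this.symm
  omega

/-! ### The internal space -/

/-- The projection to the internal space. -/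
def star (c : Fin 5 → ℝ) : ℝ × ℝ := (∑ k, c k * normal (2 * k) 0, ∑ k, c k * normal (2 * k) 1)

theorem star_add (c d : Fin 5 → ℝ) : star (fun k => c k + d k) = star c + star d := by
  simp [star, add_mul, Finset.sum_add_distrib]

theorem star_sub (c d : Fin 5 → ℝ) : star (fun k => c k - d k) = star c - star d := by
  simp [star, sub_mul, Finset.sum_sub_distrib]

theorem star_eq_zero_iff {c : Fin 5 → ℝ} : star c = 0 ↔ ∑ k, c k • normal (2 * k) = 0 := by
  constructor
  · intro h
    rw [Prod.ext_iff] at h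
    refine plane_ext ?_ ?_
    · simpa [star] using h.1
    · simpa [star] using h.2
  · intro h
    refine Prod.ext ?_ ?_
    · simpa [star] using congrArg (fun v : Plane => v 0) h
    · simpa [star] using congrArg (fun v : Plane => v 1) h

/-- A five-term sequence splits into frequencies zero, one and two. Translations supply exactly the
frequency-one part, so the total and the internal coordinate are the only invariants. -/
theorem exists_inner_iff {c : Fin 5 → ℝ} :
    (∃ z : Plane, ∀ k, c k = inner ℝ z (normal k)) ↔ ∑ k, c k = 0 ∧ star c = 0 := by
  constructor
  · rintro ⟨z, hz⟩
    simp only [star_eq_zero_iff, hz, frame_star, and_true]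
    rw [← inner_sum, sum_normal, inner_zero_right]
  · rintro ⟨h1, h2⟩
    refine ⟨(2 / 5 : ℝ) • ∑ l, c l • normal l, fun k => ?_⟩
    have := fourier_inversion c k
    rw [star_eq_zero_iff] at h2
    rw [h1, h2, inner_zero_left] at this
    rw [this, real_inner_smul_left]
    ring

/-- The linear part of the map from the parameters of a torus to the internal space. -/
def torusMap (t : Fin 5 × Bool) : ℝ × ℝ →ₗ[ℝ] ℝ × ℝ :=
  Matrix.toLin (Module.Basis.finTwoProd ℝ) (Module.Basis.finTwoProd ℝ)
    !![normal (2 * (t.1 + 3)) 0 - normal (2 * lastIndex t) 0,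
        normal (2 * (t.1 + 4)) 0 - normal (2 * lastIndex t) 0;
      normal (2 * (t.1 + 3)) 1 - normal (2 * lastIndex t) 1,
        normal (2 * (t.1 + 4)) 1 - normal (2 * lastIndex t) 1]

theorem star_offsets (t : Fin 5 × Bool) (q : ℝ × ℝ) :
    star (offsets (t, q)) = torusMap t q + star (offsets (t, 0)) := by
  obtain ⟨i, u⟩ := t
  obtain ⟨a, b⟩ := q
  rw [torusMap, Matrix.toLin_finTwoProd_apply]
  refine Prod.ext ?_ ?_
  · simp only [star, Fin.sum_univ_five, Prod.fst_add]
    fin_cases i <;> cases u <;> simp [offsets, step, lastIndex] <;> ring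
  · simp only [star, Fin.sum_univ_five, Prod.snd_add]
    fin_cases i <;> cases u <;> simp [offsets, step, lastIndex] <;> ring

/-- The Jacobians have the same ratio as the weights of the thick and thin tori, which is what makes
`prob` shift-invariant. -/
theorem abs_det_torusMap (t : Fin 5 × Bool) : |LinearMap.det (torusMap t)| =
    (if t.2 then Real.goldenRatio else 1) * (sinFifth * (2 * Real.goldenRatio - 1)) := by
  have hs := sinFifth_sq
  have hg := Real.goldenRatio_sq
  have hg1 := Real.one_lt_goldenRatio
  have hpos := sinFifth_pos
  have key : LinearMap.det (torusMap t) =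
      (if t.2 then Real.goldenRatio else -1) * (sinFifth * (2 * Real.goldenRatio - 1)) := by
    obtain ⟨i, u⟩ := t
    rw [torusMap, LinearMap.det_toLin, Matrix.det_fin_two_of]
    fin_cases i <;> cases u <;>
      simp [step, lastIndex, normal_zero_coord, normal_one_coord] <;> grind
  have h1 : 0 < sinFifth * (2 * Real.goldenRatio - 1) := mul_pos hpos (by linarith)
  rw [key, abs_mul, abs_of_pos h1]
  split_ifs
  · rw [abs_of_pos (by linarith)]
  · norm_num

theorem det_torusMap_ne_zero (t : Fin 5 × Bool) : LinearMap.det (torusMap t) ≠ 0 := by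
  have hg1 := Real.one_lt_goldenRatio
  have hpos := sinFifth_pos
  rw [← abs_pos, abs_det_torusMap]
  have : 0 < 2 * Real.goldenRatio - 1 := by linarith
  split_ifs <;> positivity

/-- The linear part of the map from the parameters of a torus to the internal space, as an
equivalence. -/
def torusEquiv (t : Fin 5 × Bool) : (ℝ × ℝ) ≃L[ℝ] (ℝ × ℝ) :=
  ((torusMap t).equivOfDetNeZero (det_torusMap_ne_zero t)).toContinuousLinearEquiv

theorem torusEquiv_apply (t : Fin 5 × Bool) (q : ℝ × ℝ) : torusEquiv t q = torusMap t q := rfl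

/-- The parameters, on the torus `t'`, of the shifted configuration. -/
def target (t' : Fin 5 × Bool) (m : Fin 5 → ℤ) (p : RawParam) : ℝ × ℝ :=
  (torusEquiv t').symm (star (offsets p) + star (fun k => m k) - star (offsets (t', 0)))

/-- Eliminates the unknown point `z`: for a given type and label difference the new parameters are
an explicit function of the old ones. -/
theorem rel_iff {x : Plane} {m : Fin 5 → ℤ} {p : RawParam} {t' : Fin 5 × Bool} {q' : ℝ × ℝ} :
    Rel x m p (t', q') ↔ (∑ k, m k = 0 ∧ q' = target t' m p) ∧
      x = ∑ k, (m k : ℝ) • normal k + (rootTile (t', q')).center - (rootTile p).center := by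
  refine and_congr_left fun _ => ?_
  have h1 : (∃ z : Plane, ∀ k, offsets (t', q') k = offsets p k + m k - inner ℝ z (normal k)) ↔
      ∃ z : Plane, ∀ k, offsets p k + m k - offsets (t', q') k = inner ℝ z (normal k) := by
    refine exists_congr fun z => forall_congr' fun k => ?_
    constructor <;> intro h <;> linarith
  rw [h1, exists_inner_iff (c := fun k => offsets p k + m k - offsets (t', q') k), star_sub,
    star_add, star_offsets t' q', target, ContinuousLinearEquiv.eq_symm_apply, torusEquiv_apply,
    Finset.sum_sub_distrib, Finset.sum_add_distrib, sum_offsets, sum_offsets]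
  refine and_congr ?_ ?_
  · rw [add_sub_cancel_left]
    exact_mod_cast Iff.rfl
  · rw [sub_eq_zero, eq_comm, ← eq_sub_iff_add_eq]

theorem Rel.torusMap_eq {x : Plane} {m : Fin 5 → ℤ} {t t' : Fin 5 × Bool} {q q' : ℝ × ℝ}
    (h : Rel x m (t, q) (t', q')) : torusMap t' q' = torusMap t q +
      (star (offsets (t, 0)) + star (fun k => m k) - star (offsets (t', 0))) := by
  have := (rel_iff.1 h).1.2
  rw [target, ContinuousLinearEquiv.eq_symm_apply, torusEquiv_apply, star_offsets] at this
  rw [this]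
  abel

/-! ### Measurability in the parameters -/

theorem measurable_offsets (k : Fin 5) : Measurable fun p : RawParam => offsets p k := by
  have h : (fun p : RawParam => offsets p k) = fun p =>
      coef₁ p.1 k * p.2.1 + coef₂ p.1 k * p.2.2 + offsets (p.1, (0, 0)) k := by
    ext p
    exact offsets_eq p.1 p.2 k
  rw [h]
  have hd : ∀ f : Fin 5 × Bool → ℝ, Measurable fun p : RawParam => f p.1 := fun f =>
    (measurable_of_countable f).comp measurable_fst
  exact (((hd fun t => coef₁ t k).mul (by fun_prop)).add ((hd fun t => coef₂ t k).mul
    (by fun_prop))).add (hd fun t => offsets (t, (0, 0)) k)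

theorem measurable_center_rootTile : Measurable fun p : RawParam => (rootTile p).center := by
  have hd : Measurable fun p : RawParam =>
      (1 / 2 : ℝ) • (normal p.1.1 + normal (p.1.1 + step p.1.2)) :=
    (measurable_of_countable fun t : Fin 5 × Bool =>
      (1 / 2 : ℝ) • (normal t.1 + normal (t.1 + step t.2))).comp measurable_fst
  have hv : ∀ k, Measurable fun p : RawParam =>
      ((⌈inner ℝ (0 : Plane) (normal k) - offsets p k⌉ : ℤ) : ℝ) • normal k := by
    intro k
    have h1 : Measurable fun p : RawParam => (⌈inner ℝ (0 : Plane) (normal k) - offsets p k⌉ : ℤ) :=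
      Int.measurable_ceil.comp (measurable_const.sub (measurable_offsets k))
    exact ((measurable_of_countable fun n : ℤ => (n : ℝ)).comp h1).smul_const (normal k)
  exact (Finset.measurable_fun_sum Finset.univ fun k _ => hv k).add hd

theorem measurable_target (t' : Fin 5 × Bool) (m : Fin 5 → ℤ) : Measurable (target t' m) := by
  refine (torusEquiv t').symm.continuous.measurable.comp ?_
  refine (Measurable.add_const ?_ _).sub_const _
  exact (Finset.measurable_sum _ fun k _ => (measurable_offsets k).mul_const _).prodMk
    (Finset.measurable_sum _ fun k _ => (measurable_offsets k).mul_const _)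

theorem measurableSet_unitSquare : MeasurableSet unitSquare := measurableSet_Ico.prod measurableSet_Ico

theorem measurableSet_rel (x : Plane) (m : Fin 5 → ℤ) (t' : Fin 5 × Bool) {M : Set RawParam}
    (hM : MeasurableSet M) :
    MeasurableSet {p | ∃ q' ∈ unitSquare, Rel x m p (t', q') ∧ (t', q') ∈ M} := by
  have h : {p | ∃ q' ∈ unitSquare, Rel x m p (t', q') ∧ (t', q') ∈ M} =
      {p | ∑ k, m k = 0 ∧ target t' m p ∈ unitSquare ∧
        x = ∑ k, (m k : ℝ) • normal k + (rootTile (t', target t' m p)).center -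
          (rootTile p).center ∧ (t', target t' m p) ∈ M} := by
    ext p
    constructor
    · rintro ⟨q', hq', hr, hq⟩
      obtain ⟨⟨h0, rfl⟩, hx⟩ := rel_iff.1 hr
      exact ⟨h0, hq', hx, hq⟩
    · rintro ⟨h0, hq', hx, hq⟩
      exact ⟨_, hq', rel_iff.2 ⟨⟨h0, rfl⟩, hx⟩, hq⟩
  rw [h]
  have hp : Measurable fun p => (t', target t' m p) :=
    measurable_const.prodMk (measurable_target t' m)
  refine (MeasurableSet.const _).inter ((measurable_target t' m measurableSet_unitSquare).inter
    (MeasurableSet.inter ?_ (hp hM)))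
  exact measurableSet_eq_fun measurable_const (((measurable_center_rootTile.comp hp).const_add
    _).sub measurable_center_rootTile)

/-! ### Events, their probability, and its relation to area in the internal plane -/

theorem measurable_configOf : Measurable configOf := fun _ h => h

theorem exists_preimage_configOf {B : Set Config} (hB : MeasurableSet B) :
    ∃ M : Set RawParam, MeasurableSet M ∧ ∀ p hp, configOf ⟨p, hp⟩ ∈ B ↔ p ∈ M := by
  obtain ⟨M, hM, h⟩ := measurable_configOf hB
  exact ⟨M, hM, fun p hp => (Set.ext_iff.1 h ⟨p, hp⟩).symm⟩

theorem measurableSet_config {B : Set Config} {M : Set RawParam} (hM : MeasurableSet M)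
    (h : ∀ p hp, configOf ⟨p, hp⟩ ∈ B ↔ p ∈ M) : MeasurableSet B := by
  change MeasurableSet (configOf ⁻¹' B)
  have : configOf ⁻¹' B = Subtype.val ⁻¹' M := Set.ext fun p => h p.1 p.2
  rw [this]
  exact measurable_subtype_coe hM

theorem prob_eq_rawMeasure {B : Set Config} {M : Set RawParam} (hM : MeasurableSet M)
    (h : ∀ p hp, configOf ⟨p, hp⟩ ∈ B ↔ p ∈ M) : prob B = rawMeasure M := by
  have hnull : NullMeasurableSet {p | Regular (offsets p)} rawMeasure :=
    (NullMeasurableSet.of_null (show rawMeasure {p | Regular (offsets p)}ᶜ = 0 from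
      rawMeasure_singular)).of_compl
  have hpre : configOf ⁻¹' B = Subtype.val ⁻¹' M := Set.ext fun p => h p.1 p.2
  rw [prob, Measure.map_apply measurable_configOf (measurableSet_config hM h), hpre,
    Measure.comap_apply₀ _ _ Subtype.val_injective
      (fun s hs => Measure.MeasurableSet.nullMeasurableSet_subtype_coe hnull hs)
      (measurable_subtype_coe hM).nullMeasurableSet, Subtype.image_preimage_coe]
  refine measure_congr ?_
  have : {p | Regular (offsets p)} =ᵐ[rawMeasure] Set.univ :=
    eventuallyEq_univ.2 (measure_eq_zero_iff_ae_notMem.1 rawMeasure_singular |>.mono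
      fun p hp => not_not.1 hp)
  simpa using this.inter (ae_eq_refl M)

theorem rawMeasure_apply {M : Set RawParam} (hM : MeasurableSet M) :
    rawMeasure M = ∑ t : Fin 5 × Bool, weight t.2 * volume {q | q ∈ unitSquare ∧ (t, q) ∈ M} := by
  rw [rawMeasure, Measure.prod_apply hM, lintegral_finsetSum_measure]
  refine Finset.sum_congr rfl fun t _ => ?_
  rw [lintegral_smul_measure, lintegral_dirac, smul_eq_mul,
    Measure.restrict_apply (measurable_prodMk_left hM), Set.inter_comm]
  rfl

/-- The weight cancels against the Jacobian, so the constant on the right does not depend on the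
torus. -/
theorem weight_mul_volume (t : Fin 5 × Bool) (C : Set (ℝ × ℝ)) :
    weight t.2 * volume C = ENNReal.ofReal (1 / ((5 * Real.goldenRatio + 5) *
      (sinFifth * (2 * Real.goldenRatio - 1)))) * volume (torusMap t '' C) := by
  have hg1 := Real.one_lt_goldenRatio
  have hpos := sinFifth_pos
  have h1 : 0 < 2 * Real.goldenRatio - 1 := by linarith
  rw [Measure.addHaar_image_linearMap, abs_det_torusMap, ← mul_assoc,
    ← ENNReal.ofReal_mul (by positivity), weight]
  congr 2
  field_simp

theorem weight_mul_volume_eq {t t' : Fin 5 × Bool} {C C' : Set (ℝ × ℝ)} {w : ℝ × ℝ}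
    (h : torusMap t' '' C' = (fun u => u + w) '' (torusMap t '' C)) :
    weight t.2 * volume C = weight t'.2 * volume C' := by
  rw [weight_mul_volume t, weight_mul_volume t', h, Set.image_add_right,
    measure_preimage_add_right]

/-! ### Shift invariance of the measure -/

/-- The parameters whose configuration has a center at `x`, with the configuration shifted to `x`
having its parameters in `M`. -/
def shiftSet (x : Plane) (M : Set RawParam) : Set RawParam :=
  ⋃ (s : (Fin 5 × Bool) × (Fin 5 → ℤ)),
    {p | ∃ q' ∈ unitSquare, Rel x s.2 p (s.1, q') ∧ (s.1, q') ∈ M}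

theorem measurableSet_shiftSet (x : Plane) {M : Set RawParam} (hM : MeasurableSet M) :
    MeasurableSet (shiftSet x M) :=
  MeasurableSet.iUnion fun _ => measurableSet_rel x _ _ hM

theorem mem_shiftSet {x : Plane} {B : Set Config} {M : Set RawParam}
    (h : ∀ p hp, configOf ⟨p, hp⟩ ∈ B ↔ p ∈ M) {p : RawParam} (hp : Regular (offsets p)) :
    (x ∈ centers (configOf ⟨p, hp⟩) ∧ shift x (configOf ⟨p, hp⟩) ∈ B) ↔ p ∈ shiftSet x M := by
  simp only [shiftSet, Set.mem_iUnion, Set.mem_ofPred_eq]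
  constructor
  · rintro ⟨hx, hB⟩
    obtain ⟨t', m, q', hq', hr⟩ := exists_rel hp hx
    obtain ⟨hp', -, hs⟩ := hr.exists_shift_eq hp
    rw [hs, h] at hB
    exact ⟨(t', m), q', hq', hr, hB⟩
  · rintro ⟨⟨t', m⟩, q', hq', hr, hM⟩
    obtain ⟨hp', hx, hs⟩ := hr.exists_shift_eq hp
    exact ⟨hx, by rw [hs, h]; exact hM⟩

theorem measurableSet_centers (x : Plane) : MeasurableSet {ω | x ∈ centers ω} := by
  refine measurableSet_config (measurableSet_shiftSet x MeasurableSet.univ) fun p hp => ?_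
  rw [← mem_shiftSet (B := Set.univ) (by simp) hp]
  simp

theorem measurable_shift (x : Plane) : Measurable (shift x) := by
  intro B hB
  obtain ⟨M, hM, h⟩ := exists_preimage_configOf hB
  have h1 : MeasurableSet {ω | x ∈ centers ω ∧ shift x ω ∈ B} :=
    measurableSet_config (measurableSet_shiftSet x hM) fun p hp => mem_shiftSet h hp
  have h2 : shift x ⁻¹' B = {ω | x ∈ centers ω ∧ shift x ω ∈ B} ∪ ({ω | x ∈ centers ω}ᶜ ∩ B) := by
    ext ω
    by_cases hx : x ∈ centers ω
    · simp [hx]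
    · simp [hx, shift]
  rw [h2]
  exact h1.union ((measurableSet_centers x).compl.inter hB)

/-- Invariance of the measure under the partial shift by `x`. -/
theorem prob_shift (x : Plane) {B : Set Config} (hB : MeasurableSet B) :
    prob {ω | x ∈ centers ω ∧ shift x ω ∈ B} = prob {ω | -x ∈ centers ω ∧ ω ∈ B} := by
  obtain ⟨M, hM, h⟩ := exists_preimage_configOf hB
  have hM' := (measurableSet_shiftSet (-x) MeasurableSet.univ).inter hM
  have h' : ∀ p hp, configOf ⟨p, hp⟩ ∈ {ω | -x ∈ centers ω ∧ ω ∈ B} ↔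
      p ∈ shiftSet (-x) Set.univ ∩ M := by
    intro p hp
    rw [Set.mem_inter_iff, ← mem_shiftSet (B := Set.univ) (by simp) hp, ← h p hp]
    simp
  rw [prob_eq_rawMeasure (measurableSet_shiftSet x hM) (fun p hp => mem_shiftSet h hp),
    prob_eq_rawMeasure hM' h', rawMeasure_apply (measurableSet_shiftSet x hM),
    rawMeasure_apply hM']
  -- Both events are cut up by the two tile types and the label difference. The shift maps each `C t
  -- t' m` onto `C' t t' m` by a translation of the internal plane.
  let C : Fin 5 × Bool → Fin 5 × Bool → (Fin 5 → ℤ) → Set (ℝ × ℝ) := fun t t' m =>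
    {q | q ∈ unitSquare ∧ ∃ q' ∈ unitSquare, Rel x m (t, q) (t', q') ∧ (t', q') ∈ M}
  let C' : Fin 5 × Bool → Fin 5 × Bool → (Fin 5 → ℤ) → Set (ℝ × ℝ) := fun t t' m =>
    {q' | q' ∈ unitSquare ∧ (∃ q ∈ unitSquare, Rel x m (t, q) (t', q')) ∧ (t', q') ∈ M}
  have hC : ∀ t t' m, MeasurableSet (C t t' m) := fun t t' m =>
    measurableSet_unitSquare.inter (measurable_prodMk_left (measurableSet_rel x m t' hM))
  have hC' : ∀ t t' m, MeasurableSet (C' t t' m) := by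
    intro t t' m
    have := measurable_prodMk_left (x := t') (measurableSet_rel (-x) (-m) t MeasurableSet.univ)
    simp only [rel_neg_iff, Set.mem_univ, and_true] at this
    exact measurableSet_unitSquare.inter (this.inter (measurable_prodMk_left hM))
  have hCC' : ∀ t t' m, weight t.2 * volume (C t t' m) = weight t'.2 * volume (C' t t' m) := by
    intro t t' m
    refine weight_mul_volume_eq
      (w := star (offsets (t, 0)) + star (fun k => m k) - star (offsets (t', 0))) ?_
    ext u
    constructor
    · rintro ⟨q', ⟨hq', ⟨q, hq, hr⟩, hqM⟩, rfl⟩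
      exact ⟨_, ⟨q, ⟨hq, q', hq', hr, hqM⟩, rfl⟩, hr.torusMap_eq.symm⟩
    · rintro ⟨_, ⟨q, ⟨hq, q', hq', hr, hqM⟩, rfl⟩, rfl⟩
      exact ⟨q', ⟨hq', ⟨q, hq, hr⟩, hqM⟩, hr.torusMap_eq⟩
  have e : ∀ t, volume {q | q ∈ unitSquare ∧ (t, q) ∈ shiftSet x M} =
      ∑ t', ∑' m, volume (C t t' m) := by
    intro t
    have : {q | q ∈ unitSquare ∧ (t, q) ∈ shiftSet x M} =
        ⋃ s : (Fin 5 × Bool) × (Fin 5 → ℤ), C t s.1 s.2 := by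
      ext q
      simp only [shiftSet, Set.mem_iUnion, Set.mem_ofPred_eq, C, exists_and_left]
    rw [this, measure_iUnion ?_ fun s : (Fin 5 × Bool) × (Fin 5 → ℤ) => hC t s.1 s.2,
      ENNReal.tsum_prod', tsum_fintype]
    -- The pieces are disjoint because the new parameters and the label difference are unique.
    intro s s' hss'
    refine Set.disjoint_left.2 ?_
    rintro q ⟨-, q', hq', hr, -⟩ ⟨-, q'', hq'', hr', -⟩
    obtain ⟨h1, h2⟩ := hr.unique hr' hq' hq''
    exact hss' (Prod.ext ((Prod.mk.inj h1).1) h2)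
  have e' : ∀ t', volume {q | q ∈ unitSquare ∧ (t', q) ∈ shiftSet (-x) Set.univ ∩ M} =
      ∑ t, ∑' m, volume (C' t t' m) := by
    intro t'
    have : {q | q ∈ unitSquare ∧ (t', q) ∈ shiftSet (-x) Set.univ ∩ M} =
        ⋃ s : (Fin 5 × Bool) × (Fin 5 → ℤ), C' s.1 t' s.2 := by
      ext q
      simp only [shiftSet, Set.mem_inter_iff, Set.mem_iUnion, Set.mem_ofPred_eq, C',
        Set.mem_univ, and_true]
      constructor
      · rintro ⟨hq, ⟨⟨t, m⟩, q', hq', hr⟩, hqM⟩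
        exact ⟨(t, -m), hq, ⟨q', hq', by simpa using hr.symm⟩, hqM⟩
      · rintro ⟨⟨t, m⟩, hq, ⟨q', hq', hr⟩, hqM⟩
        exact ⟨hq, ⟨(t, -m), q', hq', hr.symm⟩, hqM⟩
    rw [this, measure_iUnion ?_ fun s : (Fin 5 × Bool) × (Fin 5 → ℤ) => hC' s.1 t' s.2,
      ENNReal.tsum_prod', tsum_fintype]
    intro s s' hss'
    refine Set.disjoint_left.2 ?_
    rintro q ⟨-, ⟨q', hq', hr⟩, -⟩ ⟨-, ⟨q'', hq'', hr'⟩, -⟩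
    obtain ⟨h1, h2⟩ := hr.symm.unique hr'.symm hq' hq''
    exact hss' (Prod.ext ((Prod.mk.inj h1).1) (neg_injective h2))
  simp only [e, e', Finset.mul_sum, ← ENNReal.tsum_mul_left, hCC']
  rw [Finset.sum_comm]

/-! ### Measurability of the neighbor relation -/

/-- The tile of type `t` with center `c`. -/
def tileOf (t : Fin 5 × Bool) (c : Plane) : Rhombus where
  corner := c - (1 / 2 : ℝ) • (normal t.1 + normal (t.1 + step t.2))
  first := t.1
  thick := t.2

theorem center_tileOf (t : Fin 5 × Bool) (c : Plane) : (tileOf t c).center = c := by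
  simp [tileOf, Rhombus.center, Rhombus.second]

theorem tileOf_mem {p : RawParam} (hp : Regular (offsets p)) :
    tileOf p.1 0 ∈ (configOf ⟨p, hp⟩).tiles := by
  refine ⟨rootTile p, rootTile_mem p, Rhombus.ext ?_ rfl rfl⟩
  simp [Rhombus.moveToOrigin, Rhombus.center, rootTile, tileOf, Rhombus.second]

/-- A tile is fixed by its center and type, so adjacency to the root is a condition on two discrete
types, while the presence of the tile is expressed by `Rel`. -/
theorem mem_nbrs_configOf {e : Plane} {p : RawParam} (hp : Regular (offsets p)) :
    e ∈ nbrs (configOf ⟨p, hp⟩) ↔ ∃ t' m, (tileOf p.1 0).Neighbor (tileOf t' e) ∧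
      ∃ q' ∈ unitSquare, Rel e m p (t', q') := by
  set ω := configOf ⟨p, hp⟩
  have key : ∀ {t' m q'}, Rel e m p (t', q') → tileOf t' e ∈ ω.tiles := by
    intro t' m q' hr
    obtain ⟨hp', hx, hs⟩ := hr.exists_shift_eq hp
    have h1 := tileOf_mem hp'
    rw [← hs, shift_tiles hx] at h1
    obtain ⟨R, hR, hR'⟩ := h1
    have : R = tileOf t' e := moveToOrigin_injective e (by
      rw [hR']
      simp [tileOf, Rhombus.moveToOrigin])
    exact this ▸ hR
  constructor
  · rintro ⟨R, hR, R', hR', h0, he, hn⟩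
    obtain ⟨t', m, q', hq', hr⟩ := exists_rel (x := e) hp ⟨R', hR', he⟩
    rw [ω.isPenrose.eq_of_center_eq hR (tileOf_mem hp) (h0.trans (center_tileOf _ _).symm),
      ω.isPenrose.eq_of_center_eq hR' (key hr) (he.trans (center_tileOf _ _).symm)] at hn
    exact ⟨t', m, hn, q', hq', hr⟩
  · rintro ⟨t', m, hn, q', hq', hr⟩
    exact ⟨_, tileOf_mem hp, _, key hr, center_tileOf _ _, center_tileOf _ _, hn⟩

theorem measurableSet_nbrs (e : Plane) : MeasurableSet {ω | e ∈ nbrs ω} := by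
  refine measurableSet_config (M := {p | ∃ t' m, (tileOf p.1 0).Neighbor (tileOf t' e) ∧
      ∃ q' ∈ unitSquare, Rel e m p (t', q')}) ?_ fun p hp => mem_nbrs_configOf hp
  have : {p : RawParam | ∃ t' m, (tileOf p.1 0).Neighbor (tileOf t' e) ∧
      ∃ q' ∈ unitSquare, Rel e m p (t', q')} = ⋃ (t' : Fin 5 × Bool) (m : Fin 5 → ℤ),
        (Prod.fst ⁻¹' {t | (tileOf t 0).Neighbor (tileOf t' e)}) ∩
          {p | ∃ q' ∈ unitSquare, Rel e m p (t', q') ∧ (t', q') ∈ Set.univ} := by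
    ext p
    simp
  rw [this]
  exact MeasurableSet.iUnion fun t' => MeasurableSet.iUnion fun m =>
    (measurable_fst (Set.to_countable _).measurableSet).inter
      (measurableSet_rel e m t' MeasurableSet.univ)

/-! ### Reversibility -/

theorem map_shift_centers (x : Plane) : (prob.restrict {ω | x ∈ centers ω}).map (shift x) =
    prob.restrict {ω | -x ∈ centers ω} := by
  ext B hB
  rw [Measure.map_apply (measurable_shift x) hB, Measure.restrict_apply (measurable_shift x hB),
    Measure.restrict_apply hB, Set.inter_comm, Set.inter_comm B]
  exact prob_shift x hB

theorem map_shift_nbrs (e : Plane) : (prob.restrict {ω | e ∈ nbrs ω}).map (shift e) =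
    prob.restrict {ω | -e ∈ nbrs ω} := by
  ext B hB
  rw [Measure.map_apply (measurable_shift e) hB, Measure.restrict_apply (measurable_shift e hB),
    Measure.restrict_apply hB]
  have h := prob_shift e (hB.inter (measurableSet_nbrs (-e)))
  convert h using 2
  · ext ω
    simp only [Set.mem_inter_iff, Set.mem_preimage, Set.mem_ofPred_eq]
    rw [mem_nbrs_iff_neg_mem]
    tauto
  · ext ω
    simp only [Set.mem_inter_iff, Set.mem_ofPred_eq]
    have := @nbrs_subset_centers ω (-e)
    tauto

/-! ### The resolvent equation in a Hilbert space -/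

section Hilbert

variable {H K : Type*} [NormedAddCommGroup H] [InnerProductSpace ℝ H]
  [NormedAddCommGroup K] [InnerProductSpace ℝ K]
  {Q : H →L[ℝ] H} {B : H →L[ℝ] K} {V : H} {g : K} {c : ℝ}

/-- Lax–Milgram: `1 - Q` has a nonnegative quadratic form, so `1 + ε - Q` is coercive with constant
`ε`. -/
theorem existsUnique_resolvent [CompleteSpace H] (hc : 0 < c)
    (hQ : ∀ φ φ' : H, inner ℝ (φ - Q φ) φ' = c * inner ℝ (B φ) (B φ')) {ε : ℝ} (hε : 0 < ε) (V : H) :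
    ∃! ψ : H, (1 + ε) • ψ - Q ψ = V := by
  let A : H →L[ℝ] H := (1 + ε) • ContinuousLinearMap.id ℝ H - Q
  have hA : ∀ φ, A φ = (1 + ε) • φ - Q φ := fun φ => rfl
  let F : H →L[ℝ] H →L[ℝ] ℝ := LinearMap.mkContinuous₂
    (LinearMap.mk₂ ℝ (fun u v => inner ℝ (A u) v) (fun u u' v => by rw [map_add, inner_add_left])
      (fun a u v => by rw [map_smul, real_inner_smul_left, smul_eq_mul])
      (fun u v v' => inner_add_right _ _ _)
      (fun a u v => by rw [real_inner_smul_right, smul_eq_mul])) ‖A‖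
    (fun u v => (norm_inner_le_norm _ _).trans
      (mul_le_mul_of_nonneg_right (A.le_opNorm u) (norm_nonneg v)))
  have hF : ∀ u v, F u v = inner ℝ (A u) v := fun u v => rfl
  have hco : IsCoercive F := by
    refine ⟨ε, hε, fun u => ?_⟩
    have h1 : A u = ε • u + (u - Q u) := by rw [hA]; module
    have h2 : 0 ≤ c * inner ℝ (B u) (B u) := mul_nonneg hc.le real_inner_self_nonneg
    rw [hF, h1, inner_add_left, hQ, real_inner_smul_left, real_inner_self_eq_norm_mul_norm]
    linarith
  let e := hco.continuousLinearEquivOfBilin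
  have he : ∀ u, e u = A u := fun u => ext_inner_right ℝ fun v => by
    rw [hco.continuousLinearEquivOfBilin_apply, hF]
  refine ⟨e.symm V, ?_, fun ψ hψ => ?_⟩
  · simp only
    rw [← hA, ← he, e.apply_symm_apply]
  · rw [← e.symm_apply_apply ψ, he, hA, hψ]

/-- The resolvent equation is a Tikhonov regularization of the least-squares problem of
approximating `g` by the range of `B`, so `B ψ` converges to the projection of `g` even though `ψ`
itself may diverge. -/
theorem exists_tendsto_resolvent [CompleteSpace K] (hc : 0 < c)
    (hQ : ∀ φ φ' : H, inner ℝ (φ - Q φ) φ' = c * inner ℝ (B φ) (B φ'))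
    (hV : ∀ φ : H, inner ℝ V φ = c * inner ℝ g (B φ)) :
    ∃ p : K, ∀ ψ : ℝ → H, (∀ ε : ℝ, 0 < ε → (1 + ε) • ψ ε - Q (ψ ε) = V) →
      Tendsto (fun ε => B (ψ ε)) (𝓝[>] 0) (𝓝 p) ∧ Tendsto (fun ε => ε • ψ ε) (𝓝[>] 0) (𝓝 0) := by
  let S : Submodule ℝ K := (LinearMap.range B.toLinearMap).topologicalClosure
  have : CompleteSpace S := (Submodule.isClosed_topologicalClosure _).completeSpace_coe
  set p : K := S.starProjection g with hp_def
  have hpS : p ∈ S := Submodule.starProjection_apply_mem S g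
  have horth : ∀ φ, inner ℝ (g - p) (B φ) = 0 := fun φ =>
    (Submodule.mem_orthogonal' S _).1 (Submodule.sub_starProjection_mem_orthogonal g) _
      (Submodule.le_topologicalClosure _ ⟨φ, rfl⟩)
  have hdense : ∀ η : ℝ, 0 < η → ∃ φ, ‖p - B φ‖ < η := by
    intro η hη
    have hp : p ∈ closure (Set.range B) := hpS
    obtain ⟨_, ⟨φ, rfl⟩, h⟩ := Metric.mem_closure_iff.1 hp η hη
    exact ⟨φ, by rwa [dist_eq_norm] at h⟩
  refine ⟨p, fun ψ hψ => ?_⟩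
  have weak : ∀ ε, 0 < ε → ∀ φ, ε * inner ℝ (ψ ε) φ = c * inner ℝ (p - B (ψ ε)) (B φ) := by
    intro ε hε φ
    have h1 : ε • ψ ε = V - (ψ ε - Q (ψ ε)) := by rw [← hψ ε hε]; module
    have h2 := horth φ
    rw [inner_sub_left] at h2
    rw [← real_inner_smul_left, h1, inner_sub_left, hV, hQ, inner_sub_left]
    linear_combination c * h2
  -- The weak equation is tested with `φ - ψ ε`, using that `⟨ψ, φ - ψ⟩` is at most `‖φ‖² / 4`. The
  -- bound is useful because `B φ` can be chosen close to `p` before `ε` tends to 0.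
  have bound : ∀ ε, 0 < ε → ∀ φ, ‖p - B (ψ ε)‖ ^ 2 ≤ ‖p - B φ‖ ^ 2 + ε * (‖φ‖ ^ 2 / (2 * c)) := by
    intro ε hε φ
    have h1 := weak ε hε (φ - ψ ε)
    rw [map_sub, inner_sub_right, real_inner_self_eq_norm_sq] at h1
    have h2 := real_inner_le_norm (ψ ε) φ
    have h3 := real_inner_le_norm (p - B (ψ ε)) (p - B φ)
    have h4 : ‖p - B (ψ ε)‖ ^ 2 = inner ℝ (p - B (ψ ε)) (p - B φ) +
        inner ℝ (p - B (ψ ε)) (B φ - B (ψ ε)) := by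
      rw [← inner_add_right, sub_add_sub_cancel, real_inner_self_eq_norm_sq]
    have h5 : c * inner ℝ (p - B (ψ ε)) (B φ - B (ψ ε)) ≤ ε * (‖φ‖ ^ 2 / 4) := by
      rw [← h1]
      refine mul_le_mul_of_nonneg_left ?_ hε.le
      nlinarith [sq_nonneg (‖ψ ε‖ - ‖φ‖ / 2)]
    have h6 : inner ℝ (p - B (ψ ε)) (B φ - B (ψ ε)) ≤ ε * (‖φ‖ ^ 2 / (4 * c)) := by
      have : ε * (‖φ‖ ^ 2 / (4 * c)) = ε * (‖φ‖ ^ 2 / 4) / c := by field_simp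
      rw [this, le_div_iff₀ hc]
      linarith
    have h7 : ε * (‖φ‖ ^ 2 / (2 * c)) = 2 * (ε * (‖φ‖ ^ 2 / (4 * c))) := by field_simp; ring
    nlinarith [sq_nonneg (‖p - B (ψ ε)‖ - ‖p - B φ‖)]
  have lim : Tendsto (fun ε => ‖p - B (ψ ε)‖) (𝓝[>] 0) (𝓝 0) := by
    rw [Metric.tendsto_nhds]
    intro η hη
    obtain ⟨φ, hφ⟩ := hdense (η / 2) (by positivity)
    have h1 : Tendsto (fun ε : ℝ => ε * (‖φ‖ ^ 2 / (2 * c))) (𝓝[>] 0) (𝓝 0) := by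
      have : Tendsto (fun ε : ℝ => ε * (‖φ‖ ^ 2 / (2 * c))) (𝓝 0) (𝓝 (0 * (‖φ‖ ^ 2 / (2 * c)))) :=
        tendsto_id.mul_const _
      rw [zero_mul] at this
      exact this.mono_left nhdsWithin_le_nhds
    filter_upwards [h1.eventually (gt_mem_nhds (show 0 < η ^ 2 / 2 by positivity)),
      self_mem_nhdsWithin] with ε h2 hε
    have h3 := bound ε hε φ
    rw [dist_zero_right, norm_norm]
    refine lt_of_pow_lt_pow_left₀ 2 hη.le ?_
    nlinarith [norm_nonneg (p - B φ)]
  refine ⟨?_, ?_⟩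
  · rw [tendsto_iff_norm_sub_tendsto_zero]
    simpa only [norm_sub_rev] using lim
  · rw [tendsto_zero_iff_norm_tendsto_zero]
    have h1 : Tendsto (fun ε => c * ‖B‖ * ‖p - B (ψ ε)‖) (𝓝[>] 0) (𝓝 0) := by
      simpa using lim.const_mul (c * ‖B‖)
    refine squeeze_zero' (Eventually.of_forall fun _ => norm_nonneg _) ?_ h1
    filter_upwards [self_mem_nhdsWithin] with ε hε
    -- Testing with `ε • ψ ε` bounds its norm by `c ‖B‖ ‖p - B (ψ ε)‖`.
    have h2 := weak ε hε (ε • ψ ε)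
    rw [← real_inner_smul_left, real_inner_self_eq_norm_mul_norm] at h2
    have h3 := real_inner_le_norm (p - B (ψ ε)) (B (ε • ψ ε))
    have h4 := B.le_opNorm (ε • ψ ε)
    by_contra! hlt
    have h5 : 0 < ‖ε • ψ ε‖ := lt_of_le_of_lt (by positivity) hlt
    have h6 : ‖p - B (ψ ε)‖ * ‖B (ε • ψ ε)‖ ≤ ‖p - B (ψ ε)‖ * (‖B‖ * ‖ε • ψ ε‖) :=
      mul_le_mul_of_nonneg_left h4 (norm_nonneg _)
    have h7 := mul_lt_mul_of_pos_right hlt h5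
    have h8 := mul_le_mul_of_nonneg_left (h3.trans h6) hc.le
    nlinarith

/-- An operator dominated by `B` inherits the Cauchy property; this passes convergence from
gradients to increments. -/
theorem exists_tendsto_of_norm_le {L : Type*} [NormedAddCommGroup L] [NormedSpace ℝ L]
    [CompleteSpace L] {I : H →L[ℝ] L} {C : ℝ} (h : ∀ u, ‖I u‖ ≤ C * ‖B u‖) {f : ℝ → H}
    {l : Filter ℝ} [l.NeBot] {p : K} (hf : Tendsto (fun ε => B (f ε)) l (𝓝 p)) :
    ∃ q : L, Tendsto (fun ε => I (f ε)) l (𝓝 q) := by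
  refine cauchy_map_iff_exists_tendsto.1 (cauchy_map_iff'.2 ?_)
  rw [Metric.uniformity_eq_comap_nhds_zero, tendsto_comap_iff]
  have h1 := (cauchy_map_iff'.1 hf.cauchy_map)
  rw [Metric.uniformity_eq_comap_nhds_zero, tendsto_comap_iff] at h1
  have h2 := h1.const_mul C
  rw [mul_zero] at h2
  refine squeeze_zero (fun _ => dist_nonneg) (fun ε => ?_) h2
  simp only [Function.comp_apply, dist_eq_norm, ← map_sub]
  exact h _

end Hilbert

/-! ### Composition with partial maps in `L²` -/

section Pullback

variable {Ω E : Type*} [MeasurableSpace Ω] {μ : Measure Ω} [NormedAddCommGroup E]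
  {A : Set Ω} {T : Ω → Ω}

/-- The hypothesis on `(μ.restrict A).map T` is all that is needed for a partially defined map to
act on almost-everywhere classes as a contraction of L². -/
theorem memLp_pullback (hA : MeasurableSet A) (hT : Measurable T)
    (h : (μ.restrict A).map T ≤ μ) {f : Ω → E} (hf : MemLp f 2 μ) :
    MemLp (A.indicator (f ∘ T)) 2 μ := by
  rw [memLp_indicator_iff_restrict hA]
  exact (hf.mono_measure h).comp_of_map hT.aemeasurable

theorem eLpNorm_pullback_le (hA : MeasurableSet A) (hT : Measurable T)
    (h : (μ.restrict A).map T ≤ μ) {f : Ω → E} (hf : AEStronglyMeasurable f μ) :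
    eLpNorm (A.indicator (f ∘ T)) 2 μ ≤ eLpNorm f 2 μ := by
  rw [eLpNorm_indicator_eq_eLpNorm_restrict hA,
    ← eLpNorm_map_measure (hf.mono_measure h) hT.aemeasurable]
  exact eLpNorm_mono_measure f h

theorem ae_of_map_restrict_le (hA : MeasurableSet A) (hT : Measurable T)
    (h : (μ.restrict A).map T ≤ μ) {P : Ω → Prop} (hP : ∀ᵐ ω ∂μ, P ω) :
    ∀ᵐ ω ∂μ, ω ∈ A → P (T ω) := by
  rw [← ae_restrict_iff'₀ hA.nullMeasurableSet]
  exact ae_of_ae_map hT.aemeasurable ((Measure.absolutelyContinuous_of_le h).ae_le hP)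

theorem pullback_congr (hA : MeasurableSet A) (hT : Measurable T)
    (h : (μ.restrict A).map T ≤ μ) {f g : Ω → E} (hfg : f =ᵐ[μ] g) :
    A.indicator (f ∘ T) =ᵐ[μ] A.indicator (g ∘ T) := by
  filter_upwards [ae_of_map_restrict_le hA hT h hfg] with ω hω
  by_cases hωA : ω ∈ A
  · simp [hωA, hω hωA]
  · simp [hωA]

variable [NormedSpace ℝ E]

/-- The operator `f ↦ 1_A (f ∘ T)` on `L²`. -/
def pullbackL (hA : MeasurableSet A) (hT : Measurable T) (h : (μ.restrict A).map T ≤ μ) :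
    Lp E 2 μ →L[ℝ] Lp E 2 μ :=
  LinearMap.mkContinuous
    { toFun := fun f => (memLp_pullback hA hT h (Lp.memLp f)).toLp _
      map_add' := fun f g => by
        rw [← MemLp.toLp_add]
        refine MemLp.toLp_congr _ _ ?_
        refine (pullback_congr hA hT h (Lp.coeFn_add f g)).trans (Eventually.of_forall fun ω => ?_)
        by_cases hω : ω ∈ A <;> simp [hω]
      map_smul' := fun a f => by
        rw [RingHom.id_apply, ← MemLp.toLp_const_smul]
        refine MemLp.toLp_congr _ _ ?_
        refine (pullback_congr hA hT h (Lp.coeFn_smul a f)).trans (Eventually.of_forall fun ω => ?_)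
        by_cases hω : ω ∈ A <;> simp [hω] } 1 (fun f => by
      rw [one_mul]
      change ‖(memLp_pullback hA hT h (Lp.memLp f)).toLp _‖ ≤ ‖f‖
      rw [Lp.norm_toLp, Lp.norm_def]
      exact ENNReal.toReal_mono (Lp.eLpNorm_ne_top f)
        (eLpNorm_pullback_le hA hT h (Lp.aestronglyMeasurable f)))

theorem coeFn_pullbackL (hA : MeasurableSet A) (hT : Measurable T) (h : (μ.restrict A).map T ≤ μ)
    (f : Lp E 2 μ) : pullbackL hA hT h f =ᵐ[μ] A.indicator (f ∘ T) :=
  MemLp.coeFn_toLp (memLp_pullback hA hT h (Lp.memLp f))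

theorem coeFn_pullbackL_of_ae (hA : MeasurableSet A) (hT : Measurable T)
    (h : (μ.restrict A).map T ≤ μ) {f : Lp E 2 μ} {F : Ω → E} (hf : f =ᵐ[μ] F) :
    pullbackL hA hT h f =ᵐ[μ] A.indicator (F ∘ T) :=
  (coeFn_pullbackL hA hT h f).trans (pullback_congr hA hT h hf)

end Pullback

/-! ### The operators of the random walk on `L²` -/

/-- The space `L²(ℙ)` of plane-valued functions. -/
abbrev L2 : Type := Lp Plane 2 prob

/-- The finite set of all steps. -/
def steps : Finset Plane := finite_allSteps.toFinset

theorem mem_steps {e : Plane} : e ∈ steps ↔ e ∈ allSteps := finite_allSteps.mem_toFinset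

theorem mem_steps_of_mem_nbrs {e : Plane} {ω : Config} (h : e ∈ nbrs ω) : e ∈ steps :=
  mem_steps.2 (mem_allSteps h)

theorem sum_steps_neg {M : Type*} [AddCommMonoid M] (F : Plane → M) :
    ∑ e ∈ steps, F (-e) = ∑ e ∈ steps, F e := by
  have h : ∀ e ∈ steps, -e ∈ steps := fun e he => mem_steps.2 (neg_mem_allSteps (mem_steps.1 he))
  exact Finset.sum_nbij' (fun e => -e) (fun e => -e) h h (by simp) (by simp) (by simp)

open Classical in
theorem finsum_nbrs {M : Type*} [AddCommMonoid M] (ω : Config) (F : Plane → M) :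
    ∑ᶠ e ∈ nbrs ω, F e = ∑ e ∈ steps, if e ∈ nbrs ω then F e else 0 := by
  rw [finsum_mem_def, finsum_eq_sum_of_support_subset (s := steps)]
  · rfl
  · intro e he
    exact mem_steps_of_mem_nbrs (Set.mem_of_indicator_ne_zero he)

open Classical in
theorem sum_steps_const {M : Type*} [AddCommMonoid M] (ω : Config) (v : M) :
    ∑ e ∈ steps, (if e ∈ nbrs ω then v else 0) = 4 • v := by
  have h : steps.filter (· ∈ nbrs ω) = (finite_nbrs ω).toFinset := by
    ext e
    simp only [Finset.mem_filter, Set.Finite.mem_toFinset, and_iff_right_iff_imp]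
    exact mem_steps_of_mem_nbrs
  rw [← Finset.sum_filter, Finset.sum_const, h, ← Set.ncard_eq_toFinset_card _ (finite_nbrs ω),
    ncard_nbrs]

theorem map_shift_nbrs_le (e : Plane) :
    (prob.restrict {ω | e ∈ nbrs ω}).map (shift e) ≤ prob := by
  rw [map_shift_nbrs]
  exact Measure.restrict_le_self

theorem map_shift_centers_le (x : Plane) :
    (prob.restrict {ω | x ∈ centers ω}).map (shift x) ≤ prob := by
  rw [map_shift_centers]
  exact Measure.restrict_le_self

theorem map_id_restrict_le (A : Set Config) : (prob.restrict A).map id ≤ prob := by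
  rw [Measure.map_id]
  exact Measure.restrict_le_self

/-- The operator `f ↦ 1{e ∈ S_ω} f ∘ τ_e`. -/
def stepOp (e : Plane) : L2 →L[ℝ] L2 :=
  pullbackL (measurableSet_nbrs e) (measurable_shift e) (map_shift_nbrs_le e)

/-- The operator `f ↦ 1{x ∈ H_ω} f ∘ τ_x`. -/
def centerOp (x : Plane) : L2 →L[ℝ] L2 :=
  pullbackL (measurableSet_centers x) (measurable_shift x) (map_shift_centers_le x)

/-- Multiplication with the indicator function of a set. -/
def maskOp {A : Set Config} (hA : MeasurableSet A) : L2 →L[ℝ] L2 :=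
  pullbackL hA measurable_id (map_id_restrict_le A)

theorem coeFn_stepOp {e : Plane} {f : L2} {F : Config → Plane} (hf : f =ᵐ[prob] F) :
    stepOp e f =ᵐ[prob] {ω | e ∈ nbrs ω}.indicator (F ∘ shift e) :=
  coeFn_pullbackL_of_ae _ _ _ hf

theorem coeFn_centerOp {x : Plane} {f : L2} {F : Config → Plane} (hf : f =ᵐ[prob] F) :
    centerOp x f =ᵐ[prob] {ω | x ∈ centers ω}.indicator (F ∘ shift x) :=
  coeFn_pullbackL_of_ae _ _ _ hf

theorem coeFn_maskOp {A : Set Config} (hA : MeasurableSet A) {f : L2} {F : Config → Plane}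
    (hf : f =ᵐ[prob] F) : maskOp hA f =ᵐ[prob] A.indicator F :=
  coeFn_pullbackL_of_ae _ _ _ hf

/-- Multiplication with the indicator function of `{e ∈ S_ω}`. -/
def nbrMask (e : Plane) : L2 →L[ℝ] L2 := maskOp (measurableSet_nbrs e)

theorem stepOp_neg_stepOp (e : Plane) (f : L2) : stepOp (-e) (stepOp e f) = nbrMask (-e) f := by
  refine Lp.ext ?_
  filter_upwards [coeFn_stepOp (e := -e) (coeFn_stepOp (e := e) (ae_eq_refl f)),
    coeFn_maskOp (measurableSet_nbrs (-e)) (ae_eq_refl f)] with ω h1 h2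
  rw [h1, nbrMask, h2]
  by_cases hω : -e ∈ nbrs ω
  · have h3 := neg_mem_nbrs_shift hω
    have h4 := shift_neg_shift (nbrs_subset_centers ω hω)
    rw [neg_neg] at h3 h4
    simp [hω, h3, h4]
  · simp [hω]

theorem nbrMask_stepOp (e : Plane) (f : L2) : nbrMask e (stepOp e f) = stepOp e f := by
  refine Lp.ext ?_
  filter_upwards [coeFn_maskOp (measurableSet_nbrs e) (coeFn_stepOp (e := e) (ae_eq_refl f)),
    coeFn_stepOp (e := e) (ae_eq_refl f)] with ω h1 h2
  rw [nbrMask, h1, h2, Set.indicator_indicator, Set.inter_self]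

theorem nbrMask_nbrMask (e : Plane) (f : L2) : nbrMask e (nbrMask e f) = nbrMask e f := by
  refine Lp.ext ?_
  have h := coeFn_maskOp (measurableSet_nbrs e) (ae_eq_refl f)
  filter_upwards [coeFn_maskOp (measurableSet_nbrs e) h, h] with ω h1 h2
  rw [nbrMask, h1, h2, Set.indicator_indicator, Set.inter_self]

theorem sum_nbrMask (f : L2) : ∑ e ∈ steps, nbrMask e f = (4 : ℝ) • f := by
  classical
  refine Lp.ext ?_
  have h1 : ∀ᵐ ω ∂prob, ∀ e ∈ steps, nbrMask e f ω = {ω | e ∈ nbrs ω}.indicator f ω :=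
    (ae_ball_iff steps.countable_toSet).2 fun e _ => coeFn_maskOp (measurableSet_nbrs e) (ae_eq_refl f)
  filter_upwards [h1, Lp.coeFn_finsetSum steps fun e => nbrMask e f, Lp.coeFn_smul (4 : ℝ) f]
    with ω h1 h2 h3
  rw [h2, h3, Finset.sum_apply, Finset.sum_congr rfl h1, Pi.smul_apply]
  simp only [Set.indicator_apply, Set.mem_ofPred_eq, sum_steps_const]
  rw [← Nat.cast_smul_eq_nsmul ℝ]
  norm_num

theorem inner_nbrMask (e : Plane) (f g : L2) : inner ℝ (nbrMask e f) g = inner ℝ f (nbrMask e g) := by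
  rw [L2.inner_def, L2.inner_def]
  refine integral_congr_ae ?_
  filter_upwards [coeFn_maskOp (measurableSet_nbrs e) (ae_eq_refl f),
    coeFn_maskOp (measurableSet_nbrs e) (ae_eq_refl g)] with ω h1 h2
  rw [nbrMask, h1, h2]
  by_cases hω : e ∈ nbrs ω <;> simp [hω]

/-- The adjoint of a step is the reverse step: change variables by `shift e`, which carries `{e ∈
S_ω}` to `{-e ∈ S_ω}` and preserves the measure. -/
theorem inner_stepOp (e : Plane) (f g : L2) :
    inner ℝ (stepOp e f) g = inner ℝ f (stepOp (-e) g) := by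
  have hm := measurableSet_nbrs
  let F : Config → ℝ := fun ω => inner ℝ (f ω) (stepOp (-e) g ω)
  have h1 : inner ℝ (stepOp e f) g = ∫ ω in {ω | e ∈ nbrs ω}, F (shift e ω) ∂prob := by
    rw [L2.inner_def, ← integral_indicator (hm e)]
    refine integral_congr_ae ?_
    filter_upwards [coeFn_stepOp (e := e) (ae_eq_refl f),
      ae_of_map_restrict_le (hm e) (measurable_shift e) (map_shift_nbrs_le e)
        (coeFn_stepOp (e := -e) (ae_eq_refl g))] with ω h1 h2
    rw [h1]
    by_cases hω : e ∈ nbrs ω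
    · have h3 := neg_mem_nbrs_shift hω
      have h4 := shift_neg_shift (nbrs_subset_centers ω hω)
      simp [hω, F, h2 hω, h3, h4]
    · simp [hω]
  have hF : AEStronglyMeasurable F prob :=
    (Lp.aestronglyMeasurable f).inner (Lp.aestronglyMeasurable _)
  rw [h1, ← integral_map (measurable_shift e).aemeasurable (hF.mono_measure (map_shift_nbrs_le e)),
    map_shift_nbrs, L2.inner_def, ← integral_indicator (hm (-e))]
  refine integral_congr_ae ?_
  filter_upwards [coeFn_stepOp (e := -e) (ae_eq_refl g)] with ω h1
  by_cases hω : -e ∈ nbrs ω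
  · simp [hω, F]
  · rw [h1]
    simp [hω]

/-- The Markov operator on `L²`. -/
def markovL : L2 →L[ℝ] L2 := (1 / 4 : ℝ) • ∑ e ∈ steps, stepOp e

theorem markovL_apply (f : L2) : markovL f = (1 / 4 : ℝ) • ∑ e ∈ steps, stepOp e f := by
  simp [markovL]

/-- The gradient along one step. -/
def gradAt (e : Plane) : L2 →L[ℝ] L2 := stepOp e - nbrMask e

theorem gradAt_apply (e : Plane) (f : L2) : gradAt e f = stepOp e f - nbrMask e f := rfl

/-- The gradient along all steps. -/
def grad : L2 →L[ℝ] PiLp 2 (fun _ : steps => L2) :=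
  (PiLp.continuousLinearEquiv 2 ℝ (fun _ : steps => L2)).symm.toContinuousLinearMap.comp
    (ContinuousLinearMap.pi fun e : steps => gradAt e)

/-- The Dirichlet form of the reversible walk. The factor is `1/4`, the transition probability,
times `1/2`, since every edge is counted in both directions. -/
theorem inner_grad (f g : L2) :
    inner ℝ (f - markovL f) g = (1 / 8 : ℝ) * inner ℝ (grad f) (grad g) := by
  have h1 : inner ℝ (grad f) (grad g) = ∑ e ∈ steps, inner ℝ (gradAt e f) (gradAt e g) := by
    rw [PiLp.inner_apply, ← Finset.sum_coe_sort steps]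
    rfl
  have h2 : ∀ e, inner ℝ (gradAt e f) (gradAt e g) =
      inner ℝ (nbrMask (-e) f) g - inner ℝ (stepOp e f) g - inner ℝ (stepOp (-e) f) g +
        inner ℝ (nbrMask e f) g := by
    intro e
    rw [gradAt_apply, gradAt_apply, inner_sub_left, inner_sub_right, inner_sub_right]
    have e1 : inner ℝ (stepOp e f) (stepOp e g) = inner ℝ (nbrMask (-e) f) g := by
      have := inner_stepOp (-e) (stepOp e f) g
      rw [neg_neg] at this
      rw [← this, stepOp_neg_stepOp]
    have e2 : inner ℝ (stepOp e f) (nbrMask e g) = inner ℝ (stepOp e f) g := by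
      rw [← inner_nbrMask, nbrMask_stepOp]
    have e3 : inner ℝ (nbrMask e f) (stepOp e g) = inner ℝ (stepOp (-e) f) g := by
      rw [inner_nbrMask, nbrMask_stepOp, inner_stepOp, neg_neg]
    have e4 : inner ℝ (nbrMask e f) (nbrMask e g) = inner ℝ (nbrMask e f) g := by
      rw [← inner_nbrMask, nbrMask_nbrMask]
    rw [e1, e2, e3, e4]
    ring
  rw [h1, Finset.sum_congr rfl fun e _ => h2 e, Finset.sum_add_distrib, Finset.sum_sub_distrib,
    Finset.sum_sub_distrib, sum_steps_neg (fun e => inner ℝ (nbrMask e f) g),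
    sum_steps_neg (fun e => inner ℝ (stepOp e f) g), ← sum_inner, ← sum_inner, sum_nbrMask,
    inner_sub_left, markovL_apply, real_inner_smul_left, real_inner_smul_left]
  ring

/-- A constant function as an element of `L²`. -/
def constL (v : Plane) : L2 := (memLp_const v).toLp _

theorem coeFn_constL (v : Plane) : constL v =ᵐ[prob] fun _ => v := MemLp.coeFn_toLp _

/-- The drift as an element of `L²`. -/
def driftL : L2 := (1 / 4 : ℝ) • ∑ e ∈ steps, nbrMask e (constL e)

theorem stepOp_constL (e v : Plane) : stepOp e (constL v) = nbrMask e (constL v) := by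
  refine Lp.ext ?_
  filter_upwards [coeFn_stepOp (e := e) (coeFn_constL v),
    coeFn_maskOp (measurableSet_nbrs e) (coeFn_constL v)] with ω h1 h2
  rw [h1, nbrMask, h2]
  rfl

theorem constL_neg (v : Plane) : constL (-v) = -constL v := by
  refine Lp.ext ?_
  filter_upwards [coeFn_constL v, coeFn_constL (-v), Lp.coeFn_neg (constL v)] with ω h1 h2 h3
  rw [h2, h3, Pi.neg_apply, h1]

/-- The field of steps, with respect to which the drift is a divergence. -/
def stepField : PiLp 2 (fun _ : steps => L2) :=
  WithLp.toLp 2 fun e : steps => -nbrMask (e : Plane) (constL e)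

/-- Summation by parts: the step field is odd under reversal of an edge, so both ends of each edge
contribute equally. -/
theorem inner_driftL (g : L2) : inner ℝ driftL g = (1 / 8 : ℝ) * inner ℝ stepField (grad g) := by
  have h1 : inner ℝ stepField (grad g) =
      ∑ e ∈ steps, inner ℝ (-nbrMask e (constL e)) (gradAt e g) := by
    rw [PiLp.inner_apply, ← Finset.sum_coe_sort steps]
    rfl
  have h2 : ∀ e, inner ℝ (-nbrMask e (constL e)) (gradAt e g) =
      inner ℝ (nbrMask (-e) (constL (-e))) g + inner ℝ (nbrMask e (constL e)) g := by
    intro e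
    rw [gradAt_apply, inner_sub_right, inner_neg_left, inner_neg_left]
    have e1 : inner ℝ (nbrMask e (constL e)) (stepOp e g) =
        -inner ℝ (nbrMask (-e) (constL (-e))) g := by
      have h3 := inner_stepOp (-e) (constL e) g
      rw [neg_neg] at h3
      rw [inner_nbrMask, nbrMask_stepOp, ← h3, stepOp_constL, constL_neg, map_neg, inner_neg_left,
        neg_neg]
    have e2 : inner ℝ (nbrMask e (constL e)) (nbrMask e g) =
        inner ℝ (nbrMask e (constL e)) g := by
      rw [← inner_nbrMask, nbrMask_nbrMask]
    rw [e1, e2]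
    ring
  rw [h1, Finset.sum_congr rfl fun e _ => h2 e, Finset.sum_add_distrib,
    sum_steps_neg (fun e => inner ℝ (nbrMask e (constL e)) g), driftL, real_inner_smul_left,
    sum_inner]
  ring

theorem coeFn_driftL : driftL =ᵐ[prob] drift := by
  classical
  have h1 : ∀ᵐ ω ∂prob, ∀ e ∈ steps, nbrMask e (constL e) ω =
      {ω | e ∈ nbrs ω}.indicator (fun _ => e) ω :=
    (ae_ball_iff steps.countable_toSet).2 fun e _ =>
      coeFn_maskOp (measurableSet_nbrs e) (coeFn_constL e)
  filter_upwards [h1, Lp.coeFn_finsetSum steps fun e => nbrMask e (constL e),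
    Lp.coeFn_smul (1 / 4 : ℝ) (∑ e ∈ steps, nbrMask e (constL e))] with ω h1 h2 h3
  rw [driftL, h3, Pi.smul_apply, h2, Finset.sum_apply, Finset.sum_congr rfl h1, drift, finsum_nbrs]
  rfl

theorem coeFn_markovL {f : L2} {F : Config → Plane} (hf : f =ᵐ[prob] F) :
    markovL f =ᵐ[prob] markovOp F := by
  classical
  have h1 : ∀ᵐ ω ∂prob, ∀ e ∈ steps, stepOp e f ω =
      {ω | e ∈ nbrs ω}.indicator (F ∘ shift e) ω :=
    (ae_ball_iff steps.countable_toSet).2 fun e _ => coeFn_stepOp hf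
  filter_upwards [h1, Lp.coeFn_finsetSum steps fun e => stepOp e f,
    Lp.coeFn_smul (1 / 4 : ℝ) (∑ e ∈ steps, stepOp e f)] with ω h1 h2 h3
  rw [markovL_apply, h3, Pi.smul_apply, h2, Finset.sum_apply, Finset.sum_congr rfl h1, markovOp,
    finsum_nbrs]
  rfl

theorem resolvent_iff {ε : ℝ} {f : L2} {F : Config → Plane} (hf : f =ᵐ[prob] F) :
    (1 + ε) • f - markovL f = driftL ↔
      ∀ᵐ ω ∂prob, (1 + ε) • F ω - markovOp F ω = drift ω := by
  have h : ((1 + ε) • f - markovL f : L2) =ᵐ[prob] fun ω => (1 + ε) • F ω - markovOp F ω := by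
    filter_upwards [Lp.coeFn_sub ((1 + ε) • f) (markovL f), Lp.coeFn_smul (1 + ε) f,
      coeFn_markovL hf, hf] with ω h1 h2 h3 h4
    rw [h1, Pi.sub_apply, h2, Pi.smul_apply, h3, h4]
  rw [Lp.ext_iff]
  exact ⟨fun h' => h.symm.trans (h'.trans coeFn_driftL), fun h' =>
    h.trans (EventuallyEq.trans h' coeFn_driftL.symm)⟩

theorem exists_solvesResolvent {ε : ℝ} (hε : 0 < ε) :
    ∃ ψ : Config → Plane, SolvesResolvent ε ψ ∧
      ∀ φ : Config → Plane, SolvesResolvent ε φ → φ =ᵐ[prob] ψ := by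
  obtain ⟨f, hf, huniq⟩ := existsUnique_resolvent (by norm_num : (0 : ℝ) < 1 / 8) inner_grad hε driftL
  refine ⟨f, ⟨Lp.memLp f, (resolvent_iff (ae_eq_refl f)).1 hf⟩, fun φ ⟨hφ, hφ'⟩ => ?_⟩
  have := huniq (hφ.toLp φ) ((resolvent_iff hφ.coeFn_toLp).2 hφ')
  rw [← this]
  exact hφ.coeFn_toLp.symm

/-! ### Increments -/

/-- The operator `f ↦ 1{x ∈ H_ω} (f ∘ τ_x - f)`. -/
def incOp (x : Plane) : L2 →L[ℝ] L2 := centerOp x - maskOp (measurableSet_centers x)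

theorem coeFn_incOp {x : Plane} {f : L2} {F : Config → Plane} (hf : f =ᵐ[prob] F) :
    incOp x f =ᵐ[prob] increment F x := by
  filter_upwards [Lp.coeFn_sub (centerOp x f) (maskOp (measurableSet_centers x) f),
    coeFn_centerOp (x := x) hf, coeFn_maskOp (measurableSet_centers x) hf] with ω h1 h2 h3
  rw [incOp, sub_apply, h1, Pi.sub_apply, h2, h3, increment]
  by_cases hω : x ∈ centers ω <;> simp [hω]

/-- The function `1{e ∈ S_ω} (φ ∘ τ_e - φ)`. -/
def edgeGrad (φ : Config → Plane) (e : Plane) : Config → Plane :=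
  {ω | e ∈ nbrs ω}.indicator fun ω => φ (shift e ω) - φ ω

theorem edgeGrad_eq (φ : Config → Plane) (e : Plane) : edgeGrad φ e =
    {ω | e ∈ nbrs ω}.indicator (φ ∘ shift e) - {ω | e ∈ nbrs ω}.indicator φ :=
  Set.indicator_sub _ _ _

theorem memLp_edgeGrad {φ : Config → Plane} (hφ : MemLp φ 2 prob) (e : Plane) :
    MemLp (edgeGrad φ e) 2 prob := by
  rw [edgeGrad_eq]
  exact (memLp_pullback (measurableSet_nbrs e) (measurable_shift e) (map_shift_nbrs_le e) hφ).sub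
    (hφ.indicator (measurableSet_nbrs e))

theorem coeFn_gradAt {e : Plane} {f : L2} {F : Config → Plane} (hf : f =ᵐ[prob] F) :
    gradAt e f =ᵐ[prob] edgeGrad F e := by
  filter_upwards [Lp.coeFn_sub (stepOp e f) (nbrMask e f),
    coeFn_stepOp (e := e) hf, coeFn_maskOp (measurableSet_nbrs e) hf] with ω h1 h2 h3
  rw [gradAt_apply, h1, edgeGrad_eq, Pi.sub_apply, Pi.sub_apply, h2, nbrMask, h3]

theorem gradAt_eq_nbrMask_incOp (e : Plane) (f : L2) : gradAt e f = nbrMask e (incOp e f) := by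
  refine Lp.ext ?_
  filter_upwards [coeFn_gradAt (e := e) (ae_eq_refl f),
    coeFn_maskOp (measurableSet_nbrs e) (coeFn_incOp (x := e) (ae_eq_refl f))] with ω h1 h2
  rw [h1, nbrMask, h2, edgeGrad]
  by_cases hω : e ∈ nbrs ω
  · simp [hω, increment, nbrs_subset_centers ω hω]
  · simp [hω]

open Classical in
/-- The sums of `n` steps. -/
def reachSet : ℕ → Finset Plane
  | 0 => {0}
  | n + 1 => Finset.image₂ (· + ·) (reachSet n) steps

/-- Telescoping along the path. The path depends on `ω`; summing over all positions reachable in `j`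
steps and all steps avoids a measurable choice of it. -/
theorem norm_sub_le_of_linked (φ : Config → Plane) {ω : Config} {m : ℕ} {R R' : Rhombus}
    (h : Linked ω.tiles m R R') (h₀ : R.center = 0) : R'.center ∈ reachSet m ∧
      ‖φ (shift R'.center ω) - φ ω‖ ≤ ∑ j ∈ Finset.range m, ∑ y ∈ reachSet j, ∑ e ∈ steps,
        ‖{ω | y ∈ centers ω}.indicator (edgeGrad φ e ∘ shift y) ω‖ := by
  induction h with
  | refl _ => simp [reachSet, h₀, shift_zero]
  | @tail n R R' R'' hL hR'' hn ih =>
    obtain ⟨ih1, ih2⟩ := ih h₀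
    have hR' := hL.right_mem
    have hy : R'.center ∈ centers ω := ⟨R', hR', rfl⟩
    have hadd : R''.center - R'.center + R'.center = R''.center := sub_add_cancel _ _
    have he : R''.center - R'.center ∈ nbrs (shift R'.center ω) :=
      (mem_nbrs_shift hy).2 ⟨R', hR', R'', hR'', rfl, hadd.symm, hn⟩
    have hs := mem_steps_of_mem_nbrs he
    constructor
    · exact Finset.mem_image₂.2 ⟨_, ih1, _, hs, by rw [add_comm, hadd]⟩
    · have hc : R''.center - R'.center + R'.center ∈ centers ω := by
        rw [hadd]
        exact ⟨R'', hR'', rfl⟩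
      have hterm : ‖φ (shift R''.center ω) - φ (shift R'.center ω)‖ ≤
          ∑ y ∈ reachSet n, ∑ e ∈ steps,
            ‖{ω | y ∈ centers ω}.indicator (edgeGrad φ e ∘ shift y) ω‖ := by
        refine le_trans ?_ (Finset.single_le_sum (f := fun y => ∑ e ∈ steps,
          ‖{ω | y ∈ centers ω}.indicator (edgeGrad φ e ∘ shift y) ω‖)
          (fun _ _ => Finset.sum_nonneg fun _ _ => norm_nonneg _) ih1)
        refine le_trans (le_of_eq ?_) (Finset.single_le_sum (f := fun e =>
          ‖{ω | R'.center ∈ centers ω}.indicator (edgeGrad φ e ∘ shift R'.center) ω‖)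
          (fun _ _ => norm_nonneg _) hs)
        have h1 := shift_shift hy hc
        rw [hadd] at h1
        simp [hy, edgeGrad, he, h1]
      rw [Finset.sum_range_succ]
      have := norm_add_le (φ (shift R''.center ω) - φ (shift R'.center ω))
        (φ (shift R'.center ω) - φ ω)
      rw [sub_add_sub_cancel] at this
      linarith

/-- By invariance, an edge increment seen at `y` has norm at most that of the one at the origin; `K`
counts the positions, and does not depend on `φ`. -/
theorem exists_eLpNorm_increment_le (x : Plane) : ∃ K : ℕ, ∀ φ : Config → Plane, MemLp φ 2 prob →
    eLpNorm (increment φ x) 2 prob ≤ K * ∑ e ∈ steps, eLpNorm (edgeGrad φ e) 2 prob := by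
  obtain ⟨N, hN⟩ := exists_linked_center x
  refine ⟨∑ j ∈ Finset.range N, (reachSet j).card, fun φ hφ => ?_⟩
  let G : Plane → Plane → Config → Plane := fun y e =>
    {ω | y ∈ centers ω}.indicator (edgeGrad φ e ∘ shift y)
  have hG : ∀ y e, AEStronglyMeasurable (fun ω => ‖G y e ω‖) prob := fun y e =>
    (memLp_pullback (measurableSet_centers y) (measurable_shift y) (map_shift_centers_le y)
      (memLp_edgeGrad hφ e)).aestronglyMeasurable.norm
  have hG' : ∀ y e, eLpNorm (fun ω => ‖G y e ω‖) 2 prob ≤ eLpNorm (edgeGrad φ e) 2 prob := by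
    intro y e
    rw [eLpNorm_norm]
    exact eLpNorm_pullback_le (measurableSet_centers y) (measurable_shift y)
      (map_shift_centers_le y) (memLp_edgeGrad hφ e).aestronglyMeasurable
  have hpt : ∀ ω, ‖increment φ x ω‖ ≤
      ∑ j ∈ Finset.range N, ∑ y ∈ reachSet j, ∑ e ∈ steps, ‖G y e ω‖ := by
    intro ω
    by_cases hx : x ∈ centers ω
    · obtain ⟨m, hm, R, hR, R', hR', h0, rfl, hL⟩ := hN ω hx
      rw [increment, if_pos hx]
      refine (norm_sub_le_of_linked φ hL h0).2.trans ?_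
      exact Finset.sum_le_sum_of_subset_of_nonneg (Finset.range_mono hm) fun _ _ _ =>
        Finset.sum_nonneg fun _ _ => Finset.sum_nonneg fun _ _ => norm_nonneg _
    · rw [increment, if_neg hx, norm_zero]
      exact Finset.sum_nonneg fun _ _ => Finset.sum_nonneg fun _ _ =>
        Finset.sum_nonneg fun _ _ => norm_nonneg _
  have hsum : ∀ (ι : Type) (s : Finset ι) (F : ι → Config → ℝ),
      (∀ i ∈ s, AEStronglyMeasurable (F i) prob) →
      eLpNorm (fun ω => ∑ i ∈ s, F i ω) 2 prob ≤ ∑ i ∈ s, eLpNorm (F i) 2 prob := by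
    intro ι s F hF
    have := eLpNorm_sum_le hF (by norm_num : (1 : ℝ≥0∞) ≤ 2)
    have he : (∑ i ∈ s, F i) = fun ω => ∑ i ∈ s, F i ω := by
      ext ω
      simp
    rwa [he] at this
  have hm1 : ∀ y, AEStronglyMeasurable (fun ω => ∑ e ∈ steps, ‖G y e ω‖) prob := fun y =>
    Finset.aestronglyMeasurable_fun_sum _ fun e _ => hG y e
  have hm2 : ∀ j, AEStronglyMeasurable (fun ω => ∑ y ∈ reachSet j, ∑ e ∈ steps, ‖G y e ω‖) prob :=
    fun j => Finset.aestronglyMeasurable_fun_sum _ fun y _ => hm1 y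
  calc eLpNorm (increment φ x) 2 prob
      ≤ eLpNorm (fun ω => ∑ j ∈ Finset.range N, ∑ y ∈ reachSet j, ∑ e ∈ steps, ‖G y e ω‖) 2 prob :=
        eLpNorm_mono_real hpt
    _ ≤ ∑ j ∈ Finset.range N, ∑ y ∈ reachSet j, ∑ e ∈ steps, eLpNorm (edgeGrad φ e) 2 prob := by
        refine (hsum _ _ _ fun j _ => hm2 j).trans (Finset.sum_le_sum fun j _ => ?_)
        refine (hsum _ _ _ fun y _ => hm1 y).trans (Finset.sum_le_sum fun y _ => ?_)
        exact (hsum _ _ _ fun e _ => hG y e).trans (Finset.sum_le_sum fun e _ => hG' y e)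
    _ = _ := by
        simp only [Finset.sum_const, nsmul_eq_mul, ← Finset.sum_mul]
        push_cast
        rfl

theorem exists_norm_incOp_le (x : Plane) : ∃ K : ℝ, ∀ f : L2, ‖incOp x f‖ ≤ K * ‖grad f‖ := by
  obtain ⟨K, hK⟩ := exists_eLpNorm_increment_le x
  refine ⟨K * steps.card, fun f => ?_⟩
  have h1 := hK f (Lp.memLp f)
  have h2 : ∀ e, eLpNorm (edgeGrad f e) 2 prob = eLpNorm (gradAt e f) 2 prob := fun e =>
    eLpNorm_congr_ae (coeFn_gradAt (ae_eq_refl f)).symm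
  rw [← eLpNorm_congr_ae (coeFn_incOp (x := x) (ae_eq_refl f))] at h1
  simp only [h2] at h1
  have h3 : ‖incOp x f‖ ≤ K * ∑ e ∈ steps, ‖gradAt e f‖ := by
    simp only [Lp.norm_def]
    rw [← ENNReal.toReal_sum fun e _ => Lp.eLpNorm_ne_top _, ← ENNReal.toReal_natCast K,
      ← ENNReal.toReal_mul]
    exact ENNReal.toReal_mono (ENNReal.mul_ne_top (ENNReal.natCast_ne_top K)
      (ENNReal.sum_ne_top.2 fun e _ => Lp.eLpNorm_ne_top _)) h1
  refine h3.trans ?_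
  rw [mul_assoc]
  refine mul_le_mul_of_nonneg_left ?_ (Nat.cast_nonneg K)
  rw [← nsmul_eq_mul]
  refine Finset.sum_le_card_nsmul _ _ _ fun e he => ?_
  exact PiLp.norm_apply_le (grad f) (⟨e, he⟩ : steps)

/-! ### The corrector -/

theorem memLp_increment {φ : Config → Plane} (hφ : MemLp φ 2 prob) (x : Plane) :
    MemLp (increment φ x) 2 prob :=
  (memLp_congr_ae (coeFn_incOp (x := x) hφ.coeFn_toLp)).1 (Lp.memLp _)

theorem increment_cocycle (φ : Config → Plane) {x y : Plane} {ω : Config} (hx : x ∈ centers ω)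
    (hy : y ∈ centers ω) :
    increment φ x ω - increment φ y ω = increment φ (x - y) (shift y ω) := by
  have hxy : x - y + y ∈ centers ω := by rwa [sub_add_cancel]
  rw [increment, increment, increment, if_pos hx, if_pos hy, if_pos ((mem_centers_shift hy).2 hxy),
    shift_shift hy hxy, sub_add_cancel, sub_sub_sub_cancel_right]

theorem ae_centers {P : Plane → Config → Prop} (h : ∀ x ∈ allCenters, ∀ᵐ ω ∂prob,
    x ∈ centers ω → P x ω) : ∀ᵐ ω ∂prob, ∀ x ∈ centers ω, P x ω := by
  filter_upwards [(ae_ball_iff countable_allCenters).2 h] with ω hω x hx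
  exact hω x (mem_allCenters hx) hx

theorem ae_shift {P : Config → Prop} (h : ∀ᵐ ω ∂prob, P ω) :
    ∀ᵐ ω ∂prob, ∀ x ∈ centers ω, P (shift x ω) :=
  ae_centers fun x _ => ae_of_map_restrict_le (measurableSet_centers x) (measurable_shift x)
    (map_shift_centers_le x) h

section Limits

variable {f : ℝ → L2} {q : Plane → L2}

/-- For each `ε` the identity holds exactly for increments. After masking, both sides are continuous
operators on L², so it survives the limit for each pair, and there are countably many pairs. -/
theorem ae_cocycle
    (hq : ∀ x ∈ allCenters, Tendsto (fun ε => incOp x (f ε)) (𝓝[>] 0) (𝓝 (q x))) : ∀ᵐ ω ∂prob, ∀ x ∈ centers ω, ∀ y ∈ centers ω,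
    q x ω - q y ω = q (x - y) (shift y ω) := by
  have key : ∀ x ∈ allCenters, ∀ y ∈ allCenters, ∀ᵐ ω ∂prob, x ∈ centers ω → y ∈ centers ω →
      q x ω - q y ω = q (x - y) (shift y ω) := by
    intro x hx y hy
    -- Otherwise `x` and `y` are never centers of the same configuration.
    by_cases hxy : x - y ∈ allCenters
    · have hm : MeasurableSet {ω | x ∈ centers ω ∧ y ∈ centers ω} :=
        (measurableSet_centers x).inter (measurableSet_centers y)
      have hop : ∀ g : L2, maskOp hm (incOp x g - incOp y g) =
          maskOp hm (centerOp y (incOp (x - y) g)) := by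
        intro g
        refine Lp.ext ?_
        have h1 := (Lp.coeFn_sub (incOp x g) (incOp y g)).trans
          ((coeFn_incOp (x := x) (ae_eq_refl g)).sub (coeFn_incOp (x := y) (ae_eq_refl g)))
        have h2 := coeFn_centerOp (x := y) (coeFn_incOp (x := x - y) (ae_eq_refl g))
        filter_upwards [coeFn_maskOp hm h1, coeFn_maskOp hm h2] with ω h1 h2
        rw [h1, h2]
        by_cases hω : x ∈ centers ω ∧ y ∈ centers ω
        · have := increment_cocycle g hω.1 hω.2
          simp [hω.1, hω.2, this]
        · simp [hω]
      have hlim : maskOp hm (q x - q y) = maskOp hm (centerOp y (q (x - y))) := by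
        refine tendsto_nhds_unique (f := fun ε => maskOp hm (incOp x (f ε) - incOp y (f ε)))
          (((maskOp hm).continuous.tendsto _).comp ((hq x hx).sub (hq y hy))) ?_
        simp only [hop]
        exact ((maskOp hm).continuous.tendsto _).comp
          (((centerOp y).continuous.tendsto _).comp (hq _ hxy))
      filter_upwards [coeFn_maskOp hm (Lp.coeFn_sub (q x) (q y)),
        coeFn_maskOp hm (coeFn_centerOp (x := y) (ae_eq_refl (q (x - y))))] with ω h1 h2 hx hy
      rw [hlim, h2] at h1
      simpa [hx, hy] using h1.symm
    · refine Eventually.of_forall fun ω hx hy => absurd ?_ hxy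
      exact mem_allCenters ((mem_centers_shift hy).2 (by rwa [sub_add_cancel]))
  filter_upwards [(ae_ball_iff countable_allCenters).2 fun x hx =>
    (ae_ball_iff countable_allCenters).2 fun y hy => key x hx y hy] with ω hω x hx y hy
  exact hω x (mem_allCenters hx) y (mem_allCenters hy) hx hy

/-- The average of the increments over the neighbors is `(Q - 1) ψ = ε ψ - V`, which tends to `-V`.
-/
theorem ae_drift
    (hq : ∀ x ∈ allCenters, Tendsto (fun ε => incOp x (f ε)) (𝓝[>] 0) (𝓝 (q x)))
    (hf : ∀ ε : ℝ, 0 < ε → (1 + ε) • f ε - markovL (f ε) = driftL)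
    (hf₀ : Tendsto (fun ε => ε • f ε) (𝓝[>] 0) (𝓝 0)) :
    ∀ᵐ ω ∂prob, ∑ᶠ e ∈ nbrs ω, (e + q e ω) = 0 := by
  classical
  have hop : ∀ g : L2, (1 / 4 : ℝ) • ∑ e ∈ steps, nbrMask e (incOp e g) = markovL g - g := by
    intro g
    simp only [← gradAt_eq_nbrMask_incOp, gradAt_apply, Finset.sum_sub_distrib, sum_nbrMask,
      markovL_apply, smul_sub, smul_smul]
    norm_num
  have hsteps : ∀ e ∈ steps, e ∈ allCenters := by
    intro e he
    obtain ⟨ω, hω⟩ := mem_steps.1 he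
    exact mem_allCenters (nbrs_subset_centers ω hω)
  have hlim : (1 / 4 : ℝ) • ∑ e ∈ steps, nbrMask e (q e) = -driftL := by
    refine tendsto_nhds_unique
      (f := fun ε => (1 / 4 : ℝ) • ∑ e ∈ steps, nbrMask e (incOp e (f ε)))
      ((tendsto_finsetSum steps fun e he =>
        ((nbrMask e).continuous.tendsto _).comp (hq e (hsteps e he))).const_smul _) ?_
    have h2 : Tendsto (fun ε => ε • f ε - driftL) (𝓝[>] 0) (𝓝 (0 - driftL)) :=
      hf₀.sub_const driftL
    rw [zero_sub] at h2
    refine h2.congr' ?_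
    filter_upwards [self_mem_nhdsWithin] with ε hε
    rw [hop, ← hf ε hε]
    module
  have h1 : ∀ᵐ ω ∂prob, ∀ e ∈ steps, nbrMask e (q e) ω =
      {ω | e ∈ nbrs ω}.indicator (q e) ω :=
    (ae_ball_iff steps.countable_toSet).2 fun e _ =>
      coeFn_maskOp (measurableSet_nbrs e) (ae_eq_refl _)
  filter_upwards [h1, Lp.coeFn_finsetSum steps fun e => nbrMask e (q e),
    Lp.coeFn_smul (1 / 4 : ℝ) (∑ e ∈ steps, nbrMask e (q e)), Lp.coeFn_neg driftL, coeFn_driftL]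
    with ω h1 h2 h3 h4 h5
  rw [hlim, h4, Pi.neg_apply, h5, Pi.smul_apply, h2, Finset.sum_apply, Finset.sum_congr rfl h1,
    drift, finsum_nbrs] at h3
  rw [finsum_nbrs]
  have h6 : ∀ e, (if e ∈ nbrs ω then e + q e ω else 0) =
      (if e ∈ nbrs ω then e else 0) + {ω | e ∈ nbrs ω}.indicator (q e) ω := by
    intro e
    by_cases h : e ∈ nbrs ω <;> simp [h]
  simp only [h6, Finset.sum_add_distrib]
  rw [← smul_neg] at h3
  rw [← smul_right_injective Plane (by norm_num : (1 / 4 : ℝ) ≠ 0) h3, add_neg_cancel]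

end Limits

/-- The cocycle identity moves harmonicity at `x` to the origin of `shift x ω`, where the mean of `e
+ χ e` over the neighbors vanishes. -/
theorem isHarmonic_of_cocycle {χ : Plane → Config → Plane} {ω : Config}
    (h₁ : ∀ x ∈ centers ω, ∀ y ∈ centers ω, χ x ω - χ y ω = χ (x - y) (shift y ω))
    (h₂ : ∀ x ∈ centers ω, ∑ᶠ e ∈ nbrs (shift x ω), (e + χ e (shift x ω)) = 0) :
    IsHarmonic ω (fun x => x + χ x ω) := by
  classical
  intro x hx
  have h3 : ∑ᶠ e : Plane, transProb ω x e • (x + e + χ (x + e) ω) =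
      ∑ e ∈ steps, if e ∈ nbrs (shift x ω) then (1 / 4 : ℝ) • (x + e + χ (x + e) ω) else 0 := by
    rw [finsum_eq_sum_of_support_subset (s := steps)]
    · refine Finset.sum_congr rfl fun e _ => ?_
      unfold transProb
      split_ifs <;> simp
    · intro e he
      refine mem_steps_of_mem_nbrs (ω := shift x ω) ?_
      by_contra hne
      exact he (by simp [transProb, hne])
  have h4 : ∀ e ∈ steps,
      (if e ∈ nbrs (shift x ω) then (1 / 4 : ℝ) • (x + e + χ (x + e) ω) else 0) =
      (if e ∈ nbrs (shift x ω) then (1 / 4 : ℝ) • (x + χ x ω) else 0) +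
        (1 / 4 : ℝ) • (if e ∈ nbrs (shift x ω) then e + χ e (shift x ω) else 0) := by
    intro e _
    split_ifs with he
    · have hxe : x + e ∈ centers ω := by
        rw [add_comm]
        exact (mem_centers_shift hx).1 (nbrs_subset_centers _ he)
      have := h₁ _ hxe x hx
      rw [add_sub_cancel_left] at this
      rw [← this]
      module
    · simp
  have h5 := h₂ x hx
  rw [finsum_nbrs] at h5
  simp only
  rw [h3, Finset.sum_congr rfl h4, Finset.sum_add_distrib, ← Finset.smul_sum, h5, sum_steps_const,
    smul_zero, add_zero, ← Nat.cast_smul_eq_nsmul ℝ, smul_smul]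
  norm_num

/-- By the cocycle identity the increment over `e` at `x` is `χ e` seen from `x`, whose norm is at
most that of `χ e`. Only finitely many steps occur. -/
theorem exists_eLpNorm_edgeIncrement_lt {χ : Plane → Config → Plane}
    (hχ : ∀ x ∈ allCenters, MemLp (χ x) 2 prob)
    (h : ∀ᵐ ω ∂prob, ∀ x ∈ centers ω, ∀ y ∈ centers ω, χ x ω - χ y ω = χ (x - y) (shift y ω)) :
    ∃ C : ℝ≥0, ∀ x ∈ allCenters, ∀ e ∈ allSteps, eLpNorm (edgeIncrement χ x e) 2 prob < C := by
  have hsteps : ∀ e ∈ steps, e ∈ allCenters := by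
    intro e he
    obtain ⟨ω, hω⟩ := mem_steps.1 he
    exact mem_allCenters (nbrs_subset_centers ω hω)
  have hfin : ∑ e ∈ steps, eLpNorm (χ e) 2 prob ≠ ∞ :=
    ENNReal.sum_ne_top.2 fun e he => (hχ e (hsteps e he)).eLpNorm_ne_top
  -- The summand 1 makes the inequality strict.
  refine ⟨(∑ e ∈ steps, eLpNorm (χ e) 2 prob).toNNReal + 1, fun x _ e he => ?_⟩
  have h1 : eLpNorm (edgeIncrement χ x e) 2 prob ≤
      eLpNorm ({ω | x ∈ centers ω}.indicator (χ e ∘ shift x)) 2 prob := by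
    refine eLpNorm_mono_ae ?_
    filter_upwards [h] with ω hω
    unfold edgeIncrement
    split_ifs with hc
    · have hxe : x + e ∈ centers ω := by
        rw [add_comm]
        exact (mem_centers_shift hc.1).1 (nbrs_subset_centers _ hc.2)
      rw [hω _ hxe x hc.1, add_sub_cancel_left]
      simp [hc.1]
    · simp
  have h2 := eLpNorm_pullback_le (measurableSet_centers x) (measurable_shift x)
    (map_shift_centers_le x) (hχ e (hsteps e (mem_steps.2 he))).aestronglyMeasurable
  have h3 := Finset.single_le_sum (f := fun e => eLpNorm (χ e) 2 prob)
    (fun _ _ => zero_le) (mem_steps.2 he)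
  refine ((h1.trans h2).trans h3).trans_lt ?_
  rw [ENNReal.coe_add, ENNReal.coe_toNNReal hfin, ENNReal.coe_one]
  exact ENNReal.lt_add_right hfin one_ne_zero

end Penrose

end

/-! ### Existence of the corrector -/

theorem mainTheorem5 :
    (∀ ε : ℝ, 0 < ε → ∃ ψ : Config → Plane, SolvesResolvent ε ψ ∧
      ∀ φ : Config → Plane, SolvesResolvent ε φ → φ =ᵐ[prob] ψ) ∧
    ∀ ψ : ℝ → Config → Plane, (∀ ε : ℝ, 0 < ε → SolvesResolvent ε (ψ ε)) →
      ∃ χ : Plane → Config → Plane,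
        (∀ x ∈ allCenters,
          (∀ ε : ℝ, 0 < ε → MemLp (increment (ψ ε) x) 2 prob) ∧
          MemLp (χ x) 2 prob ∧
          Tendsto (fun ε : ℝ => eLpNorm (fun ω => increment (ψ ε) x ω - χ x ω) 2 prob)
            (𝓝[>] 0) (𝓝 0)) ∧
        (∀ᵐ ω ∂prob, ∀ x ∈ centers ω, ∀ y ∈ centers ω,
          χ x ω - χ y ω = χ (x - y) (shift y ω)) ∧
        (∀ᵐ ω ∂prob, IsHarmonic ω (fun x => x + χ x ω)) ∧
        (∃ C : ℝ≥0, ∀ x ∈ allCenters, ∀ e ∈ allSteps,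
          eLpNorm (edgeIncrement χ x e) 2 prob < C) := by
  refine ⟨fun ε hε => exists_solvesResolvent hε, fun ψ hψ => ?_⟩
  obtain ⟨p, hp⟩ := exists_tendsto_resolvent (by norm_num : (0 : ℝ) < 1 / 8) inner_grad inner_driftL
  -- The values of `f` at `ε ≤ 0` are arbitrary and invisible to the one-sided limit.
  choose! f hf using fun (ε : ℝ) (hε : 0 < ε) =>
    (⟨(hψ ε hε).1.toLp (ψ ε), (hψ ε hε).1.coeFn_toLp⟩ : ∃ f : L2, f =ᵐ[prob] ψ ε)
  have hres : ∀ ε : ℝ, 0 < ε → (1 + ε) • f ε - markovL (f ε) = driftL := fun ε hε =>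
    (resolvent_iff (hf ε hε)).2 (hψ ε hε).2
  obtain ⟨hgrad, hzero⟩ := hp f hres
  have hlim : ∀ x, ∃ q : L2, Tendsto (fun ε => incOp x (f ε)) (𝓝[>] 0) (𝓝 q) := by
    intro x
    obtain ⟨K, hK⟩ := exists_norm_incOp_le x
    exact exists_tendsto_of_norm_le hK hgrad
  choose q hq using hlim
  have hcoc := ae_cocycle (fun x _ => hq x)
  refine ⟨fun x => q x, fun x _ => ⟨fun ε hε => memLp_increment (hψ ε hε).1 x, Lp.memLp _, ?_⟩,
    hcoc, ?_, exists_eLpNorm_edgeIncrement_lt (fun x _ => Lp.memLp _) hcoc⟩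
  · refine ((Lp.tendsto_Lp_iff_tendsto_eLpNorm' _ _).1 (hq x)).congr' ?_
    filter_upwards [self_mem_nhdsWithin] with ε hε
    refine eLpNorm_congr_ae ?_
    filter_upwards [coeFn_incOp (x := x) (hf ε hε)] with ω hω
    rw [Pi.sub_apply, hω]
  · filter_upwards [hcoc, ae_shift (ae_drift (fun x _ => hq x) hres hzero)] with ω h1 h2
    exact isHarmonic_of_cocycle (χ := fun x => q x) h1 h2
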